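/- Let $M$ be a smooth Hausdorff manifold of dimension $m$, let $\mathcal V$ be a smooth involutive distribution of rank $n$ on $M$ and let $F$ be a smooth vector field on $M$. Let $\mathcal W=\mathcal V+[F,\mathcal V]$, i.e. $\mathcal W_z$ is spanned by the values at $z$ of the vector fields $V_1+[F,V_2]$ with $V_1,V_2\in\mathcal V$. Assume that $\dim\mathcal W_z=2n$ for every $z\in M$ (so that $\mathcal W$ is a distribution and $2n\le m$ if $M\neq\emptyset$), that $\mathcal W$ is involutive and that $[F,\mathcal W]\subset\mathcal W$. Let $S$ be the unique $(1,1)$-tensor field on $\mathcal W$ with $S(V)=0$ and $S([F,V])=-V$ for $V\in\mathcal V$. Put $(\mathcal L_FS)(X)=[F,S(X)]-S([F,X])$ for $X\in\mathcal W$; then $P_{\mathcal H}=\frac12(\mathrm{id}-\mathcal L_FS)$ and $P_{\mathcal V}=\frac12(\mathrm{id}+\mathcal L_FS)$ are complementary projectors of $\mathcal W$, with images $\mathcal H$ and $\mathcal V$. For $V\in\mathcal V$ let $V^{h}$ be the unique section of $\mathcal H$ with $S(V^{h})=V$ (explicitly $V^h=-P_{\mathcal H}[F,V]$). The induced $\mathcal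 W$-connection $\nabla$ on $\mathcal V$ and its mixed curvature $\theta$ are $$\nabla_XV=P_{\mathcal V}\big([P_{\mathcal H}X,V]\big)+S\big([P_{\mathcal V}X,V^{h}]\big),\qquad X\in\mathcal W,\ V\in\mathcal V,$$ $$\theta(V_1,V_2)V_3=\nabla_{V_1^{h}}\nabla_{V_2}V_3-\nabla_{V_2}\nabla_{V_1^{h}}V_3-\nabla_{[V_1^{h},V_2]}V_3,\qquad V_1,V_2,V_3\in\mathcal V .$$ Below, adapted coordinates are smooth local coordinates $(t,x,y)=(t^1,\dots,t^{m-2n},x^1,\dots,x^n,y^1,\dots,y^n)$ on an open subset of $M$ such that $\mathcal V$ is spanned by $\partial/\partial y^1,\dots,\partial/\partial y^n$ there; and $f^k$ is called quadratic if $$f^k=\Gamma^k_{ij}(t,x)\,y^iy^j+P^k_i(t,x)\,y^i+Q^k(t,x),\qquad k=1,\dots,n,$$ with smooth functions $\Gamma^k_{ij},P^k_i,Q^k$ of $(t,x)$ only. Let $O\subset M$ be open (for instance $O=M$). 1. Suppose $F(z)\in\mathcal W_z$ for all $z\in O$. Then every point of $O$ has a neighbourhood with adapted coordinates in which $$F=y^i\frac{\partial}{\partial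 x^i}+f^i\frac{\partial}{\partial y^i}\quad\text{with }f^k\text{ quadratic}$$ if and only if $\theta=0$ on $O$. 2. Suppose $F(z)\notin\mathcal W_z$ for all $z\in O$. Then every point of $O$ has a neighbourhood with adapted coordinates in which, for one of the coordinates $t^p$ (which may be numbered $t^1$), $$F=\frac{\partial}{\partial t^1}+y^i\frac{\partial}{\partial x^i}+f^i\frac{\partial}{\partial y^i}\quad\text{with }f^k\text{ quadratic}$$ if and only if $\theta=0$ on $O$. -/

import Mathlib

open scoped Manifold ContDiff Topology

noncomputable section

namespace SecondOrder

/-- Vector fields (no regularity imposed) on a manifold `M` of dimension `m`. -/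
abbrev VField (m : ℕ) (M : Type*) [TopologicalSpace M]
    [ChartedSpace (EuclideanSpace ℝ (Fin m)) M] : Type _ :=
  (z : M) → TangentSpace (𝓡 m) z

/-- Fields of linear subspaces of the tangent spaces of `M`. -/
abbrev SubspaceField (m : ℕ) (M : Type*) [TopologicalSpace M]
    [ChartedSpace (EuclideanSpace ℝ (Fin m)) M] : Type _ :=
  (z : M) → Submodule ℝ (TangentSpace (𝓡 m) z)

variable {m : ℕ} {M : Type*} [TopologicalSpace M] [ChartedSpace (EuclideanSpace ℝ (Fin m)) M]

/-- The Lie bracket `[X, Y]` of vector fields. -/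
abbrev br (X Y : VField m M) : VField m M := VectorField.mlieBracket (𝓡 m) X Y

/-- Smooth vector fields. -/
def IsSmooth [IsManifold (𝓡 m) ∞ M] (X : VField m M) : Prop :=
  ContMDiff (𝓡 m) (𝓡 m).tangent ∞ (fun z => (⟨z, X z⟩ : TangentBundle (𝓡 m) M))

/-- A distribution of dimension `n`: a field of subspaces which near every point has a smooth local
basis of `n` vector fields. -/
def IsDistribution [IsManifold (𝓡 m) ∞ M] (n : ℕ) (D : SubspaceField m M) : Prop :=
  ∀ z : M, ∃ U : Set M, IsOpen U ∧ z ∈ U ∧ ∃ X : Fin n → VField m M,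
    (∀ i, ContMDiffOn (𝓡 m) (𝓡 m).tangent ∞
      (fun z => (⟨z, X i z⟩ : TangentBundle (𝓡 m) M)) U) ∧
    ∀ z' ∈ U, LinearIndependent ℝ (fun i => X i z') ∧
      Submodule.span ℝ (Set.range fun i => X i z') = D z'

/-- `X` is a smooth vector field belonging to `D`. -/
def IsSection [IsManifold (𝓡 m) ∞ M] (D : SubspaceField m M) (X : VField m M) : Prop :=
  IsSmooth X ∧ ∀ z, X z ∈ D z

/-- `[D, D] ⊆ D`. -/
def Involutive [IsManifold (𝓡 m) ∞ M] (D : SubspaceField m M) : Prop :=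
  ∀ X Y : VField m M, IsSection D X → IsSection D Y → ∀ z, br X Y z ∈ D z

/-- `[F, D] ⊆ D`. -/
def Preserves [IsManifold (𝓡 m) ∞ M] (F : VField m M) (D : SubspaceField m M) : Prop :=
  ∀ X : VField m M, IsSection D X → ∀ z, br F X z ∈ D z

/-- `𝒲 = 𝒱 + [F, 𝒱]`: at each point the span of the values of the fields `V₁ + [F, V₂]`, with
`V₁, V₂` in `𝒱`. -/
def derived [IsManifold (𝓡 m) ∞ M] (F : VField m M) (D : SubspaceField m M) :
    SubspaceField m M :=
  fun z => Submodule.span ℝ {w | ∃ V₁ V₂ : VField m M,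
    IsSection D V₁ ∧ IsSection D V₂ ∧ w = V₁ z + br F V₂ z}

open Classical in
/-- The tensor `S` on `𝒲 = 𝒱 + [F, 𝒱]` with `S V = 0` and `S [F, V] = -V` for `V` in `𝒱`: a vector
`w = V₁(z) + [F, V₂](z)` of `𝒲` is sent to `-V₂(z)`, and this does not depend on the choice of
`V₁, V₂` when `𝒱` is a distribution of dimension `n` and `𝒲` has dimension `2n` everywhere.
(Tangent vectors outside `𝒲` get the value `0`, which is never used there.) -/
def tensorS [IsManifold (𝓡 m) ∞ M] (F : VField m M) (D : SubspaceField m M) (z : M)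
    (w : TangentSpace (𝓡 m) z) : TangentSpace (𝓡 m) z :=
  if h : ∃ V₂ : VField m M, IsSection D V₂ ∧
      ∃ V₁ : VField m M, IsSection D V₁ ∧ w = V₁ z + br F V₂ z
  then -(h.choose z) else 0

section operators

variable [IsManifold (𝓡 m) ∞ M] (F : VField m M) (D : SubspaceField m M)

/-- `S` acting on vector fields. -/
def opS (X : VField m M) : VField m M := fun z => tensorS F D z (X z)

/-- The Lie derivative `(L_F S) X = [F, S X] - S [F, X]`. -/
def lieS (X : VField m M) : VField m M := br F (opS F D X) - opS F D (br F X)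

/-- The projector `P_H = (id - L_F S) / 2` of `𝒲` onto the horizontal distribution. -/
def projH (X : VField m M) : VField m M := (1 / 2 : ℝ) • (X - lieS F D X)

/-- The projector `P_V = (id + L_F S) / 2` of `𝒲` onto `𝒱`. -/
def projV (X : VField m M) : VField m M := (1 / 2 : ℝ) • (X + lieS F D X)

/-- The horizontal lift of `V` in `𝒱`: the horizontal field `V^h` with `S (V^h) = V`. Since
`S (-[F, V]) = V` and `S` vanishes on the image `𝒱` of `P_V`, it is `P_H (-[F, V])`. -/
def hlift (V : VField m M) : VField m M := projH F D (-(br F V))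

/-- The induced `𝒲`-connection on `𝒱`: `∇_X V = P_V [P_H X, V] + S [P_V X, V^h]`. -/
def nabla (X V : VField m M) : VField m M :=
  projV F D (br (projH F D X) V) + opS F D (br (projV F D X) (hlift F D V))

/-- The mixed curvature
`θ(V₁, V₂) V₃ = ∇_{V₁^h} ∇_{V₂} V₃ - ∇_{V₂} ∇_{V₁^h} V₃ - ∇_{[V₁^h, V₂]} V₃`. -/
def mixedCurvature (V₁ V₂ V₃ : VField m M) : VField m M :=
  nabla F D (hlift F D V₁) (nabla F D V₂ V₃) - nabla F D V₂ (nabla F D (hlift F D V₁) V₃)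
    - nabla F D (br (hlift F D V₁) V₂) V₃

/-- `θ` vanishes at `z`. -/
def MixedCurvatureVanishesAt (z : M) : Prop :=
  ∀ V₁ V₂ V₃ : VField m M, IsSection D V₁ → IsSection D V₂ → IsSection D V₃ →
    mixedCurvature F D V₁ V₂ V₃ z = 0

end operators

/-- The space of values of the coordinates `(t, x, y)`: `p` parameters `t`, then `x` and `y`
with `n` components each. -/
abbrev CoordSpace (p n : ℕ) : Type := (Fin p → ℝ) × (Fin n → ℝ) × (Fin n → ℝ)

/-- Local coordinates `(t, x, y)` on an open subset of `M`. -/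
abbrev Coords (m : ℕ) (M : Type*) [TopologicalSpace M] [ChartedSpace (EuclideanSpace ℝ (Fin m)) M]
    (p n : ℕ) : Type _ :=
  PartialDiffeomorph (𝓡 m) 𝓘(ℝ, CoordSpace p n) M (CoordSpace p n) ∞

/-- The components of a tangent vector `v` at `z` in the coordinates `Φ`. -/
def comps {p n : ℕ} (Φ : Coords m M p n) (z : M) (v : TangentSpace (𝓡 m) z) : CoordSpace p n :=
  mfderiv (𝓡 m) 𝓘(ℝ, CoordSpace p n) Φ z v

/-- The coordinate fields `∂/∂y^i` span the subspaces `D` on the domain of the coordinates. -/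
def Adapted {p n : ℕ} (D : SubspaceField m M) (Φ : Coords m M p n) : Prop :=
  ∀ z ∈ Φ.source, ∀ v : TangentSpace (𝓡 m) z,
    v ∈ D z ↔ (comps Φ z v).1 = 0 ∧ (comps Φ z v).2.1 = 0

/-- In the coordinates `Φ = (t, x, y)`, in which `D` is spanned by the `∂/∂y^i`,
`F = c^p ∂/∂t^p + y^i ∂/∂x^i + f^i ∂/∂y^i` with `c` a constant vector and
`f^k = Γ^k_{ij} y^i y^j + P^k_i y^i + Q^k`, where `Γ`, `P`, `Q` are smooth functions of `(t, x)`. -/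
def IsQuadraticIn {p n : ℕ} (F : VField m M) (D : SubspaceField m M) (c : Fin p → ℝ)
    (Φ : Coords m M p n) : Prop :=
  Adapted D Φ ∧
  ∃ (Γ : Fin n → Fin n → Fin n → (Fin p → ℝ) × (Fin n → ℝ) → ℝ)
    (P : Fin n → Fin n → (Fin p → ℝ) × (Fin n → ℝ) → ℝ)
    (Q : Fin n → (Fin p → ℝ) × (Fin n → ℝ) → ℝ),
    (∀ k i j, ContDiffOn ℝ ∞ (Γ k i j) ((fun a => (a.1, a.2.1)) '' Φ.target)) ∧
    (∀ k i, ContDiffOn ℝ ∞ (P k i) ((fun a => (a.1, a.2.1)) '' Φ.target)) ∧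
    (∀ k, ContDiffOn ℝ ∞ (Q k) ((fun a => (a.1, a.2.1)) '' Φ.target)) ∧
    ∀ z ∈ Φ.source, ∀ t x y, Φ z = (t, x, y) →
      comps Φ z (F z) =
        (c, y, fun k => (∑ i, ∑ j, Γ k i j (t, x) * y i * y j) + (∑ i, P k i (t, x) * y i)
          + Q k (t, x))

/-- Near `z` there are coordinates `(t, x, y)` in which
`F = y^i ∂/∂x^i + f^i ∂/∂y^i` with `f` quadratic in `y`; the `t^p` are mere parameters. -/
def QuadraticNear (n : ℕ) (F : VField m M) (D : SubspaceField m M) (z : M) : Prop :=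
  ∃ Φ : Coords m M (m - 2 * n) n, z ∈ Φ.source ∧ IsQuadraticIn F D 0 Φ

/-- Near `z` there are coordinates `(t, x, y)` in which
`F = ∂/∂t^p + y^i ∂/∂x^i + f^i ∂/∂y^i` for one of the `t^p` (the time), with `f` quadratic in `y`;
the other `t^q` are mere parameters. -/
def TimeDependentQuadraticNear (n : ℕ) (F : VField m M) (D : SubspaceField m M) (z : M) : Prop :=
  ∃ p : Fin (m - 2 * n), ∃ Φ : Coords m M (m - 2 * n) n,
    z ∈ Φ.source ∧ IsQuadraticIn F D (Pi.single p 1) Φ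

end SecondOrder

end

/-! The proof rests on coordinates in which `F = c ∂/∂t + y ∂/∂x + f ∂/∂y` with `c` constant and `D`
is spanned by the `∂/∂y`. There `S` sends `∂/∂x^i` to `∂/∂y^i`, the horizontal fields are spanned by
`∂/∂x^i + ½ (∂f^k/∂y^i) ∂/∂y^k`, and the connection is the plain derivative corrected by `-½
∂²f/∂y∂y`. Hence the mixed curvature has components `½ ∂³f/∂y∂y∂y` (`HasComps.mixedCurvature`). It
vanishes exactly when `f` is, locally, a quadratic polynomial in `y` with coefficients depending on
`(t, x)`, by Taylor's formula on a box (`exists_quadraticMap_eq`). Quadratic coordinates thus force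
`θ = 0`, and conversely any such coordinates are already quadratic when `θ = 0`; no further change
of coordinates is needed.

Such coordinates exist by the Frobenius theorem (`exists_first_integrals`). First integrals of `𝒲`
give `t`; first integrals `x` of `𝒱` are chosen so that `dx` is nondegenerate on the `[F, Xᵢ]`; and
`y = dx(F)`. Since `Xᵢ x = 0`, one has `Xᵢ y = -dx([F, Xᵢ])`, so `(t, x, y)` is a local
diffeomorphism (`exists_secondOrder_coordinates`). If `F` lies in `𝒲`, then `dt(F) = 0`. If `F` is
transverse to `𝒲`, a function `σ` with `dσ = 0` on `𝒲` and `dσ(F) = 1` is completed by first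
integrals of `𝒲 ⊕ ℝF`, which is involutive because `F` preserves `𝒲` (`exists_time_submersion`).

The Frobenius theorem itself is proved by transport along rays. A distribution that is the graph of
`A` over the first factor is followed from `(s, y)` to `(0, γ(1))`, and `γ(1)` is the first
integral. The transport equation is a fixed-point problem in a space of continuous paths, depending
smoothly on `(s, y)` and trivial for `s = 0`, so the inverse function theorem solves it with smooth
dependence on the data. -/

noncomputable section

namespace SecondOrder

set_option linter.unusedSectionVars false

/-! ### Calculus of bounded bilinear maps. -/

section Bilinear

variable {G₁ G₂ G₃ : Type*} [NormedAddCommGroup G₁] [NormedSpace ℝ G₁]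
  [NormedAddCommGroup G₂] [NormedSpace ℝ G₂] [NormedAddCommGroup G₃] [NormedSpace ℝ G₃]
  {B : G₁ → G₂ → G₃}

theorem contDiff_bilinear_comp (hB : IsBoundedBilinearMap ℝ fun p : G₁ × G₂ => B p.1 p.2)
    {P : Type*} [NormedAddCommGroup P] [NormedSpace ℝ P] {c : P → G₁} {d : P → G₂}
    (hc : ContDiff ℝ ∞ c) (hd : ContDiff ℝ ∞ d) : ContDiff ℝ ∞ (fun p => B (c p) (d p)) :=
  hB.contDiff.comp (hc.prodMk hd)

theorem hasDerivAt_bilinear_comp (hB : IsBoundedBilinearMap ℝ fun p : G₁ × G₂ => B p.1 p.2)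
    {c : ℝ → G₁} {d : ℝ → G₂} {c' : G₁} {d' : G₂} {r : ℝ} (hc : HasDerivAt c c' r)
    (hd : HasDerivAt d d' r) :
    HasDerivAt (fun ε => B (c ε) (d ε)) (B (c r) d' + B c' (d r)) r := by
  have h := (hB.hasFDerivAt (c r, d r)).comp_hasDerivAt r (hc.prodMk hd)
  exact h

end Bilinear

/-! ### Smoothness of the superposition operator on spaces of continuous functions. -/

section Superposition

universe u

variable {X : Type*} [TopologicalSpace X] [CompactSpace X]
  {E : Type u} [NormedAddCommGroup E] [NormedSpace ℝ E]
  {F : Type u} [NormedAddCommGroup F] [NormedSpace ℝ F]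

/-- Pointwise application of a continuous family of continuous linear maps. -/
def clmApply : C(X, E →L[ℝ] F) →L[ℝ] C(X, E) →L[ℝ] C(X, F) :=
  LinearMap.mkContinuous₂
    (LinearMap.mk₂ ℝ (fun (A : C(X, E →L[ℝ] F)) (φ : C(X, E)) =>
        (⟨fun x => A x (φ x), A.continuous.clm_apply φ.continuous⟩ : C(X, F)))
      (fun _ _ _ => by ext; simp) (fun _ _ _ => by ext; simp)
      (fun _ _ _ => by ext; simp) (fun _ _ _ => by ext; simp)) 1
    (fun A φ => by
      rw [ContinuousMap.norm_le _ (by positivity)]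
      intro x
      rw [one_mul]
      exact (A x).le_of_opNorm_le_of_le (A.norm_coe_le_norm x) (φ.norm_coe_le_norm x))

@[simp]
theorem clmApply_apply (A : C(X, E →L[ℝ] F)) (φ : C(X, E)) (x : X) :
    clmApply A φ x = A x (φ x) := rfl

/-- The superposition operator `φ ↦ G ∘ φ`. -/
def superposition (G : C(E, F)) (φ : C(X, E)) : C(X, F) := G.comp φ

@[simp]
theorem superposition_apply (G : C(E, F)) (φ : C(X, E)) (x : X) :
    superposition G φ x = G (φ x) := rfl

/-- The mean value inequality is applied at each `x` to `G` on a ball around `φ x`; the radius does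
not depend on `x`, so the estimate holds in the sup norm. -/
theorem hasFDerivAt_superposition {G : C(E, F)} {G' : C(E, E →L[ℝ] F)}
    (h : ∀ a, HasFDerivAt G (G' a) a) (φ : C(X, E)) :
    HasFDerivAt (superposition G) (clmApply (superposition G' φ)) φ := by
  rw [hasFDerivAt_iff_isLittleO_nhds_zero, Asymptotics.isLittleO_iff]
  intro ε hε
  have hcont : Continuous (fun ψ : C(X, E) => superposition G' ψ) :=
    ContinuousMap.continuous_postcomp G'
  obtain ⟨δ, hδ, hδ'⟩ := Metric.continuous_iff.1 hcont φ ε hε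
  filter_upwards [Metric.ball_mem_nhds (0 : C(X, E)) hδ] with η hη
  rw [mem_ball_zero_iff] at hη
  rw [ContinuousMap.norm_le _ (by positivity)]
  intro x
  -- Translating `φ` by the constant `ξ - φ x` gives a function within `δ` of `φ` whose value at `x`
  -- is `ξ`; continuity of `ψ ↦ G' ∘ ψ` in the sup norm then bounds `G'` at the single point `ξ`.
  have key : ∀ ξ ∈ Metric.ball (φ x) δ, ‖G' ξ - G' (φ x)‖ ≤ ε := by
    intro ξ hξ
    have h1 : dist (φ + ContinuousMap.const X (ξ - φ x)) φ < δ := by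
      rw [dist_eq_norm, add_sub_cancel_left]
      refine lt_of_le_of_lt ?_ (mem_ball_iff_norm.1 hξ)
      rw [ContinuousMap.norm_le _ (norm_nonneg _)]
      intro y
      simp
    have h2 := (ContinuousMap.dist_apply_le_dist (f := superposition G'
      (φ + ContinuousMap.const X (ξ - φ x))) (g := superposition G' φ) x).trans (hδ' _ h1).le
    rw [dist_eq_norm] at h2
    simpa using h2
  have h3 := (convex_ball (φ x) δ).norm_image_sub_le_of_norm_hasFDerivWithin_le'
    (f := G) (f' := fun ξ => G' ξ) (φ := G' (φ x)) (C := ε)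
    (fun ξ _ => (h ξ).hasFDerivWithinAt) key (Metric.mem_ball_self hδ)
    (y := φ x + η x) (by
      rw [mem_ball_iff_norm, add_sub_cancel_left]
      exact (η.norm_coe_le_norm x).trans_lt hη)
  rw [add_sub_cancel_left] at h3
  exact h3.trans (mul_le_mul_of_nonneg_left (η.norm_coe_le_norm x) hε.le)

/-- The target space varies in the induction, because the derivative is the superposition operator
of `fderiv ℝ G`, with values in `E →L[ℝ] F`. Keeping `E` and `F` in one universe keeps this new
target there too. -/
theorem contDiff_superposition_nat (n : ℕ) : ∀ {F : Type u} [NormedAddCommGroup F]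
    [NormedSpace ℝ F] (G : C(E, F)), ContDiff ℝ ∞ G →
    ContDiff ℝ n (superposition (X := X) G) := by
  induction n with
  | zero =>
    intro F _ _ G _
    exact contDiff_zero.2 (ContinuousMap.continuous_postcomp G)
  | succ n ih =>
    intro F _ _ G hG
    have hG' : ContDiff ℝ ∞ (fderiv ℝ G) := hG.fderiv_right (by simp)
    have h1 := ih (⟨fderiv ℝ G, hG'.continuous⟩ : C(E, E →L[ℝ] F)) hG'
    have h2 : ∀ φ, HasFDerivAt (superposition (X := X) G)
        (clmApply (superposition (⟨fderiv ℝ G, hG'.continuous⟩ : C(E, E →L[ℝ] F)) φ)) φ :=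
      hasFDerivAt_superposition fun a => (hG.differentiable (by simp) a).hasFDerivAt
    exact_mod_cast (contDiff_succ_iff_hasFDerivAt (n := n)).2
      ⟨_, clmApply.contDiff.comp h1, h2⟩

theorem contDiff_superposition (G : C(E, F)) (hG : ContDiff ℝ ∞ G) :
    ContDiff ℝ ∞ (superposition (X := X) G) :=
  contDiff_infty.2 fun n => contDiff_superposition_nat n G hG

theorem isBoundedBilinearMap_clmApply :
    IsBoundedBilinearMap ℝ (fun p : C(X, E →L[ℝ] F) × C(X, E) => clmApply p.1 p.2) where
  add_left _ _ _ := by ext; simp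
  smul_left _ _ _ := by ext; simp
  add_right _ _ _ := by ext; simp
  smul_right _ _ _ := by ext; simp
  bound := ⟨1, one_pos, fun A φ => by
    rw [ContinuousMap.norm_le _ (by positivity)]
    intro x
    rw [one_mul]
    exact (A x).le_of_opNorm_le_of_le (A.norm_coe_le_norm x) (φ.norm_coe_le_norm x)⟩

theorem contDiff_clmApply_comp {P : Type*} [NormedAddCommGroup P] [NormedSpace ℝ P]
    {c : P → C(X, E →L[ℝ] F)} {d : P → C(X, E)} (hc : ContDiff ℝ ∞ c) (hd : ContDiff ℝ ∞ d) :
    ContDiff ℝ ∞ (fun p => clmApply (c p) (d p)) :=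
  contDiff_bilinear_comp (G₁ := C(X, E →L[ℝ] F)) (G₂ := C(X, E)) (G₃ := C(X, F))
    (B := fun A φ => clmApply A φ)
    isBoundedBilinearMap_clmApply hc hd

theorem hasDerivAt_clmApply_comp {c : ℝ → C(X, E →L[ℝ] F)} {d : ℝ → C(X, E)}
    {c' : C(X, E →L[ℝ] F)} {d' : C(X, E)} {r : ℝ} (hc : HasDerivAt c c' r)
    (hd : HasDerivAt d d' r) :
    HasDerivAt (fun ε => clmApply (c ε) (d ε)) (clmApply (c r) d' + clmApply c' (d r)) r :=
  hasDerivAt_bilinear_comp (G₁ := C(X, E →L[ℝ] F)) (G₂ := C(X, E)) (G₃ := C(X, F))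
    (B := fun A φ => clmApply A φ)
    isBoundedBilinearMap_clmApply hc hd

theorem hasDerivAt_superposition_comp {G : C(E, F)} {G' : C(E, E →L[ℝ] F)}
    (h : ∀ a, HasFDerivAt G (G' a) a) {c : ℝ → C(X, E)} {c' : C(X, E)} {r : ℝ}
    (hc : HasDerivAt c c' r) :
    HasDerivAt (fun ε => superposition G (c ε)) (clmApply (superposition G' (c r)) c') r :=
  HasFDerivAt.comp_hasDerivAt (F := C(X, E)) (E := C(X, F)) r (hasFDerivAt_superposition h _) hc

end Superposition

/-! ### Inverse function theorem and smooth dependence of fixed points. -/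

section InverseFunction

variable {E : Type*} [NormedAddCommGroup E] [NormedSpace ℝ E] [CompleteSpace E]
  {F : Type*} [NormedAddCommGroup F] [NormedSpace ℝ F]

/-- The smooth inverse function theorem: a map that is smooth on an open set, with invertible
derivative at `a`, restricts to a diffeomorphism between open sets. -/
theorem exists_partialDiffeomorph {f : E → F} {U : Set E} (hU : IsOpen U)
    (hf : ContDiffOn ℝ ∞ f U) {a : E} (ha : a ∈ U) (e : E ≃L[ℝ] F)
    (he : HasFDerivAt f (e : E →L[ℝ] F) a) :
    ∃ Φ : PartialDiffeomorph 𝓘(ℝ, E) 𝓘(ℝ, F) E F ∞, a ∈ Φ.source ∧ Φ.source ⊆ U ∧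
      ∀ x, Φ x = f x := by
  have hfa : ContDiffAt ℝ ∞ f a := hf.contDiffAt (hU.mem_nhds ha)
  let Φ₀ := hfa.toOpenPartialHomeomorph f he (by simp)
  -- Smoothness of the inverse needs an invertible derivative at every point of the source, not only
  -- at `a`; invertibility is an open condition, so the source is cut down to it.
  let V : Set E := U ∩ fderiv ℝ f ⁻¹' Set.range ((↑) : (E ≃L[ℝ] F) → E →L[ℝ] F)
  have hV : IsOpen V :=
    (hf.continuousOn_fderiv_of_isOpen hU (by simp)).isOpen_inter_preimage hU
      ContinuousLinearEquiv.isOpen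
  let Φ₁ := Φ₀.restrOpen V hV
  have hsub : ∀ x ∈ Φ₁.source, x ∈ V := fun x hx => by
    rw [Φ₀.restrOpen_source] at hx
    exact hx.2
  refine ⟨{ toPartialEquiv := Φ₁.toPartialEquiv
            open_source := Φ₁.open_source
            open_target := Φ₁.open_target
            contMDiffOn_toFun := ?_
            contMDiffOn_invFun := ?_ }, ?_, ?_, ?_⟩
  · rw [contMDiffOn_iff_contDiffOn]
    exact hf.mono fun x hx => (hsub x hx).1
  · rw [contMDiffOn_iff_contDiffOn]
    intro y hy
    have hy' := hsub _ (Φ₁.map_target hy)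
    obtain ⟨e', he'⟩ := hy'.2
    have hfy : ContDiffAt ℝ ∞ f (Φ₁.symm y) := hf.contDiffAt (hU.mem_nhds hy'.1)
    have hd : HasFDerivAt Φ₁ (e' : E →L[ℝ] F) (Φ₁.symm y) := by
      rw [he']
      exact (hfy.differentiableAt (by simp)).hasFDerivAt
    exact (Φ₁.contDiffAt_symm hy hd hfy).contDiffWithinAt
  · change a ∈ Φ₁.source
    rw [Φ₀.restrOpen_source]
    exact ⟨hfa.mem_toOpenPartialHomeomorph_source he (by simp), ha, e, he.fderiv.symm⟩
  · exact fun x hx => (hsub x hx).1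
  · exact fun _ => rfl

/-- Fixed points of a smooth family of maps that degenerates to a constant map depend smoothly on
the parameter. -/
theorem exists_smooth_fixedPoint [CompleteSpace F] {T : E × F → F} (hT : ContDiff ℝ ∞ T) {a : E}
    {b : F} (hab : ∀ y, T (a, y) = b) :
    ∃ (U : Set E) (ψ : E → F), IsOpen U ∧ a ∈ U ∧ ContDiffOn ℝ ∞ ψ U ∧ ψ a = b ∧
      ∀ x ∈ U, T (x, ψ x) = ψ x := by
  have hd : HasFDerivAt T (fderiv ℝ T (a, b)) (a, b) :=
    (hT.differentiable (by simp) _).hasFDerivAt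
  set B : E →L[ℝ] F := fderiv ℝ T (a, b) ∘L .inl ℝ E F with hB
  -- `T (a, ·)` is constant, so its partial derivative vanishes, and the derivative of `(x, y) ↦ (x,
  -- y - T (x, y))` is the shear `(h, k) ↦ (h, k - B h)`, which is invertible.
  have h0 : fderiv ℝ T (a, b) ∘L .inr ℝ E F = 0 := by
    have h1 : HasFDerivAt (fun y => T (a, y)) (fderiv ℝ T (a, b) ∘L .inr ℝ E F) b :=
      hd.comp b (hasFDerivAt_prodMk_right a b)
    have h2 : HasFDerivAt (fun y => T (a, y)) (0 : F →L[ℝ] F) b := by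
      simp only [hab]
      exact hasFDerivAt_const b b
    exact h1.unique h2
  have hTB : fderiv ℝ T (a, b) = B ∘L .fst ℝ E F := by
    ext v
    · simp [hB]
    · have := DFunLike.congr_fun h0 v
      simpa using this
  let f₁ : E × F →L[ℝ] E × F := (ContinuousLinearMap.fst ℝ E F).prod (.snd ℝ E F - B ∘L .fst ℝ E F)
  let f₂ : E × F →L[ℝ] E × F := (ContinuousLinearMap.fst ℝ E F).prod (.snd ℝ E F + B ∘L .fst ℝ E F)
  let e : (E × F) ≃L[ℝ] E × F := ContinuousLinearEquiv.equivOfInverse f₁ f₂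
    (fun v => by simp [f₁, f₂]) (fun v => by simp [f₁, f₂])
  have hS : ContDiff ℝ ∞ (fun p : E × F => (p.1, p.2 - T p)) :=
    contDiff_fst.prodMk (contDiff_snd.sub hT)
  have he : HasFDerivAt (fun p : E × F => (p.1, p.2 - T p)) (e : E × F →L[ℝ] E × F) (a, b) := by
    rw [hTB] at hd
    exact hasFDerivAt_fst.prodMk (hasFDerivAt_snd.sub hd)
  obtain ⟨Φ, hΦa, -, hΦ⟩ := exists_partialDiffeomorph isOpen_univ hS.contDiffOn
    (Set.mem_univ (a, b)) e he
  have hΦab : Φ (a, b) = (a, 0) := by rw [hΦ]; simp [hab]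
  let Ψ := Φ.symm
  have hsm : ContDiffOn ℝ ∞ Φ.symm Φ.target := contMDiffOn_iff_contDiffOn.1 Φ.contMDiffOn_invFun
  have hι : Continuous (fun x : E => (x, (0 : F))) := by fun_prop
  -- The fixed point over `x` is the second component of the preimage of `(x, 0)`.
  refine ⟨(fun x => (x, (0 : F))) ⁻¹' Φ.target, fun x => (Φ.symm (x, 0)).2,
    Φ.open_target.preimage hι, ?_, ?_, ?_, ?_⟩
  · change (a, (0 : F)) ∈ Φ.target
    rw [← hΦab]
    exact Φ.map_source hΦa
  · exact contDiff_snd.comp_contDiffOn (hsm.comp (by fun_prop) fun x hx => hx)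
  · change (Φ.symm (a, 0)).2 = b
    rw [← hΦab]
    exact congrArg Prod.snd (Φ.left_inv hΦa)
  · intro x hx
    have h1 : Φ (Φ.symm (x, 0)) = (x, 0) := Φ.right_inv hx
    rw [hΦ, Prod.mk.injEq, sub_eq_zero] at h1
    have h2 : (x, (Φ.symm (x, 0)).2) = Φ.symm (x, 0) := Prod.ext h1.1.symm rfl
    rw [h2]
    exact h1.2.symm

end InverseFunction

/-! ### Integration as an operator on paths. -/

section Primitive

variable {L : Type*} [NormedAddCommGroup L] [NormedSpace ℝ L]

/-- The primitive, vanishing at `0`, of a continuous function on the unit interval. -/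
def primitive : C(unitInterval, L) →L[ℝ] C(unitInterval, L) :=
  LinearMap.mkContinuous
    { toFun := fun φ => ⟨fun t => ∫ s in (0 : ℝ)..t, Set.IccExtend zero_le_one φ s,
        (intervalIntegral.continuous_primitive (fun _ _ =>
          (φ.continuous.Icc_extend' (h := zero_le_one)).intervalIntegrable _ _) 0).comp
            continuous_subtype_val⟩
      map_add' := fun φ ψ => by
        ext t
        exact intervalIntegral.integral_add
          ((φ.continuous.Icc_extend' (h := zero_le_one)).intervalIntegrable _ _)
          ((ψ.continuous.Icc_extend' (h := zero_le_one)).intervalIntegrable _ _)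
      map_smul' := fun c φ => by
        ext t
        exact intervalIntegral.integral_smul c _ } 1
    (fun φ => by
      rw [ContinuousMap.norm_le _ (by positivity)]
      intro t
      refine (intervalIntegral.norm_integral_le_of_norm_le_const (C := ‖φ‖)
        fun s _ => φ.norm_coe_le_norm _).trans ?_
      rw [sub_zero, abs_of_nonneg t.2.1, mul_comm]
      exact mul_le_mul_of_nonneg_right t.2.2 (norm_nonneg _))

theorem contDiff_primitive : ContDiff ℝ ∞ (primitive (L := L)) :=
  (primitive (L := L)).contDiff

/-- A continuous function on the unit interval given as a constant minus a primitive is the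
restriction of a differentiable function. -/
theorem exists_hasDerivAt_of_eq_sub_primitive [CompleteSpace L] {φ ψ : C(unitInterval, L)} {c : L}
    (h : φ = ContinuousMap.const _ c - primitive ψ) :
    ∃ f : ℝ → L, f 0 = c ∧ (∀ t : unitInterval, f t = φ t) ∧
      ∀ t : unitInterval, HasDerivAt f (-ψ t) t := by
  have hc : Continuous (Set.IccExtend zero_le_one ψ : ℝ → L) := ψ.continuous.Icc_extend'
  refine ⟨fun t => c - ∫ s in (0 : ℝ)..t, Set.IccExtend zero_le_one ψ s, by simp, fun t => ?_,
    fun t => ?_⟩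
  · rw [h]
    rfl
  · have h1 := intervalIntegral.integral_hasDerivAt_right (hc.intervalIntegrable 0 t)
      (hc.stronglyMeasurableAtFilter _ _) hc.continuousAt
    rw [Set.IccExtend_val] at h1
    exact h1.const_sub c

end Primitive

/-! ### Frobenius theorem for graphs, by transport along rays. -/

section GraphFrobenius

universe u

/-- Constant functions, as a continuous linear map. -/
def constMap {X : Type*} [TopologicalSpace X] [CompactSpace X] {E : Type*} [NormedAddCommGroup E]
    [NormedSpace ℝ E] : E →L[ℝ] C(X, E) :=
  LinearMap.mkContinuous
    { toFun := ContinuousMap.const X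
      map_add' := fun _ _ => rfl
      map_smul' := fun _ _ => rfl } 1
    (fun v => by
      rw [ContinuousMap.norm_le _ (by positivity)]
      intro x
      rw [one_mul]
      exact le_rfl)

@[simp]
theorem constMap_apply {X : Type*} [TopologicalSpace X] [CompactSpace X] {E : Type*}
    [NormedAddCommGroup E] [NormedSpace ℝ E] (v : E) (x : X) : constMap v x = v := rfl

variable {K L : Type u} [NormedAddCommGroup K] [NormedSpace ℝ K]
  [NormedAddCommGroup L] [NormedSpace ℝ L]

/-- The paths `t ↦ ((1 - t) s, γ t)`. -/
def radialPath : K × C(unitInterval, L) →L[ℝ] C(unitInterval, K × L) :=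
  clmApply (⟨fun t => (1 - (t : ℝ)) • ContinuousLinearMap.inl ℝ K L, by fun_prop⟩ :
      C(unitInterval, K →L[ℝ] K × L)) ∘L constMap ∘L .fst ℝ K C(unitInterval, L) +
    clmApply (constMap (ContinuousLinearMap.inr ℝ K L)) ∘L .snd ℝ K C(unitInterval, L)

theorem radialPath_apply (s : K) (γ : C(unitInterval, L)) (t : unitInterval) :
    radialPath (s, γ) t = ((1 - (t : ℝ)) • s, γ t) := by
  simp [radialPath]

/-- A solution operator whose fixed points `γ` solve `γ' = -A((1 - t) s, γ) s`, `γ 0 = y`. -/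
def radialOperator (A : C(K × L, K →L[ℝ] L)) (p : (K × L) × C(unitInterval, L)) :
    C(unitInterval, L) :=
  constMap p.1.2 -
    primitive (clmApply (superposition A (radialPath (p.1.1, p.2))) (constMap p.1.1))

theorem contDiff_radialOperator {A : C(K × L, K →L[ℝ] L)} (hA : ContDiff ℝ ∞ A) :
    ContDiff ℝ ∞ (radialOperator A) := by
  have h1 : ContDiff ℝ ∞ (fun p : (K × L) × C(unitInterval, L) =>
      superposition A (radialPath (p.1.1, p.2))) :=
    (contDiff_superposition A hA).comp (by fun_prop)
  unfold radialOperator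
  have h3 : ContDiff ℝ ∞ (fun p : (K × L) × C(unitInterval, L) =>
      clmApply (superposition A (radialPath (p.1.1, p.2))) (constMap p.1.1)) :=
    contDiff_clmApply_comp h1 (by fun_prop)
  exact ContDiff.sub (by fun_prop) (contDiff_primitive.comp h3)

/-- The linearized equation along a curve of solutions of the radial equation. -/
theorem hasDerivAt_radialOperator {A : C(K × L, K →L[ℝ] L)} {A' : C(K × L, K × L →L[ℝ] K →L[ℝ] L)}
    (hA : ∀ z, HasFDerivAt A (A' z) z) {c : ℝ → (K × L) × C(unitInterval, L)}
    {c' : (K × L) × C(unitInterval, L)} {r : ℝ} (hc : HasDerivAt c c' r) :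
    HasDerivAt (fun ε => radialOperator A (c ε))
      (constMap c'.1.2 - primitive
        (clmApply (clmApply (superposition A' (radialPath ((c r).1.1, (c r).2)))
            (radialPath (c'.1.1, c'.2))) (constMap (c r).1.1)
          + clmApply (superposition A (radialPath ((c r).1.1, (c r).2))) (constMap c'.1.1))) r := by
  have hs : HasDerivAt (fun ε => (c ε).1.1) c'.1.1 r := hc.fst.fst
  have hy : HasDerivAt (fun ε => (c ε).1.2) c'.1.2 r := hc.fst.snd
  have hγ : HasDerivAt (fun ε => (c ε).2) c'.2 r := hc.snd
  have h1 : HasDerivAt (fun ε => radialPath ((c ε).1.1, (c ε).2)) (radialPath (c'.1.1, c'.2)) r :=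
    (radialPath (K := K) (L := L)).hasFDerivAt.comp_hasDerivAt r (hs.prodMk hγ)
  have h4 : HasDerivAt (fun ε => (constMap (c ε).1.1 : C(unitInterval, K)))
      (constMap c'.1.1) r :=
    (constMap (X := unitInterval) (E := K)).hasFDerivAt.comp_hasDerivAt r hs
  have h5 : HasDerivAt (fun ε => (constMap (c ε).1.2 : C(unitInterval, L)))
      (constMap c'.1.2) r :=
    (constMap (X := unitInterval) (E := L)).hasFDerivAt.comp_hasDerivAt r hy
  have h6 := hasDerivAt_clmApply_comp (hasDerivAt_superposition_comp hA h1) h4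
  rw [add_comm] at h6
  exact h5.sub ((primitive (L := L)).hasFDerivAt.comp_hasDerivAt r h6)

variable [CompleteSpace L]

/-- `δ` is the variation of the transported path when `(s, y)` moves in the direction `(h, A (s, y)
h)` of the distribution. By the integrability condition, `ζ(t) = (1 - t) A(c t) h` solves the same
linear equation with the same initial value. The difference satisfies a homogeneous linear equation,
so it vanishes, and `ζ(1) = 0`. -/
theorem radial_variation_eq_zero {A : C(K × L, K →L[ℝ] L)} {A' : C(K × L, K × L →L[ℝ] K →L[ℝ] L)}
    (hA : ∀ z, HasFDerivAt A (A' z) z) {s h : K} {y : L} {γ δ : C(unitInterval, L)}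
    (hγ : γ = radialOperator A ((s, y), γ))
    (hδ : δ = constMap (A (s, y) h) - primitive
      (clmApply (clmApply (superposition A' (radialPath (s, γ))) (radialPath (h, δ))) (constMap s)
        + clmApply (superposition A (radialPath (s, γ))) (constMap h)))
    (hsym : ∀ t : unitInterval, A' (radialPath (s, γ) t) (s, A (radialPath (s, γ) t) s) h =
      A' (radialPath (s, γ) t) (h, A (radialPath (s, γ) t) h) s) :
    δ 1 = 0 := by
  obtain ⟨g, hg0, hg, hg'⟩ := exists_hasDerivAt_of_eq_sub_primitive hγ
  obtain ⟨d, hd0, hd, hd'⟩ := exists_hasDerivAt_of_eq_sub_primitive hδ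
  let c : ℝ → K × L := fun t => ((1 - t) • s, g t)
  have hcp : ∀ t : unitInterval, c t = radialPath (s, γ) t := fun t => by
    rw [radialPath_apply, ← hg]
  have hc : ∀ t : unitInterval, HasDerivAt c (-(s, A (c t) s)) t := fun t => by
    have h1 : HasDerivAt (fun t : ℝ => (1 - t) • s) ((-1 : ℝ) • s) t :=
      ((hasDerivAt_id (t : ℝ)).const_sub 1).smul_const s
    have h2 := h1.prodMk (hg' t)
    convert! h2 using 1
    rw [hcp]
    simp
  let ζ : ℝ → L := fun t => (1 - t) • A (c t) h
  have hζ : ∀ t : unitInterval, HasDerivAt ζ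
      (-(A (c t) h) - A' (c t) ((1 - (t : ℝ)) • h, ζ t) s) t := fun t => by
    have h1 : HasDerivAt (fun t : ℝ => 1 - t) (-1) (t : ℝ) :=
      (hasDerivAt_id (t : ℝ)).const_sub 1
    have h2 : HasDerivAt (fun t => A (c t) h) (A' (c t) (-(s, A (c t) s)) h) t := by
      have h2' := ((hA (c t)).comp_hasDerivAt (t : ℝ) (hc t)).clm_apply (hasDerivAt_const (t : ℝ) h)
      simpa using h2'
    convert! h1.smul h2 using 1
    have h3 : ((1 - (t : ℝ)) • h, ζ t) = (1 - (t : ℝ)) • (h, A (c t) h) := by simp [ζ]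
    rw [h3, map_neg, map_smul, _root_.smul_apply, _root_.neg_apply]
    have h4 := hsym t
    rw [← hcp] at h4
    rw [h4]
    simp only [smul_neg, neg_smul, one_smul]
    abel
  have hw : ∀ t : unitInterval, HasDerivAt (fun t => d t - ζ t)
      (-(A' (c t) (0, d t - ζ t) s)) t := fun t => by
    convert! (hd' t).sub (hζ t) using 1
    have h5 : (0, d t - ζ t) = ((1 - (t : ℝ)) • h, d t) - ((1 - (t : ℝ)) • h, ζ t) := by simp
    rw [h5, map_sub]
    simp only [ContinuousMap.add_apply, clmApply_apply, superposition_apply, constMap_apply,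
      radialPath_apply h δ, ← hcp, ← hd, _root_.sub_apply]
    abel
  let B := superposition (F := K × L →L[ℝ] K →L[ℝ] L) A' (radialPath (s, γ))
  have hz := eq_zero_of_abs_deriv_le_mul_abs_self_of_eq_zero_right (a := 0) (b := 1)
    (f := fun t => d t - ζ t) (f' := fun t => -(A' (c t) (0, d t - ζ t) s))
    (K := ‖B‖ * ‖s‖)
    (fun t ht => (hw ⟨t, ht⟩).continuousAt.continuousWithinAt)
    (fun t ht => (hw ⟨t, Set.Ico_subset_Icc_self ht⟩).hasDerivWithinAt)
    (by
      have : c 0 = (s, y) := by simp [c, hg0]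
      simp [hd0, ζ, this])
    (fun t ht => by
      rw [norm_neg]
      have h6 := B.norm_coe_le_norm ⟨t, Set.Ico_subset_Icc_self ht⟩
      rw [superposition_apply, ← hcp] at h6
      have h7 : ‖((0 : K), d t - ζ t)‖ = ‖d t - ζ t‖ := by simp [Prod.norm_def]
      calc ‖A' (c t) (0, d t - ζ t) s‖ ≤ ‖A' (c t)‖ * ‖((0 : K), d t - ζ t)‖ * ‖s‖ :=
            ContinuousLinearMap.le_opNorm₂ _ _ _
        _ ≤ ‖B‖ * ‖d t - ζ t‖ * ‖s‖ := by
            rw [h7]; gcongr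
        _ = _ := by ring)
    1 ⟨zero_le_one, le_rfl⟩
  have h8 := hd 1
  simp only [ζ, sub_self, zero_smul, sub_zero] at hz
  rw [← h8]
  exact hz

/-- The Frobenius theorem for distributions given as graphs `{(h, A z h)}`. -/
theorem exists_first_integral_graph [CompleteSpace K] {A : K × L → K →L[ℝ] L}
    (hA : ContDiff ℝ ∞ A) (y₀ : L)
    (hsym : ∀ᶠ z in 𝓝 ((0 : K), y₀), ∀ h h' : K,
      fderiv ℝ A z (h, A z h) h' = fderiv ℝ A z (h', A z h') h) :
    ∃ (U : Set (K × L)) (g : K × L → L), IsOpen U ∧ (0, y₀) ∈ U ∧ ContDiffOn ℝ ∞ g U ∧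
      (∀ k, fderiv ℝ g (0, y₀) (0, k) = k) ∧ ∀ z ∈ U, ∀ h, fderiv ℝ g z (h, A z h) = 0 := by
  let Ac : C(K × L, K →L[ℝ] L) := ⟨A, hA.continuous⟩
  have hA'c : Continuous (fderiv ℝ A) := hA.continuous_fderiv (by simp)
  let A' : C(K × L, K × L →L[ℝ] K →L[ℝ] L) := ⟨fderiv ℝ A, hA'c⟩
  have hAA' : ∀ z, HasFDerivAt Ac (A' z) z := fun z =>
    (hA.differentiable (by simp) z).hasFDerivAt
  obtain ⟨V, hV, hVo, hV0⟩ := eventually_nhds_iff.1 hsym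
  have hfix : ∀ y γ, radialOperator Ac ((0, y), γ) = constMap y := fun y γ => by
    simp [radialOperator]
  obtain ⟨U, ψ, hU, hU0, hψ, hψ0, hψU⟩ := exists_smooth_fixedPoint
    (contDiff_radialOperator (A := Ac) hA) (hfix y₀)
  -- Integrability is known only on `V`, so the whole transport path must stay in `V`; by
  -- compactness of the interval this is an open condition on the path.
  let W : Set C(unitInterval, K × L) := {φ | Set.MapsTo φ Set.univ V}
  have hW : IsOpen W := ContinuousMap.isOpen_setOfPred_mapsTo isCompact_univ hVo
  have hcont : ContinuousOn (fun p : K × L => radialPath (p.1, ψ p)) U :=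
    radialPath.continuous.comp_continuousOn
      (continuous_fst.continuousOn.prodMk hψ.continuousOn)
  have hdψ : ∀ z ∈ U, HasFDerivAt ψ (fderiv ℝ ψ z) z := fun z hz =>
    ((hψ.contDiffAt (hU.mem_nhds hz)).differentiableAt (by simp)).hasFDerivAt
  let ev : C(unitInterval, L) →L[ℝ] L := ContinuousMap.evalCLM ℝ (1 : unitInterval)
  have hdg : ∀ z ∈ U, HasFDerivAt (fun p => ev (ψ p)) (ev ∘L fderiv ℝ ψ z) z := fun z hz =>
    ev.hasFDerivAt.comp z (hdψ z hz)
  have hline : ∀ z ∈ U, ∀ v : K × L,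
      HasDerivAt (fun ε : ℝ => (z + ε • v, ψ (z + ε • v))) (v, fderiv ℝ ψ z v) 0 := by
    intro z hz v
    have h1 : HasDerivAt (fun ε : ℝ => z + ε • v) v 0 := by
      simpa using ((hasDerivAt_id (0 : ℝ)).smul_const v).const_add z
    have h2 : HasFDerivAt ψ (fderiv ℝ ψ z) (z + (0 : ℝ) • v) := by
      simpa using hdψ z hz
    exact h1.prodMk (h2.comp_hasDerivAt (0 : ℝ) h1)
  -- The linearized transport equation, from differentiating the fixed-point identity for `ψ`, which
  -- holds on the whole open set `U`.
  have hvar : ∀ z ∈ U, ∀ v : K × L, fderiv ℝ ψ z v = constMap v.2 - primitive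
      (clmApply (clmApply (superposition A' (radialPath (z.1, ψ z)))
          (radialPath (v.1, fderiv ℝ ψ z v))) (constMap z.1)
        + clmApply (superposition Ac (radialPath (z.1, ψ z))) (constMap v.1)) := by
    intro z hz v
    have h1 := hasDerivAt_radialOperator hAA' (hline z hz v)
    simp only [zero_smul, add_zero] at h1
    have h2 : HasDerivAt (fun ε : ℝ => ψ (z + ε • v)) (fderiv ℝ ψ z v) 0 := (hline z hz v).snd
    have h3 : (fun ε : ℝ => ψ (z + ε • v)) =ᶠ[𝓝 0]
        fun ε => radialOperator Ac (z + ε • v, ψ (z + ε • v)) := by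
      have h4 : ContinuousAt (fun ε : ℝ => z + ε • v) 0 := by fun_prop
      have h5 : ∀ᶠ ε in 𝓝 (0 : ℝ), z + ε • v ∈ U :=
        h4.eventually_mem (by simpa using hU.mem_nhds hz)
      filter_upwards [h5] with ε hε
      exact (hψU _ hε).symm
    exact h2.unique (h1.congr_of_eventuallyEq h3)
  refine ⟨U ∩ (fun p : K × L => radialPath (p.1, ψ p)) ⁻¹' W, fun p => ev (ψ p),
    hcont.isOpen_inter_preimage hU hW, ⟨hU0, ?_⟩, ?_, ?_, ?_⟩
  · intro t _
    rw [radialPath_apply, hψ0]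
    simpa using hV0
  · exact ev.contDiff.comp_contDiffOn (hψ.mono Set.inter_subset_left)
  · intro k
    rw [(hdg _ hU0).fderiv, ContinuousLinearMap.comp_apply, hvar _ hU0]
    simp only [map_zero, add_zero, map_sub]
    rw [sub_zero]
    rfl
  · intro z hz h
    rw [(hdg z hz.1).fderiv]
    change (fderiv ℝ ψ z (h, A z h)) 1 = 0
    exact radial_variation_eq_zero hAA' (s := z.1) (y := z.2) (γ := ψ z) (h := h)
      (hψU z hz.1).symm (hvar z hz.1 (h, A z h)) fun t => hV _ (hz.2 (Set.mem_univ t)) _ _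

end GraphFrobenius

/-! ### Frobenius theorem for a local frame. -/

section Frobenius

/-- A map that is smooth on an open set coincides near a given point with a globally smooth map. -/
theorem exists_contDiff_eventuallyEq {E G : Type*} [NormedAddCommGroup E] [NormedSpace ℝ E]
    [FiniteDimensional ℝ E] [NormedAddCommGroup G] [NormedSpace ℝ G] {f : E → G} {U : Set E}
    (hU : IsOpen U) (hf : ContDiffOn ℝ ∞ f U) {a : E} (ha : a ∈ U) :
    ∃ f' : E → G, ContDiff ℝ ∞ f' ∧ f' =ᶠ[𝓝 a] f := by
  obtain ⟨χ, h₁⟩ : ∃ χ : ContDiffBump a, tsupport χ ⊆ U := by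
    obtain ⟨ε, hε, hεU⟩ := Metric.isOpen_iff.1 hU a ha
    refine ⟨⟨ε / 4, ε / 2, by positivity, by linarith⟩, ?_⟩
    rw [ContDiffBump.tsupport_eq]
    exact (Metric.closedBall_subset_ball (by simpa using hε)).trans hεU
  refine ⟨fun x => χ x • f x, ?_, ?_⟩
  · rw [contDiff_iff_contDiffAt]
    intro x
    by_cases hx : x ∈ tsupport χ
    · exact χ.contDiffAt.smul (hf.contDiffAt (hU.mem_nhds (h₁ hx)))
    · have : (fun x => χ x • f x) =ᶠ[𝓝 x] fun _ => 0 := by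
        filter_upwards [(isClosed_tsupport χ).isOpen_compl.mem_nhds hx] with y hy
        rw [image_eq_zero_of_notMem_tsupport hy, zero_smul]
      exact contDiffAt_const.congr_of_eventuallyEq this
  · filter_upwards [χ.eventuallyEq_one] with x hx
    rw [hx, Pi.one_apply, one_smul]


variable {E : Type*} [NormedAddCommGroup E] [NormedSpace ℝ E] {ι : Type} [Fintype ι]

/-- The linear map with the given values on the standard basis. -/
def frameMap (x : ι → E) : (ι → ℝ) →L[ℝ] E :=
  ∑ i, (ContinuousLinearMap.proj i : (ι → ℝ) →L[ℝ] ℝ).smulRight (x i)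

theorem frameMap_apply (x : ι → E) (c : ι → ℝ) : frameMap x c = ∑ i, c i • x i := by
  simp [frameMap]

theorem frameMap_single [DecidableEq ι] (x : ι → E) (i : ι) :
    frameMap x (Pi.single i 1) = x i := by
  simp [frameMap_apply, Pi.single_apply]

theorem frameMap_mem_span (x : ι → E) (c : ι → ℝ) :
    frameMap x c ∈ Submodule.span ℝ (Set.range x) := by
  rw [frameMap_apply]
  exact Submodule.sum_mem _ fun i _ => Submodule.smul_mem _ _ (Submodule.subset_span ⟨i, rfl⟩)

theorem contDiffOn_frameMap {P : Type*} [NormedAddCommGroup P] [NormedSpace ℝ P]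
    {X : ι → P → E} {U : Set P} (hX : ∀ i, ContDiffOn ℝ ∞ (X i) U) :
    ContDiffOn ℝ ∞ (fun z => frameMap fun i => X i z) U := by
  unfold frameMap
  refine ContDiffOn.sum fun i _ => ?_
  exact (ContinuousLinearMap.smulRightL ℝ (ι → ℝ) E
    (ContinuousLinearMap.proj i)).contDiff.comp_contDiffOn (hX i)

/-- Linear coordinates in which a given linearly independent family becomes the standard basis of
the first factor. -/
theorem exists_equiv_of_linearIndependent [FiniteDimensional ℝ E] [DecidableEq ι] {q : ℕ}
    {x : ι → E} (hx : LinearIndependent ℝ x) (hdim : Fintype.card ι + q = Module.finrank ℝ E) :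
    ∃ e : E ≃L[ℝ] (ι → ℝ) × (Fin q → ℝ), ∀ i, e (x i) = (Pi.single i 1, 0) := by
  obtain ⟨C, hC⟩ := Submodule.exists_isCompl (Submodule.span ℝ (Set.range x))
  have h1 := Submodule.finrank_add_eq_of_isCompl hC
  rw [finrank_span_eq_card hx] at h1
  have h2 : Module.finrank ℝ C = Module.finrank ℝ (Fin q → ℝ) := by
    rw [Module.finrank_fin_fun]; omega
  let e : E ≃ₗ[ℝ] (ι → ℝ) × (Fin q → ℝ) := (Submodule.prodEquivOfIsCompl _ C hC).symm ≪≫ₗ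
    ((Module.Basis.span hx).equivFun.prodCongr (LinearEquiv.ofFinrankEq C (Fin q → ℝ) h2))
  refine ⟨e.toContinuousLinearEquiv, fun i => ?_⟩
  have h3 : (Submodule.prodEquivOfIsCompl _ C hC).symm (x i) = (Module.Basis.span hx i, 0) := by
    rw [LinearEquiv.symm_apply_eq]
    simp [Module.Basis.span_apply]
  change e (x i) = _
  simp only [e, LinearEquiv.trans_apply, h3]
  ext j <;> simp [Finsupp.single_apply, Pi.single_apply, eq_comm]

/-- The integrability condition for a distribution given both by a frame and as a graph. -/
theorem graph_integrability {K L : Type*} [NormedAddCommGroup K] [NormedSpace ℝ K]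
    [NormedAddCommGroup L] [NormedSpace ℝ L] (e : E →L[ℝ] K × L) {A : E → K →L[ℝ] L} {U : Set E}
    (hU : IsOpen U) (hA : ContDiffOn ℝ ∞ A U) {X : ι → E → E} (hX : ∀ i, ContDiffOn ℝ ∞ (X i) U)
    (hAX : ∀ z ∈ U, ∀ i, (e (X i z)).2 = A z (e (X i z)).1)
    (hbr : ∀ i j, ∀ z ∈ U,
      VectorField.lieBracket ℝ (X i) (X j) z ∈ Submodule.span ℝ (Set.range fun i => X i z))
    {z : E} (hz : z ∈ U) {v w : E} (hv : v ∈ Submodule.span ℝ (Set.range fun i => X i z))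
    (hw : w ∈ Submodule.span ℝ (Set.range fun i => X i z)) :
    fderiv ℝ A z v (e w).1 = fderiv ℝ A z w (e v).1 := by
  let η : E →L[ℝ] L := .snd ℝ K L ∘L e - A z ∘L .fst ℝ K L ∘L e
  have hη : ∀ u ∈ Submodule.span ℝ (Set.range fun i => X i z), η u = 0 := by
    intro u hu
    have : Submodule.span ℝ (Set.range fun i => X i z) ≤ η.ker := by
      rw [Submodule.span_le]
      rintro _ ⟨i, rfl⟩
      simp [η, hAX z hz i]
    exact this hu
  have hAd : HasFDerivAt A (fderiv ℝ A z) z :=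
    ((hA.contDiffAt (hU.mem_nhds hz)).differentiableAt (by simp)).hasFDerivAt
  have hXd : ∀ i, HasFDerivAt (X i) (fderiv ℝ (X i) z) z := fun i =>
    (((hX i).contDiffAt (hU.mem_nhds hz)).differentiableAt (by simp)).hasFDerivAt
  -- Differentiating `(e Xᵢ).2 = A (e Xᵢ).1`. The antisymmetrization over `i, j` is then `η` of the
  -- bracket, which vanishes because `η` kills the span.
  have key : ∀ i u, fderiv ℝ A z u (e (X i z)).1 = η (fderiv ℝ (X i) z u) := by
    intro i u
    have h1 : HasFDerivAt (fun z => (e (X i z)).1) (.fst ℝ K L ∘L e ∘L fderiv ℝ (X i) z) z :=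
      ((ContinuousLinearMap.fst ℝ K L).comp e).hasFDerivAt.comp z (hXd i)
    have h2 : HasFDerivAt (fun z => (e (X i z)).2) (.snd ℝ K L ∘L e ∘L fderiv ℝ (X i) z) z :=
      ((ContinuousLinearMap.snd ℝ K L).comp e).hasFDerivAt.comp z (hXd i)
    have h3 := hAd.clm_apply h1
    have h4 : (fun z => (e (X i z)).2) =ᶠ[𝓝 z] fun z => A z (e (X i z)).1 := by
      filter_upwards [hU.mem_nhds hz] with y hy using hAX y hy i
    have h5 := DFunLike.congr_fun (h2.unique (h3.congr_of_eventuallyEq h4)) u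
    simp only [ContinuousLinearMap.comp_apply, ContinuousLinearMap.coe_snd',
      ContinuousLinearMap.coe_fst', _root_.add_apply, ContinuousLinearMap.flip_apply] at h5
    simp only [η, _root_.sub_apply, ContinuousLinearMap.comp_apply, ContinuousLinearMap.coe_snd',
      ContinuousLinearMap.coe_fst', h5]
    abel
  have hframe : ∀ i j, fderiv ℝ A z (X i z) (e (X j z)).1 = fderiv ℝ A z (X j z) (e (X i z)).1 := by
    intro i j
    rw [key, key, ← sub_eq_zero, ← map_sub]
    exact hη _ (hbr i j z hz)
  induction hv using Submodule.span_induction with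
  | zero => simp
  | add v v' _ _ hv hv' => simp [hv, hv']
  | smul c v _ hv => simp [hv]
  | mem v hv =>
    obtain ⟨i, rfl⟩ := hv
    induction hw using Submodule.span_induction with
    | zero => simp
    | add v v' _ _ hv hv' => simp [hv, hv']
    | smul c v _ hv => simp [hv]
    | mem w hw =>
      obtain ⟨j, rfl⟩ := hw
      exact hframe i j

/-- The **Frobenius theorem**: an involutive distribution, given by a local frame, is locally the
kernel of the differential of a smooth map. -/
theorem exists_first_integrals [FiniteDimensional ℝ E] [DecidableEq ι] {q : ℕ} {X : ι → E → E}
    {U : Set E} (hU : IsOpen U) (hX : ∀ i, ContDiffOn ℝ ∞ (X i) U)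
    (hli : ∀ z ∈ U, LinearIndependent ℝ fun i => X i z)
    (hbr : ∀ i j, ∀ z ∈ U,
      VectorField.lieBracket ℝ (X i) (X j) z ∈ Submodule.span ℝ (Set.range fun i => X i z))
    (hdim : Fintype.card ι + q = Module.finrank ℝ E) {a : E} (ha : a ∈ U) :
    ∃ (V : Set E) (g : E → Fin q → ℝ), IsOpen V ∧ a ∈ V ∧ V ⊆ U ∧ ContDiffOn ℝ ∞ g V ∧
      ∀ z ∈ V, ∀ v, fderiv ℝ g z v = 0 ↔ v ∈ Submodule.span ℝ (Set.range fun i => X i z) := by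
  obtain ⟨e, he⟩ := exists_equiv_of_linearIndependent (hli a ha) hdim
  let p₁ : E →L[ℝ] (ι → ℝ) := .fst ℝ _ _ ∘L (e : E →L[ℝ] (ι → ℝ) × (Fin q → ℝ))
  let p₂ : E →L[ℝ] (Fin q → ℝ) := .snd ℝ _ _ ∘L (e : E →L[ℝ] (ι → ℝ) × (Fin q → ℝ))
  let B : E → (ι → ℝ) →L[ℝ] E := fun z => frameMap fun i => X i z
  have hB : ContDiffOn ℝ ∞ B U := contDiffOn_frameMap hX
  let B₁ : E → (ι → ℝ) →L[ℝ] (ι → ℝ) := fun z => p₁ ∘L B z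
  let B₂ : E → (ι → ℝ) →L[ℝ] (Fin q → ℝ) := fun z => p₂ ∘L B z
  have hB₁ : ContDiffOn ℝ ∞ B₁ U := contDiffOn_const.clm_comp hB
  have hB₂ : ContDiffOn ℝ ∞ B₂ U := contDiffOn_const.clm_comp hB
  have hB₁a : B₁ a = ContinuousLinearMap.id ℝ _ := by
    ext c i
    have : p₁ (B a c) = c := by
      simp only [B, frameMap_apply, map_sum, map_smul]
      ext j
      simp [p₁, he, Pi.single_apply]
    exact congrFun this i
  let U₁ : Set E := U ∩ B₁ ⁻¹' Set.range ((↑) : ((ι → ℝ) ≃L[ℝ] (ι → ℝ)) → _ →L[ℝ] _)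
  have hU₁ : IsOpen U₁ := hB₁.continuousOn.isOpen_inter_preimage hU ContinuousLinearEquiv.isOpen
  have haU₁ : a ∈ U₁ := ⟨ha, ContinuousLinearEquiv.refl ℝ _, by rw [hB₁a]; rfl⟩
  -- Where the first component `B₁` of the frame is invertible, its span is the graph of `B₂ B₁⁻¹`.
  let A₀ : E → (ι → ℝ) →L[ℝ] (Fin q → ℝ) := fun z => B₂ z ∘L (B₁ z).inverse
  have hA₀ : ContDiffOn ℝ ∞ A₀ U₁ := by
    intro z hz
    obtain ⟨e', he'⟩ := hz.2
    have h1 : ContDiffAt ℝ ∞ ContinuousLinearMap.inverse (B₁ z) := by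
      rw [← he']
      exact contDiffAt_map_inverse e'
    exact (((hB₂ z hz.1).mono Set.inter_subset_left).clm_comp
      (h1.comp_contDiffWithinAt z ((hB₁ z hz.1).mono Set.inter_subset_left)))
  have hA₀B : ∀ z ∈ U₁, ∀ c, A₀ z (B₁ z c) = B₂ z c := by
    intro z hz c
    obtain ⟨e', he'⟩ := hz.2
    simp only [A₀, ← he', ContinuousLinearMap.inverse_equiv, ContinuousLinearMap.comp_apply,
      ContinuousLinearEquiv.coe_coe, ContinuousLinearEquiv.symm_apply_apply]
  have hlift : ∀ z ∈ U₁, ∀ h, ∃ c, e (B z c) = (h, A₀ z h) := by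
    intro z hz h
    obtain ⟨e', he'⟩ := hz.2
    have h1 : B₁ z (e'.symm h) = h := by rw [← he']; simp
    refine ⟨e'.symm h, Prod.ext h1 ?_⟩
    change B₂ z _ = _
    rw [← hA₀B z hz, h1]
  have hsymA₀ : ∀ z ∈ U₁, ∀ h h',
      fderiv ℝ A₀ z (e.symm (h, A₀ z h)) h' = fderiv ℝ A₀ z (e.symm (h', A₀ z h')) h := by
    intro z hz h h'
    obtain ⟨c, hc⟩ := hlift z hz h
    obtain ⟨c', hc'⟩ := hlift z hz h'
    have := graph_integrability (e : E →L[ℝ] (ι → ℝ) × (Fin q → ℝ)) hU₁ hA₀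
      (fun i => (hX i).mono Set.inter_subset_left)
      (fun z hz i => by
        have := hA₀B z hz (Pi.single i 1)
        simp only [B₁, B₂, B, ContinuousLinearMap.comp_apply, frameMap_single] at this
        exact this.symm)
      (fun i j z hz => hbr i j z hz.1) hz (frameMap_mem_span _ c) (frameMap_mem_span _ c')
    rw [← hc, ← hc', e.symm_apply_apply, e.symm_apply_apply]
    change fderiv ℝ A₀ z (B z c) (e (B z c')).1 = fderiv ℝ A₀ z (B z c') (e (B z c)).1 at this
    rw [hc, hc'] at this
    exact this
  let ζ : (ι → ℝ) × (Fin q → ℝ) → E := fun w => a + e.symm w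
  have hζ : ∀ w, HasFDerivAt ζ (e.symm : _ →L[ℝ] E) w := fun w =>
    e.symm.hasFDerivAt.const_add a
  have hζs : ContDiff ℝ ∞ ζ := contDiff_const.add e.symm.contDiff
  have hζ0 : ζ (0, 0) = a := by
    change a + e.symm 0 = a
    simp
  -- The graph theorem asks for a globally smooth `A`; `A₀`, read in affine coordinates centred at
  -- `a`, is replaced by a global map with the same germ, which is all that the integrability
  -- hypothesis sees.
  obtain ⟨A, hA, hAeq⟩ := exists_contDiff_eventuallyEq (hU₁.preimage hζs.continuous)
    (hA₀.comp hζs.contDiffOn fun w hw => hw) (a := ((0 : ι → ℝ), (0 : Fin q → ℝ)))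
    (by rw [Set.mem_preimage, hζ0]; exact haU₁)
  have hmem : ∀ᶠ w in 𝓝 ((0 : ι → ℝ), (0 : Fin q → ℝ)), ζ w ∈ U₁ :=
    hζs.continuous.continuousAt.eventually_mem (by rw [hζ0]; exact hU₁.mem_nhds haU₁)
  obtain ⟨U₂, g₀, hU₂, h0U₂, hg₀, hg₀1, hg₀2⟩ := exists_first_integral_graph hA 0 (by
    filter_upwards [hAeq.eventuallyEq_nhds, hmem] with w hw hw1 h h'
    have h1 : HasFDerivAt (A₀ ∘ ζ) (fderiv ℝ A₀ (ζ w) ∘L (e.symm : _ →L[ℝ] E)) w :=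
      ((hA₀.contDiffAt (hU₁.mem_nhds hw1)).differentiableAt (by simp)).hasFDerivAt.comp w (hζ w)
    rw [hw.fderiv_eq, hw.eq_of_nhds, h1.fderiv]
    exact hsymA₀ _ hw1 h h')
  obtain ⟨U₃, hU₃, hU₃o, h0U₃⟩ := eventually_nhds_iff.1 (hAeq.and hmem)
  -- Invertibility of the derivative in the second factor makes the kernel no larger than the graph.
  let U₄ := U₂ ∩ (fun w => fderiv ℝ g₀ w ∘L .inr ℝ (ι → ℝ) (Fin q → ℝ)) ⁻¹'
    Set.range ((↑) : ((Fin q → ℝ) ≃L[ℝ] (Fin q → ℝ)) → _ →L[ℝ] _)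
  have hU₄ : IsOpen U₄ := by
    refine ContinuousOn.isOpen_inter_preimage ?_ hU₂ ContinuousLinearEquiv.isOpen
    exact (hg₀.continuousOn_fderiv_of_isOpen hU₂ (by simp)).clm_comp continuousOn_const
  have h0U₄ : (0, 0) ∈ U₄ := by
    refine ⟨h0U₂, ContinuousLinearEquiv.refl ℝ _, ?_⟩
    ext k : 1
    exact (hg₀1 k).symm
  let ξ : E → (ι → ℝ) × (Fin q → ℝ) := fun z => e (z - a)
  have hξ : ∀ z, HasFDerivAt ξ (e : E →L[ℝ] _) z := fun z =>
    e.hasFDerivAt.comp z ((hasFDerivAt_id z).sub_const a)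
  have hξs : ContDiff ℝ ∞ ξ := e.contDiff.comp (contDiff_id.sub contDiff_const)
  have hξζ : ∀ z, ζ (ξ z) = z := fun z => by simp [ζ, ξ]
  have hsub : ∀ z, ξ z ∈ U₃ → z ∈ U₁ ∧ A (ξ z) = A₀ z := fun z hz => by
    have := hU₃ _ hz
    rw [Function.comp_apply, hξζ] at this
    exact this.symm
  refine ⟨ξ ⁻¹' (U₃ ∩ U₄), g₀ ∘ ξ, (hU₃o.inter hU₄).preimage hξs.continuous, ?_,
    fun z hz => (hsub z hz.1).1.1, hg₀.comp hξs.contDiffOn fun z hz => hz.2.1, ?_⟩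
  · have : ξ a = (0, 0) := by
      simp only [ξ, sub_self, map_zero]
      rfl
    rw [Set.mem_preimage, this]
    exact ⟨h0U₃, h0U₄⟩
  · intro z hz v
    obtain ⟨hz1, hAz⟩ := hsub z hz.1
    have hd : fderiv ℝ (g₀ ∘ ξ) z = fderiv ℝ g₀ (ξ z) ∘L (e : E →L[ℝ] _) :=
      (((hg₀.contDiffAt (hU₂.mem_nhds hz.2.1)).differentiableAt
        (by simp)).hasFDerivAt.comp z (hξ z)).fderiv
    have hgr := hg₀2 _ hz.2.1
    rw [hAz] at hgr
    rw [hd, ContinuousLinearMap.comp_apply, ContinuousLinearEquiv.coe_coe]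
    constructor
    · intro h0
      obtain ⟨e', he'⟩ := hz.2.2
      obtain ⟨c, hc⟩ := hlift z hz1 (e v).1
      have h1 : e v = ((e v).1, A₀ z (e v).1) + (0, (e v).2 - A₀ z (e v).1) := by
        ext <;> simp
      rw [h1, map_add, hgr, zero_add] at h0
      have h2 : e' ((e v).2 - A₀ z (e v).1) = 0 := by
        rw [← h0, ← ContinuousLinearEquiv.coe_coe, he']
        rfl
      rw [e'.map_eq_zero_iff] at h2
      rw [h2, ← hc] at h1
      have h3 : v = B z c := e.injective (by rw [h1]; simp)
      rw [h3]
      exact frameMap_mem_span _ c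
    · intro hv
      have : Submodule.span ℝ (Set.range fun i => X i z) ≤
          (fderiv ℝ g₀ (ξ z) ∘L (e : E →L[ℝ] _)).ker := by
        rw [Submodule.span_le]
        rintro _ ⟨i, rfl⟩
        have h1 : e (X i z) = ((e (X i z)).1, A₀ z (e (X i z)).1) := by
          refine Prod.ext rfl ?_
          have := hA₀B z hz1 (Pi.single i 1)
          simp only [B₁, B₂, B, ContinuousLinearMap.comp_apply, frameMap_single] at this
          exact this.symm
        change fderiv ℝ g₀ (ξ z) (e (X i z)) = 0
        rw [h1]
        exact hgr _
      exact this hv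

end Frobenius

/-! ### A function increasing at unit speed along a transverse field. -/

section TimeFunction

variable {E : Type*} [NormedAddCommGroup E] [NormedSpace ℝ E]

theorem lieBracket_prod_const {V W : E → E} {c d : ℝ} {p : E × ℝ}
    (hV : DifferentiableAt ℝ V p.1) (hW : DifferentiableAt ℝ W p.1) :
    VectorField.lieBracket ℝ (fun p : E × ℝ => (V p.1, c)) (fun p => (W p.1, d)) p =
      (VectorField.lieBracket ℝ V W p.1, 0) := by
  have h : ∀ {V : E → E} (c : ℝ), DifferentiableAt ℝ V p.1 →
      HasFDerivAt (fun p : E × ℝ => (V p.1, c))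
        ((fderiv ℝ V p.1 ∘L .fst ℝ E ℝ).prod (0 : E × ℝ →L[ℝ] ℝ)) p := fun c hV =>
    (HasFDerivAt.comp p hV.hasFDerivAt hasFDerivAt_fst).prodMk (hasFDerivAt_const c p)
  rw [VectorField.lieBracket, (h c hV).fderiv, (h d hW).fderiv]
  simp [VectorField.lieBracket]

/-- The last components force the coefficient of `(F, 1)` to be `1`; the first ones then express `F`
through the `X i`. -/
theorem exists_apply_ne_zero_of_frame {ι : Type} [Fintype ι] {X : ι → E} {F : E}
    (hF : F ∉ Submodule.span ℝ (Set.range X)) :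
    ((0 : E), (1 : ℝ)) ∉ Submodule.span ℝ (Set.range
      (fun o : Option ι => o.elim (F, (1 : ℝ)) fun i => (X i, 0))) := by
  rw [Submodule.mem_span_range_iff_exists_fun]
  rintro ⟨c, hc⟩
  rw [Fintype.sum_option] at hc
  have h2 := congrArg Prod.snd hc
  have h1 := congrArg Prod.fst hc
  simp only [Option.elim, Prod.smul_mk, Prod.snd_add, smul_eq_mul, mul_one, mul_zero, Prod.snd_sum,
    Finset.sum_const_zero, add_zero, Prod.fst_add, Prod.fst_sum] at h1 h2
  rw [h2, one_smul] at h1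
  apply hF
  rw [eq_neg_of_add_eq_zero_left h1]
  exact neg_mem (Submodule.sum_mem _ fun i _ => Submodule.smul_mem _ _
    (Submodule.subset_span ⟨i, rfl⟩))

theorem linearIndependent_option_elim_prod {ι : Type} [Fintype ι] {X : ι → E} {F : E}
    (hX : LinearIndependent ℝ X) :
    LinearIndependent ℝ (fun o : Option ι => o.elim (F, (1 : ℝ)) fun i => (X i, 0)) := by
  rw [Fintype.linearIndependent_iff] at hX ⊢
  intro c hc
  rw [Fintype.sum_option] at hc
  have h2 := congrArg Prod.snd hc
  have h1 := congrArg Prod.fst hc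
  simp only [Option.elim, Prod.smul_mk, Prod.snd_add, smul_eq_mul, mul_one, mul_zero, Prod.snd_sum,
    Finset.sum_const_zero, add_zero, Prod.fst_add, Prod.fst_sum, Prod.snd_zero,
    Prod.fst_zero] at h1 h2
  rw [h2, zero_smul, zero_add] at h1
  rintro (_ | i)
  · exact h2
  · exact hX (fun i => c (some i)) h1 i

/-- A function that is constant along an involutive distribution preserved by `F`, and increases
with unit speed along `F`. -/
theorem exists_time_function [FiniteDimensional ℝ E] {ι : Type} [Fintype ι] [DecidableEq ι]
    {X : ι → E → E} {F : E → E} {U : Set E} (hU : IsOpen U) (hX : ∀ i, ContDiffOn ℝ ∞ (X i) U)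
    (hF : ContDiffOn ℝ ∞ F U) (hli : ∀ z ∈ U, LinearIndependent ℝ fun i => X i z)
    (hbr : ∀ i j, ∀ z ∈ U,
      VectorField.lieBracket ℝ (X i) (X j) z ∈ Submodule.span ℝ (Set.range fun i => X i z))
    (hFbr : ∀ i, ∀ z ∈ U,
      VectorField.lieBracket ℝ F (X i) z ∈ Submodule.span ℝ (Set.range fun i => X i z))
    (hFX : ∀ z ∈ U, F z ∉ Submodule.span ℝ (Set.range fun i => X i z)) {a : E} (ha : a ∈ U) :
    ∃ (V : Set E) (σ : E → ℝ), IsOpen V ∧ a ∈ V ∧ V ⊆ U ∧ ContDiffOn ℝ ∞ σ V ∧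
      ∀ z ∈ V, (∀ i, fderiv ℝ σ z (X i z) = 0) ∧ fderiv ℝ σ z (F z) = 1 := by
  -- On `E × ℝ` the fields `(F, 1)` and `(Xᵢ, 0)` span an involutive distribution not containing
  -- `(0, 1)`. A suitable leafwise constant function `H` therefore has `∂H/∂r ≠ 0`, and its level
  -- set is a graph `r = σ z` tangent to these fields. Tangency says exactly `dσ(F) = 1` and `dσ(Xᵢ)
  -- = 0`.
  let Y : Option ι → E × ℝ → E × ℝ := fun o p => o.elim (F p.1, 1) fun i => (X i p.1, 0)
  have hUo : IsOpen (Prod.fst ⁻¹' U : Set (E × ℝ)) := hU.preimage continuous_fst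
  have hYs : ∀ o, ContDiffOn ℝ ∞ (Y o) (Prod.fst ⁻¹' U) := by
    rintro (_ | i)
    · exact (hF.comp contDiffOn_fst fun p hp => hp).prodMk contDiffOn_const
    · exact ((hX i).comp contDiffOn_fst fun p hp => hp).prodMk contDiffOn_const
  have hdX : ∀ i, ∀ z ∈ U, DifferentiableAt ℝ (X i) z := fun i z hz =>
    ((hX i).contDiffAt (hU.mem_nhds hz)).differentiableAt (by simp)
  have hdF : ∀ z ∈ U, DifferentiableAt ℝ F z := fun z hz =>
    (hF.contDiffAt (hU.mem_nhds hz)).differentiableAt (by simp)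
  have hYli : ∀ p ∈ (Prod.fst ⁻¹' U : Set (E × ℝ)), LinearIndependent ℝ fun o => Y o p :=
    fun p hp => linearIndependent_option_elim_prod (hli p.1 hp)
  have hincl : ∀ (p : E × ℝ) (v : E), v ∈ Submodule.span ℝ (Set.range fun i => X i p.1) →
      (v, (0 : ℝ)) ∈ Submodule.span ℝ (Set.range fun o => Y o p) := by
    intro p v hv
    have : Submodule.span ℝ (Set.range fun i => X i p.1) ≤
        (Submodule.span ℝ (Set.range fun o => Y o p)).comap (LinearMap.inl ℝ E ℝ) := by
      rw [Submodule.span_le]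
      rintro _ ⟨i, rfl⟩
      exact Submodule.subset_span ⟨some i, rfl⟩
    exact this hv
  have hYbr : ∀ o o', ∀ p ∈ (Prod.fst ⁻¹' U : Set (E × ℝ)),
      VectorField.lieBracket ℝ (Y o) (Y o') p ∈ Submodule.span ℝ (Set.range fun o => Y o p) := by
    rintro (_ | i) (_ | j) p hp
    · simp
    · have h : VectorField.lieBracket ℝ (Y none) (Y (some j)) p = _ :=
        lieBracket_prod_const (hdF _ hp) (hdX j _ hp)
      rw [h]
      exact hincl p _ (hFbr j _ hp)
    · have h : VectorField.lieBracket ℝ (Y (some i)) (Y none) p = _ :=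
        lieBracket_prod_const (hdX i _ hp) (hdF _ hp)
      rw [h, VectorField.lieBracket_swap]
      exact hincl p _ (neg_mem (hFbr i _ hp))
    · have h : VectorField.lieBracket ℝ (Y (some i)) (Y (some j)) p = _ :=
        lieBracket_prod_const (hdX i _ hp) (hdX j _ hp)
      rw [h]
      exact hincl p _ (hbr i j _ hp)
  have hcard : Fintype.card (Option ι) + (Module.finrank ℝ E - Fintype.card ι) =
      Module.finrank ℝ (E × ℝ) := by
    have := (hli a ha).fintype_card_le_finrank
    rw [Fintype.card_option, Module.finrank_prod, Module.finrank_self]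
    omega
  obtain ⟨V, g, hV, haV, hVU, hg, hgker⟩ := exists_first_integrals hUo hYs hYli hYbr hcard
    (a := (a, (0 : ℝ))) ha
  have hdg : ∀ p ∈ V, HasFDerivAt g (fderiv ℝ g p) p := fun p hp =>
    ((hg.contDiffAt (hV.mem_nhds hp)).differentiableAt (by simp)).hasFDerivAt
  have hne : fderiv ℝ g (a, 0) (0, 1) ≠ 0 := by
    rw [Ne, hgker _ haV]
    exact exists_apply_ne_zero_of_frame (hFX a ha)
  obtain ⟨k, hk⟩ := Function.ne_iff.1 hne
  let H : E × ℝ → ℝ := fun p => g p k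
  let pr : (Fin (Module.finrank ℝ E - Fintype.card ι) → ℝ) →L[ℝ] ℝ := ContinuousLinearMap.proj k
  have hH : ContDiffOn ℝ ∞ H V := pr.contDiff.comp_contDiffOn hg
  have hdH : ∀ p ∈ V, HasFDerivAt H (pr ∘L fderiv ℝ g p) p := fun p hp =>
    pr.hasFDerivAt.comp p (hdg p hp)
  have hHker : ∀ p ∈ V, ∀ v ∈ Submodule.span ℝ (Set.range fun o => Y o p),
      fderiv ℝ H p v = 0 := by
    intro p hp v hv
    rw [(hdH p hp).fderiv, ContinuousLinearMap.comp_apply, (hgker p hp v).2 hv, map_zero]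
  let V' : Set (E × ℝ) := V ∩ (fun p => fderiv ℝ H p (0, 1)) ⁻¹' {0}ᶜ
  have hV' : IsOpen V' := by
    refine ContinuousOn.isOpen_inter_preimage ?_ hV isOpen_compl_singleton
    exact (hH.continuousOn_fderiv_of_isOpen hV (by simp)).clm_apply continuousOn_const
  have haV' : (a, 0) ∈ V' := ⟨haV, by
    change fderiv ℝ H (a, 0) (0, 1) ≠ 0
    rw [(hdH _ haV).fderiv]
    exact hk⟩
  let l := fderiv ℝ H (a, 0) (0, 1)
  have hl : l ≠ 0 := haV'.2
  let β : E →L[ℝ] ℝ := fderiv ℝ H (a, 0) ∘L .inl ℝ E ℝ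
  have hdecomp : ∀ v : E × ℝ, fderiv ℝ H (a, 0) v = β v.1 + l * v.2 := by
    intro v
    have : v = (v.1, 0) + v.2 • (0, 1) := by ext <;> simp
    conv_lhs => rw [this, map_add, map_smul, smul_eq_mul, mul_comm]
    rfl
  let e : (E × ℝ) ≃L[ℝ] E × ℝ := ContinuousLinearEquiv.equivOfInverse
    ((ContinuousLinearMap.fst ℝ E ℝ).prod (fderiv ℝ H (a, 0)))
    ((ContinuousLinearMap.fst ℝ E ℝ).prod (l⁻¹ • (.snd ℝ E ℝ - β ∘L .fst ℝ E ℝ)))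
    (fun v => by ext <;> simp [hdecomp, hl]) (fun v => by ext <;> simp [hdecomp, hl])
  obtain ⟨Φ, hΦa, hΦV, hΦ⟩ := exists_partialDiffeomorph hV'
    (f := fun p : E × ℝ => (p.1, H p)) (contDiffOn_fst.prodMk (hH.mono Set.inter_subset_left))
    haV' e (hasFDerivAt_fst.prodMk ((hdH _ haV).differentiableAt.hasFDerivAt))
  have hsm : ContDiffOn ℝ ∞ Φ.symm Φ.target := contMDiffOn_iff_contDiffOn.1 Φ.contMDiffOn_invFun
  let ρ : E → E × ℝ := fun z => (z, H (a, 0))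
  have hρ : ContDiff ℝ ∞ ρ := contDiff_id.prodMk contDiff_const
  have hVo : IsOpen (ρ ⁻¹' Φ.target) := Φ.open_target.preimage hρ.continuous
  have hσ : ContDiffOn ℝ ∞ (fun z => (Φ.symm (ρ z)).2) (ρ ⁻¹' Φ.target) :=
    contDiff_snd.comp_contDiffOn (hsm.comp hρ.contDiffOn fun z hz => hz)
  have hgraph : ∀ z ∈ ρ ⁻¹' Φ.target, Φ.symm (ρ z) = (z, (Φ.symm (ρ z)).2) ∧
      H (z, (Φ.symm (ρ z)).2) = H (a, 0) := by
    intro z hz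
    have h1 : Φ (Φ.symm (ρ z)) = ρ z := Φ.right_inv hz
    rw [hΦ, Prod.mk.injEq] at h1
    have h2 : Φ.symm (ρ z) = (z, (Φ.symm (ρ z)).2) := Prod.ext h1.1 rfl
    exact ⟨h2, by rw [← h2]; exact h1.2⟩
  have hmem : ∀ z ∈ ρ ⁻¹' Φ.target, (z, (Φ.symm (ρ z)).2) ∈ V' := by
    intro z hz
    rw [← (hgraph z hz).1]
    exact hΦV (Φ.symm.map_source hz)
  refine ⟨ρ ⁻¹' Φ.target, fun z => (Φ.symm (ρ z)).2, hVo, ?_, fun z hz => hVU (hmem z hz).1, hσ,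
    fun z hz => ?_⟩
  · change ρ a ∈ Φ.target
    have : Φ (a, 0) = ρ a := hΦ _
    rw [← this]
    exact Φ.map_source hΦa
  · set σ : E → ℝ := fun z => (Φ.symm (ρ z)).2 with hσdef
    have hdσ : HasFDerivAt σ (fderiv ℝ σ z) z :=
      ((hσ.contDiffAt (hVo.mem_nhds hz)).differentiableAt (by simp)).hasFDerivAt
    have hp := hmem z hz
    have hpV : (z, σ z) ∈ V := hp.1
    have hchain : ∀ v, fderiv ℝ H (z, σ z) (v, fderiv ℝ σ z v) = 0 := by
      intro v
      have h0 : HasFDerivAt (fun z => (z, σ z))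
          ((ContinuousLinearMap.id ℝ E).prod (fderiv ℝ σ z)) z := (hasFDerivAt_id z).prodMk hdσ
      have h1 : HasFDerivAt (fun z => H (z, σ z))
          (fderiv ℝ H (z, σ z) ∘L (ContinuousLinearMap.id ℝ E).prod (fderiv ℝ σ z)) z :=
        HasFDerivAt.comp (g := H) z (hdH _ hpV).differentiableAt.hasFDerivAt h0
      have h2 : (fun z => H (z, σ z)) =ᶠ[𝓝 z] fun _ => H (a, 0) := by
        filter_upwards [hVo.mem_nhds hz] with y hy using (hgraph y hy).2
      have h3 := h1.unique ((hasFDerivAt_const (H (a, 0)) z).congr_of_eventuallyEq h2)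
      exact DFunLike.congr_fun h3 v
    -- As `∂H/∂r ≠ 0`, the tangent space of the graph contains at most one vector over each `v`.
    have huniq : ∀ v r, fderiv ℝ H (z, σ z) (v, r) = 0 → fderiv ℝ σ z v = r := by
      intro v r hr
      have h1 : (v, fderiv ℝ σ z v) = (v, r) + (fderiv ℝ σ z v - r) • ((0 : E), (1 : ℝ)) := by
        ext <;> simp
      have h2 := hchain v
      rw [h1, map_add, hr, zero_add, map_smul, smul_eq_mul] at h2
      exact sub_eq_zero.1 ((mul_eq_zero.1 h2).resolve_right hp.2)
    exact ⟨fun i => huniq _ _ (hHker _ hpV _ (Submodule.subset_span ⟨some i, rfl⟩)),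
      huniq _ _ (hHker _ hpV _ (Submodule.subset_span ⟨none, rfl⟩))⟩

end TimeFunction

/-! ### Second-order coordinates in a vector space. -/

section FlatCoordinates

theorem PartialDiffeomorph.hasFDerivAt_of_mem {E G : Type*} [NormedAddCommGroup E]
    [NormedSpace ℝ E] [NormedAddCommGroup G] [NormedSpace ℝ G]
    (Φ : PartialDiffeomorph 𝓘(ℝ, E) 𝓘(ℝ, G) E G ∞) {z : E} (hz : z ∈ Φ.source) :
    HasFDerivAt Φ (fderiv ℝ Φ z) z :=
  (((contMDiffOn_iff_contDiffOn.1 Φ.contMDiffOn_toFun).contDiffAt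
    (Φ.open_source.mem_nhds hz)).differentiableAt (by simp)).hasFDerivAt

theorem PartialDiffeomorph.fderiv_injective {E G : Type*} [NormedAddCommGroup E]
    [NormedSpace ℝ E] [NormedAddCommGroup G] [NormedSpace ℝ G]
    (Φ : PartialDiffeomorph 𝓘(ℝ, E) 𝓘(ℝ, G) E G ∞) {z : E} (hz : z ∈ Φ.source) :
    Function.Injective (fderiv ℝ Φ z) := by
  have h1 := PartialDiffeomorph.hasFDerivAt_of_mem Φ hz
  have hz' : Φ z ∈ Φ.symm.source := Φ.map_source hz
  have h2 := PartialDiffeomorph.hasFDerivAt_of_mem Φ.symm hz'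
  have h3 : (fun z => Φ.symm (Φ z)) =ᶠ[𝓝 z] id := by
    filter_upwards [Φ.open_source.mem_nhds hz] with y hy using Φ.left_inv hy
  have h4 := ((h2.comp z h1).congr_of_eventuallyEq h3.symm).unique (hasFDerivAt_id z)
  intro v w hvw
  have h5 := DFunLike.congr_fun h4 v
  have h6 := DFunLike.congr_fun h4 w
  simp only [ContinuousLinearMap.comp_apply, ContinuousLinearMap.id_apply] at h5 h6
  rw [← h5, ← h6, hvw]

variable {E : Type*} [NormedAddCommGroup E] [NormedSpace ℝ E] [FiniteDimensional ℝ E] {n p : ℕ}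

/-- Coordinates `(t, x, y)` adapted to a frame `X` and a field `F`, obtained from a map `t` whose
differential has kernel spanned by the `Xᵢ` and `[F, Xᵢ]`. -/
theorem exists_secondOrder_coordinates {X : Fin n → E → E} {F : E → E} {U : Set E} (hU : IsOpen U)
    (hX : ∀ i, ContDiffOn ℝ ∞ (X i) U) (hF : ContDiffOn ℝ ∞ F U)
    (hli : ∀ z ∈ U, LinearIndependent ℝ (Sum.elim (fun i => X i z)
      fun i => VectorField.lieBracket ℝ F (X i) z))
    (hbr : ∀ i j, ∀ z ∈ U,
      VectorField.lieBracket ℝ (X i) (X j) z ∈ Submodule.span ℝ (Set.range fun i => X i z))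
    (hdim : 2 * n + p = Module.finrank ℝ E) {a : E} (ha : a ∈ U) {t : E → Fin p → ℝ}
    (ht : ContDiffOn ℝ ∞ t U) {c : Fin p → ℝ} (htF : ∀ z ∈ U, fderiv ℝ t z (F z) = c)
    (htker : ∀ z ∈ U, ∀ v, fderiv ℝ t z v = 0 ↔ v ∈ Submodule.span ℝ (Set.range
      (Sum.elim (fun i => X i z) fun i => VectorField.lieBracket ℝ F (X i) z))) :
    ∃ Φ : PartialDiffeomorph 𝓘(ℝ, E) 𝓘(ℝ, CoordSpace p n) E (CoordSpace p n) ∞,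
      a ∈ Φ.source ∧ Φ.source ⊆ U ∧ ∀ z ∈ Φ.source,
        (∀ v, v ∈ Submodule.span ℝ (Set.range fun i => X i z) ↔
          (fderiv ℝ Φ z v).1 = 0 ∧ (fderiv ℝ Φ z v).2.1 = 0) ∧
        (fderiv ℝ Φ z (F z)).1 = c ∧ (fderiv ℝ Φ z (F z)).2.1 = (Φ z).2.2 := by
  have hliX : ∀ z ∈ U, LinearIndependent ℝ fun i => X i z := fun z hz =>
    (hli z hz).comp Sum.inl Sum.inl_injective
  obtain ⟨V, g, hV, haV, hVU, hg, hgker⟩ := exists_first_integrals (q := n + p) hU hX hliX hbr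
    (by rw [Fintype.card_fin]; omega) ha
  have hdg : ∀ z ∈ V, HasFDerivAt g (fderiv ℝ g z) z := fun z hz =>
    ((hg.contDiffAt (hV.mem_nhds hz)).differentiableAt (by simp)).hasFDerivAt
  have hgY : LinearIndependent ℝ fun i => fderiv ℝ g a (VectorField.lieBracket ℝ F (X i) a) := by
    rw [Fintype.linearIndependent_iff]
    intro β hβ
    simp_rw [← map_smul] at hβ
    rw [← map_sum, hgker a haV, Submodule.mem_span_range_iff_exists_fun] at hβ
    obtain ⟨α, hα⟩ := hβ
    have h1 := Fintype.linearIndependent_iff.1 (hli a ha) (Sum.elim (-α) β) (by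
      simp [Fintype.sum_sum_type, ← hα])
    exact fun i => h1 (Sum.inr i)
  -- Of the `n + p` first integrals of the `Xᵢ`, the `n` linear combinations kept as `x` are those
  -- with `dx([F, Xᵢ]) = eᵢ` at `a`.
  obtain ⟨e, he⟩ := exists_equiv_of_linearIndependent (q := p) hgY (by simp)
  let ℓ : (Fin (n + p) → ℝ) →L[ℝ] (Fin n → ℝ) := .fst ℝ (Fin n → ℝ) (Fin p → ℝ) ∘L
    (e : (Fin (n + p) → ℝ) →L[ℝ] (Fin n → ℝ) × (Fin p → ℝ))
  let x : E → Fin n → ℝ := fun z => ℓ (g z)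
  have hx : ContDiffOn ℝ ∞ x V := ℓ.contDiff.comp_contDiffOn hg
  have hdx : ∀ z ∈ V, HasFDerivAt x (ℓ ∘L fderiv ℝ g z) z := fun z hz =>
    ℓ.hasFDerivAt.comp z (hdg z hz)
  have hxX : ∀ z ∈ V, ∀ i, fderiv ℝ x z (X i z) = 0 := by
    intro z hz i
    rw [(hdx z hz).fderiv, ContinuousLinearMap.comp_apply,
      (hgker z hz _).2 (Submodule.subset_span ⟨i, rfl⟩), map_zero]
  have hxY : ∀ i, fderiv ℝ x a (VectorField.lieBracket ℝ F (X i) a) = Pi.single i 1 := by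
    intro i
    rw [(hdx a haV).fderiv]
    simp [ℓ, he]
  -- This choice makes `∂/∂x` appear in `F` with coefficients `y`.
  let y : E → Fin n → ℝ := fun z => fderiv ℝ x z (F z)
  have hy : ContDiffOn ℝ ∞ y V :=
    (hx.fderiv_of_isOpen hV (by simp)).clm_apply (hF.mono hVU)
  have hyX : ∀ z ∈ V, ∀ i,
      fderiv ℝ y z (X i z) = -fderiv ℝ x z (VectorField.lieBracket ℝ F (X i) z) := by
    intro z hz i
    rw [VectorField.fderiv_apply_lieBracket (n := ∞) (hx.contDiffAt (hV.mem_nhds hz))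
      (by simp only [minSmoothness_of_isRCLikeNormedField]; exact ENat.LEInfty.out)
      (((hX i).contDiffAt (hU.mem_nhds (hVU hz))).differentiableAt (by simp))
      ((hF.contDiffAt (hU.mem_nhds (hVU hz))).differentiableAt (by simp))]
    have h1 : (fun z => fderiv ℝ x z (X i z)) =ᶠ[𝓝 z] fun _ => 0 := by
      filter_upwards [hV.mem_nhds hz] with w hw using hxX w hw i
    rw [h1.fderiv_eq]
    simp [y]
  have hdt : ∀ z ∈ V, HasFDerivAt t (fderiv ℝ t z) z := fun z hz =>
    ((ht.contDiffAt (hU.mem_nhds (hVU hz))).differentiableAt (by simp)).hasFDerivAt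
  have hdy : ∀ z ∈ V, HasFDerivAt y (fderiv ℝ y z) z := fun z hz =>
    ((hy.contDiffAt (hV.mem_nhds hz)).differentiableAt (by simp)).hasFDerivAt
  let φ : E → CoordSpace p n := fun z => (t z, x z, y z)
  have hφ : ContDiffOn ℝ ∞ φ V := (ht.mono hVU).prodMk (hx.prodMk hy)
  have hdφ : ∀ z ∈ V, HasFDerivAt φ
      ((fderiv ℝ t z).prod ((fderiv ℝ x z).prod (fderiv ℝ y z))) z := fun z hz =>
    (hdt z hz).prodMk ((hdx z hz).differentiableAt.hasFDerivAt.prodMk (hdy z hz))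
  -- At `a` the differential is triangular: `dt` kills `Xᵢ` and `[F, Xᵢ]`, `dx` detects the `[F,
  -- Xᵢ]`, and `dy(Xᵢ) = -eᵢ` detects the `Xᵢ`.
  have hinj : Function.Injective
      ((fderiv ℝ t a).prod ((fderiv ℝ x a).prod (fderiv ℝ y a)) : E →L[ℝ] CoordSpace p n) := by
    rw [injective_iff_map_eq_zero]
    intro v hv
    simp only [ContinuousLinearMap.prod_apply, Prod.mk_eq_zero] at hv
    obtain ⟨h1, h2, h3⟩ := hv
    rw [htker a ha, Submodule.mem_span_range_iff_exists_fun] at h1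
    obtain ⟨κ, rfl⟩ := h1
    rw [Fintype.sum_sum_type] at h2 h3 ⊢
    simp only [Sum.elim_inl, Sum.elim_inr, map_add, map_sum, map_smul, hxX a haV, hxY, hyX a haV,
      smul_zero, Finset.sum_const_zero, zero_add] at h2 h3
    have h4 : ∀ i, κ (Sum.inr i) = 0 := fun i => by
      simpa [Finset.sum_apply, Pi.single_apply] using congrFun h2 i
    simp only [h4, zero_smul, Finset.sum_const_zero, add_zero] at h3
    have h5 : ∀ i, κ (Sum.inl i) = 0 := fun i => by
      simpa [Finset.sum_apply, Pi.single_apply] using congrFun h3 i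
    simp [h4, h5]
  let e' : E ≃L[ℝ] CoordSpace p n := (LinearEquiv.ofInjectiveOfFinrankEq
    ((fderiv ℝ t a).prod ((fderiv ℝ x a).prod (fderiv ℝ y a)) : E →L[ℝ] CoordSpace p n).toLinearMap
    hinj (by simp; omega)).toContinuousLinearEquiv
  obtain ⟨Φ, hΦa, hΦV, hΦ⟩ := exists_partialDiffeomorph hV hφ haV e' (hdφ a haV)
  have hΦφ : (Φ : E → CoordSpace p n) = φ := funext hΦ
  refine ⟨Φ, hΦa, hΦV.trans hVU, fun z hz => ?_⟩
  have hinj' := PartialDiffeomorph.fderiv_injective Φ hz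
  have hzV := hΦV hz
  have hzU := hVU hzV
  rw [hΦφ, (hdφ z hzV).fderiv] at hinj' ⊢
  refine ⟨fun v => ⟨fun hv => ?_, fun ⟨h1, h2⟩ => ?_⟩, htF z hzU, rfl⟩
  · refine ⟨(htker z hzU v).2 (Submodule.span_mono ?_ hv), ?_⟩
    · rintro _ ⟨i, rfl⟩
      exact ⟨Sum.inl i, rfl⟩
    · change fderiv ℝ x z v = 0
      rw [(hdx z hzV).fderiv, ContinuousLinearMap.comp_apply, (hgker z hzV v).2 hv, map_zero]
  · change fderiv ℝ t z v = 0 at h1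
    change fderiv ℝ x z v = 0 at h2
    rw [htker z hzU, Submodule.mem_span_range_iff_exists_fun] at h1
    obtain ⟨κ, rfl⟩ := h1
    rw [Fintype.sum_sum_type] at h2 ⊢
    simp only [Sum.elim_inl, Sum.elim_inr, map_add, map_sum, map_smul, hxX z hzV,
      smul_zero, Finset.sum_const_zero, zero_add] at h2
    -- Away from `a` the values `dx([F, Xᵢ])` are no longer a standard basis, but they equal
    -- `-dy(Xᵢ)`. A relation among them gives a combination of the `Xᵢ` killed by `dt`, `dx` and
    -- `dy`, hence zero.
    have h3 : ∑ i, κ (Sum.inr i) • X i z = 0 := by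
      apply hinj'
      rw [map_zero, ContinuousLinearMap.prod_apply, ContinuousLinearMap.prod_apply,
        Prod.mk_eq_zero, Prod.mk_eq_zero]
      refine ⟨(htker z hzU _).2 (Submodule.sum_mem _ fun i _ => Submodule.smul_mem _ _
        (Submodule.subset_span ⟨Sum.inl i, rfl⟩)), ?_, ?_⟩
      · simp [map_sum, hxX z hzV]
      · simp only [map_sum, map_smul, hyX z hzV, smul_neg, Finset.sum_neg_distrib, h2, neg_zero]
    have h4 := Fintype.linearIndependent_iff.1 (hliX z hzU) _ h3
    simp only [h4, zero_smul, Finset.sum_const_zero, add_zero, Sum.elim_inl]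
    exact Submodule.sum_mem _ fun i _ => Submodule.smul_mem _ _ (Submodule.subset_span ⟨i, rfl⟩)

/-- A time-like submersion whose differential has a given involutive kernel preserved by `F`. -/
theorem exists_time_submersion {ι : Type} [Fintype ι] [DecidableEq ι] {W : ι → E → E} {F : E → E}
    {U : Set E} (hU : IsOpen U) (hW : ∀ i, ContDiffOn ℝ ∞ (W i) U) (hF : ContDiffOn ℝ ∞ F U)
    (hli : ∀ z ∈ U, LinearIndependent ℝ fun i => W i z)
    (hbr : ∀ i j, ∀ z ∈ U,
      VectorField.lieBracket ℝ (W i) (W j) z ∈ Submodule.span ℝ (Set.range fun i => W i z))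
    (hFbr : ∀ i, ∀ z ∈ U,
      VectorField.lieBracket ℝ F (W i) z ∈ Submodule.span ℝ (Set.range fun i => W i z))
    (hFW : ∀ z ∈ U, F z ∉ Submodule.span ℝ (Set.range fun i => W i z))
    (hdim : Fintype.card ι + p = Module.finrank ℝ E) {a : E} (ha : a ∈ U) :
    ∃ (V : Set E) (t : E → Fin p → ℝ) (k : Fin p), IsOpen V ∧ a ∈ V ∧ V ⊆ U ∧
      ContDiffOn ℝ ∞ t V ∧ (∀ z ∈ V, fderiv ℝ t z (F z) = Pi.single k 1) ∧
      ∀ z ∈ V, ∀ v, fderiv ℝ t z v = 0 ↔ v ∈ Submodule.span ℝ (Set.range fun i => W i z) := by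
  have hYli : ∀ z ∈ U, LinearIndependent ℝ fun o : Option ι => o.elim (F z) fun i => W i z :=
    fun z hz => linearIndependent_option.2 ⟨hli z hz, hFW z hz⟩
  -- Transversality of `F` leaves room for at least one parameter, which will be the time.
  obtain ⟨q, rfl⟩ : ∃ q, p = q + 1 := by
    have := (hYli a ha).fintype_card_le_finrank
    rw [Fintype.card_option] at this
    exact ⟨p - 1, by omega⟩
  let Y : Option ι → E → E := fun o => o.elim F W
  have hY : ∀ o z, Y o z = o.elim (F z) fun i => W i z := by rintro (_ | i) z <;> rfl
  have hincl : ∀ z, Submodule.span ℝ (Set.range fun i => W i z) ≤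
      Submodule.span ℝ (Set.range fun o => Y o z) := fun z =>
    Submodule.span_mono (by rintro _ ⟨i, rfl⟩; exact ⟨some i, rfl⟩)
  obtain ⟨V₁, σ, hV₁, haV₁, hVU₁, hσ, hσ'⟩ := exists_time_function hU hW hF hli hbr hFbr hFW ha
  obtain ⟨V₂, g, hV₂, haV₂, hVU₂, hg, hgker⟩ := exists_first_integrals (q := q) (X := Y) hU
    (by rintro (_ | i); exacts [hF, hW i]) (by simpa only [hY] using hYli)
    (by
      rintro (_ | i) (_ | j) z hz
      · simp
      · exact hincl z (hFbr j z hz)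
      · rw [VectorField.lieBracket_swap]
        exact hincl z (neg_mem (hFbr i z hz))
      · exact hincl z (hbr i j z hz))
    (by rw [Fintype.card_option]; omega) ha
  have hσW : ∀ z ∈ V₁, ∀ v ∈ Submodule.span ℝ (Set.range fun i => W i z), fderiv ℝ σ z v = 0 := by
    intro z hz v hv
    have : Submodule.span ℝ (Set.range fun i => W i z) ≤ (fderiv ℝ σ z).ker := by
      rw [Submodule.span_le]
      rintro _ ⟨i, rfl⟩
      exact (hσ' z hz).1 i
    exact this hv
  have hdt : ∀ z ∈ V₁ ∩ V₂, HasFDerivAt (fun z => (Fin.cons (σ z) (g z) : Fin (q + 1) → ℝ))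
      ((fderiv ℝ σ z).finCons (fderiv ℝ g z)) z := fun z hz =>
    HasFDerivAtFilter.finCons
      (((hσ.contDiffAt (hV₁.mem_nhds hz.1)).differentiableAt (by simp)).hasFDerivAt)
      (((hg.contDiffAt (hV₂.mem_nhds hz.2)).differentiableAt (by simp)).hasFDerivAt)
  have hdt' : ∀ z ∈ V₁ ∩ V₂, ∀ v, fderiv ℝ (fun z => (Fin.cons (σ z) (g z) : Fin (q + 1) → ℝ)) z v =
      Fin.cons (fderiv ℝ σ z v) (fderiv ℝ g z v) := fun z hz v => by
    rw [(hdt z hz).fderiv]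
    rfl
  refine ⟨V₁ ∩ V₂, fun z => Fin.cons (σ z) (g z), 0, hV₁.inter hV₂, ⟨haV₁, haV₂⟩,
    fun z hz => hVU₁ hz.1, ?_, fun z hz => ?_, fun z hz v => ?_⟩
  · rw [contDiffOn_pi]
    intro i
    refine Fin.cases ?_ (fun j => ?_) i
    · exact hσ.mono Set.inter_subset_left
    · exact (contDiffOn_pi.1 hg j).mono Set.inter_subset_right
  · have hgF : fderiv ℝ g z (F z) = 0 :=
      (hgker z hz.2 _).2 (Submodule.subset_span ⟨none, rfl⟩)
    rw [hdt' z hz, (hσ' z hz.1).2, hgF]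
    ext i
    refine Fin.cases ?_ (fun j => ?_) i <;> simp
  · rw [hdt' z hz]
    constructor
    · intro h
      have h1 : fderiv ℝ σ z v = 0 := congrFun h 0
      have h2 : fderiv ℝ g z v = 0 := funext fun j => congrFun h j.succ
      rw [hgker z hz.2, Submodule.mem_span_range_iff_exists_fun] at h2
      obtain ⟨κ, rfl⟩ := h2
      rw [Fintype.sum_option] at h1 ⊢
      -- A vector in the kernel of `dg` is a multiple of `F` plus an element of the span of `W`;
      -- `dσ` reads off that multiple.
      have h3 : ∑ i, κ (some i) • Y (some i) z ∈ Submodule.span ℝ (Set.range fun i => W i z) :=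
        Submodule.sum_mem _ fun i _ => Submodule.smul_mem _ _ (Submodule.subset_span ⟨i, rfl⟩)
      rw [map_add, hσW z hz.1 _ h3, map_smul, add_zero] at h1
      have h4 : fderiv ℝ σ z (Y none z) = 1 := (hσ' z hz.1).2
      rw [h4, smul_eq_mul, mul_one] at h1
      rw [h1, zero_smul, zero_add]
      exact h3
    · intro hv
      rw [hσW z hz.1 v hv, (hgker z hz.2 v).2 (hincl z hv)]
      ext i
      refine Fin.cases ?_ (fun j => ?_) i <;> simp

end FlatCoordinates

/-! ### Vector fields on the manifold read in coordinates. -/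

section Representation

variable {m : ℕ} {M : Type*} [TopologicalSpace M] [ChartedSpace (EuclideanSpace ℝ (Fin m)) M]
  [IsManifold (𝓡 m) ∞ M]
  {E : Type*} [NormedAddCommGroup E] [NormedSpace ℝ E] [FiniteDimensional ℝ E]

/-- Smoothness of a vector field at a point. -/
def SmoothAt (X : VField m M) (z : M) : Prop :=
  ContMDiffAt (𝓡 m) (𝓡 m).tangent ∞ (fun z => (⟨z, X z⟩ : TangentBundle (𝓡 m) M)) z

theorem SmoothAt.congr {X Y : VField m M} {z : M} (hX : SmoothAt X z) (h : Y =ᶠ[𝓝 z] X) :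
    SmoothAt Y z :=
  ContMDiffAt.congr_of_eventuallyEq hX (h.mono fun y hy => by simp only [hy])

theorem SmoothAt.mdifferentiableAt {X : VField m M} {z : M} (hX : SmoothAt X z) :
    MDifferentiableAt (𝓡 m) (𝓡 m).tangent
      (fun z => (⟨z, X z⟩ : TangentBundle (𝓡 m) M)) z :=
  ContMDiffAt.mdifferentiableAt hX (by simp)

theorem isManifold_minSmoothness_two :
    IsManifold (𝓡 m) (minSmoothness ℝ 2) M := by
  simp only [minSmoothness_of_isRCLikeNormedField]
  exact IsManifold.of_le (n := ∞) ENat.LEInfty.out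

theorem isManifold_minSmoothness_three :
    IsManifold (𝓡 m) (minSmoothness ℝ 3) M := by
  simp only [minSmoothness_of_isRCLikeNormedField]
  exact IsManifold.of_le (n := ∞) ENat.LEInfty.out

variable (Φ : PartialDiffeomorph (𝓡 m) 𝓘(ℝ, E) M E ∞)

/-- The components, in the coordinates `Φ`, of a vector field. -/
def rep (X : VField m M) (a : E) : E := mfderiv (𝓡 m) 𝓘(ℝ, E) Φ (Φ.symm a) (X (Φ.symm a))

theorem symm_mem_source {a : E} (ha : a ∈ Φ.target) : Φ.symm a ∈ Φ.source := Φ.map_target ha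

theorem isInvertible_mfderiv {z : M} (hz : z ∈ Φ.source) :
    (mfderiv (𝓡 m) 𝓘(ℝ, E) Φ z).IsInvertible :=
  ⟨(Φ.isLocalDiffeomorphAt (𝓡 m) 𝓘(ℝ, E) ∞ hz).mfderivToContinuousLinearEquiv (by simp), rfl⟩

theorem isInvertible_mfderiv_symm {a : E} (ha : a ∈ Φ.target) :
    (mfderiv 𝓘(ℝ, E) (𝓡 m) Φ.symm a).IsInvertible :=
  ⟨(Φ.symm.isLocalDiffeomorphAt 𝓘(ℝ, E) (𝓡 m) ∞ ha).mfderivToContinuousLinearEquiv (by simp), rfl⟩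

theorem mfderiv_symm_apply {z : M} (hz : z ∈ Φ.source) (v : TangentSpace (𝓡 m) z) :
    mfderiv 𝓘(ℝ, E) (𝓡 m) Φ.symm (Φ z) (mfderiv (𝓡 m) 𝓘(ℝ, E) Φ z v) = v := by
  have hz' : Φ z ∈ Φ.symm.source := Φ.map_source hz
  have h1 := Φ.mdifferentiableAt (by simp) hz
  have h2 := Φ.symm.mdifferentiableAt (by simp) hz'
  have h3 := mfderiv_comp z h2 h1
  have h4 : (Φ.symm ∘ Φ : M → M) =ᶠ[𝓝 z] id := by
    filter_upwards [Φ.open_source.mem_nhds hz] with y hy using Φ.left_inv hy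
  rw [h4.mfderiv_eq, mfderiv_id] at h3
  exact (DFunLike.congr_fun h3 v).symm

/-- Links `rep` with the pullback of vector fields, whose smoothness and compatibility with brackets
are then available. -/
theorem mpullback_symm_eq_rep (X : VField m M) {a : E} (ha : a ∈ Φ.target) :
    VectorField.mpullback 𝓘(ℝ, E) (𝓡 m) Φ.symm X a = rep Φ X a := by
  have hz : Φ.symm a ∈ Φ.source := Φ.map_target ha
  have h := mfderiv_symm_apply Φ hz (X (Φ.symm a))
  have h2 : Φ (Φ.symm a) = a := Φ.right_inv ha
  rw [h2] at h
  exact (isInvertible_mfderiv_symm Φ ha).inverse_apply_eq.2 h.symm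

theorem rep_apply {X : VField m M} {z : M} (hz : z ∈ Φ.source) :
    rep Φ X (Φ z) = mfderiv (𝓡 m) 𝓘(ℝ, E) Φ z (X z) := by
  have h : Φ.symm (Φ z) = z := Φ.left_inv hz
  unfold rep
  rw [h]

theorem mpullback_rep_eq (X : VField m M) {z : M} (hz : z ∈ Φ.source) :
    VectorField.mpullback (𝓡 m) 𝓘(ℝ, E) Φ (rep Φ X) z = X z := by
  exact (isInvertible_mfderiv Φ hz).inverse_apply_eq.2 (rep_apply Φ hz)

theorem contDiffAt_rep {X : VField m M} {a : E} (ha : a ∈ Φ.target)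
    (hX : SmoothAt X (Φ.symm a)) : ContDiffAt ℝ ∞ (rep Φ X) a := by
  have h1 : ContMDiffAt 𝓘(ℝ, E) (𝓡 m) ∞ Φ.symm a :=
    Φ.symm.contMDiffOn_toFun.contMDiffAt (Φ.open_target.mem_nhds ha)
  have h2 := ContMDiffAt.mpullback_vectorField_preimage (m := ∞) (n := ∞) hX h1
    (isInvertible_mfderiv_symm Φ ha) (by simp)
  rw [contMDiffAt_vectorSpace_iff_contDiffAt] at h2
  refine h2.congr_of_eventuallyEq ?_
  filter_upwards [Φ.open_target.mem_nhds ha] with b hb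
  exact (mpullback_symm_eq_rep Φ X hb).symm

theorem smoothAt_of_contDiffAt_rep {X : VField m M} {z : M} (hz : z ∈ Φ.source)
    (hX : ContDiffAt ℝ ∞ (rep Φ X) (Φ z)) : SmoothAt X z := by
  have h1 : ContMDiffAt (𝓡 m) 𝓘(ℝ, E) ∞ Φ z :=
    Φ.contMDiffOn_toFun.contMDiffAt (Φ.open_source.mem_nhds hz)
  have hX' := contMDiffAt_vectorSpace_iff_contDiffAt.2 hX
  have h2 := ContMDiffAt.mpullback_vectorField_preimage (m := ∞) (n := ∞) hX' h1
    (isInvertible_mfderiv Φ hz) (by simp)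
  refine SmoothAt.congr h2 ?_
  filter_upwards [Φ.open_source.mem_nhds hz] with y hy
  exact (mpullback_rep_eq Φ X hy).symm

theorem rep_br {X Y : VField m M} {a : E} (ha : a ∈ Φ.target)
    (hX : SmoothAt X (Φ.symm a)) (hY : SmoothAt Y (Φ.symm a)) :
    rep Φ (br X Y) a = VectorField.lieBracket ℝ (rep Φ X) (rep Φ Y) a := by
  have h1 : ContMDiffAt 𝓘(ℝ, E) (𝓡 m) ∞ Φ.symm a :=
    Φ.symm.contMDiffOn_toFun.contMDiffAt (Φ.open_target.mem_nhds ha)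
  have : IsManifold (𝓡 m) (minSmoothness ℝ 2) M := isManifold_minSmoothness_two
  have h2 := VectorField.mpullback_mlieBracket (n := ∞) hX.mdifferentiableAt hY.mdifferentiableAt h1
    (by simp only [minSmoothness_of_isRCLikeNormedField]; exact ENat.LEInfty.out)
  have h3 := congrFun (VectorField.mlieBracketWithin_eq_lieBracketWithin (𝕜 := ℝ) (s := Set.univ)
    (V := VectorField.mpullback 𝓘(ℝ, E) (𝓡 m) Φ.symm X)
    (W := VectorField.mpullback 𝓘(ℝ, E) (𝓡 m) Φ.symm Y)) a
  rw [VectorField.mlieBracketWithin_univ] at h3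
  have h4 : ∀ V W : E → E, VectorField.lieBracketWithin ℝ V W Set.univ a =
      VectorField.lieBracket ℝ V W a := fun V W => congrFun VectorField.lieBracketWithin_univ a
  refine (mpullback_symm_eq_rep Φ _ ha).symm.trans (h2.trans (h3.trans ((h4 _ _).trans ?_)))
  apply Filter.EventuallyEq.lieBracket_vectorField_eq <;>
  · filter_upwards [Φ.open_target.mem_nhds ha] with b hb
    exact mpullback_symm_eq_rep Φ _ hb

theorem SmoothAt.br {X Y : VField m M} {z : M} (hX : SmoothAt X z) (hY : SmoothAt Y z) :
    SmoothAt (br X Y) z := by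
  have : IsManifold (𝓡 m) (minSmoothness ℝ 3) M := isManifold_minSmoothness_three
  have : IsManifold (𝓡 m) (∞ + 1) M := inferInstanceAs (IsManifold (𝓡 m) ∞ M)
  exact ContMDiffAt.mlieBracket_vectorField (m := ⊤) (n := ⊤) hX hY (by simp [minSmoothness_of_isRCLikeNormedField])

end Representation

/-! ### Global sections from local ones, by bump functions. -/

section Extension

variable {m : ℕ} {M : Type*} [TopologicalSpace M] [ChartedSpace (EuclideanSpace ℝ (Fin m)) M]
  [IsManifold (𝓡 m) ∞ M] [T2Space M]

/-- A vector field that is smooth near a point coincides there with a global smooth one, which is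
everywhere a multiple of the given field. -/
theorem exists_smooth_extension {X : VField m M} {U : Set M} (hU : IsOpen U)
    (hX : ∀ z ∈ U, SmoothAt X z) {z : M} (hz : z ∈ U) :
    ∃ X' : VField m M, IsSmooth X' ∧ X' =ᶠ[𝓝 z] X ∧
      ∀ y, ∃ c : ℝ, X' y = c • X y ∧ (y ∉ U → c = 0) := by
  obtain ⟨f, -, hf⟩ := (SmoothBumpFunction.nhds_basis_tsupport (I := 𝓡 m) z).mem_iff.1
    (hU.mem_nhds hz)
  refine ⟨fun y => f y • X y, ?_, ?_, fun y => ⟨f y, rfl, fun hy => ?_⟩⟩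
  · exact ContMDiffOn.smul_section_of_tsupport f.contMDiff.contMDiffOn hU hf
      fun y hy => (hX y hy).contMDiffWithinAt
  · filter_upwards [f.eventuallyEq_one] with y hy
    rw [hy, Pi.one_apply, one_smul]
  · exact image_eq_zero_of_notMem_tsupport fun h => hy (hf h)

/-- A scalar multiple of a vector of `D` stays in `D`; outside `U`, where `X` may leave `D`, the
factor is zero. -/
theorem exists_section_extension {D : SubspaceField m M} {X : VField m M} {U : Set M}
    (hU : IsOpen U) (hX : ∀ z ∈ U, SmoothAt X z) (hXD : ∀ z ∈ U, X z ∈ D z) {z : M} (hz : z ∈ U) :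
    ∃ X' : VField m M, IsSection D X' ∧ X' =ᶠ[𝓝 z] X := by
  obtain ⟨X', h1, h2, h3⟩ := exists_smooth_extension hU hX hz
  refine ⟨X', ⟨h1, fun y => ?_⟩, h2⟩
  obtain ⟨c, hc, hc0⟩ := h3 y
  rw [hc]
  by_cases hy : y ∈ U
  · exact (D y).smul_mem _ (hXD y hy)
  · rw [hc0 hy, zero_smul]
    exact (D y).zero_mem

theorem IsSection.smul {D : SubspaceField m M} {X : VField m M} (hX : IsSection D X) (c : ℝ) :
    IsSection D (c • X) :=
  ⟨ContMDiff.const_smul_section hX.1, fun z => (D z).smul_mem c (hX.2 z)⟩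

theorem IsSection.sum {D : SubspaceField m M} {ι : Type*} {s : Finset ι} {X : ι → VField m M}
    (hX : ∀ i ∈ s, IsSection D (X i)) : IsSection D (fun z => ∑ i ∈ s, X i z) :=
  ⟨ContMDiff.sum_section fun i hi => (hX i hi).1, fun z => (D z).sum_mem fun i hi => (hX i hi).2 z⟩

/-- Every vector of a distribution is the value of a global section. -/
theorem exists_section_apply_eq {n : ℕ} {D : SubspaceField m M} (hD : IsDistribution n D) {z : M}
    {v : TangentSpace (𝓡 m) z} (hv : v ∈ D z) : ∃ X : VField m M, IsSection D X ∧ X z = v := by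
  obtain ⟨U, hU, hzU, X, hX, hXD⟩ := hD z
  have h1 : ∀ i, ∃ X' : VField m M, IsSection D X' ∧ X' =ᶠ[𝓝 z] X i := fun i =>
    exists_section_extension hU (fun y hy => (hX i).contMDiffAt (hU.mem_nhds hy))
      (fun y hy => by rw [← (hXD y hy).2]; exact Submodule.subset_span ⟨i, rfl⟩) hzU
  choose X' hX' hX'X using h1
  rw [← (hXD z hzU).2, Submodule.mem_span_range_iff_exists_fun] at hv
  obtain ⟨c, rfl⟩ := hv
  refine ⟨fun z => ∑ i, (c i • X' i) z, IsSection.sum fun i _ => (hX' i).smul (c i), ?_⟩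
  exact Finset.sum_congr rfl fun i _ => by rw [Pi.smul_apply, (hX'X i).eq_of_nhds]

end Extension

/-! ### Components in coordinates `(t, x, y)`. -/

section Components

variable {m p n : ℕ} {M : Type*} [TopologicalSpace M] [ChartedSpace (EuclideanSpace ℝ (Fin m)) M]
  [IsManifold (𝓡 m) ∞ M]

/-- On the domain of the coordinates `Φ`, the vector field `X` has the smooth components
`(c, A, B)`, with `c` constant. -/
def HasComps (Φ : Coords m M p n) (X : VField m M) (c : Fin p → ℝ)
    (A B : CoordSpace p n → Fin n → ℝ) : Prop :=
  ContDiffOn ℝ ∞ A Φ.target ∧ ContDiffOn ℝ ∞ B Φ.target ∧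
    ∀ a ∈ Φ.target, rep Φ X a = (c, A a, B a)

variable {Φ : Coords m M p n} {X Y : VField m M} {c d : Fin p → ℝ}
  {A B A' B' : CoordSpace p n → Fin n → ℝ}

theorem HasComps.congr (h : HasComps Φ X c A B) (hA : ∀ a ∈ Φ.target, A' a = A a)
    (hB : ∀ a ∈ Φ.target, B' a = B a) : HasComps Φ X c A' B' :=
  ⟨h.1.congr hA, h.2.1.congr hB, fun a ha => by rw [h.2.2 a ha, hA a ha, hB a ha]⟩

theorem HasComps.differentiableAt_left (h : HasComps Φ X c A B) {a : CoordSpace p n}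
    (ha : a ∈ Φ.target) : DifferentiableAt ℝ A a :=
  (h.1.contDiffAt (Φ.open_target.mem_nhds ha)).differentiableAt (by simp)

theorem HasComps.differentiableAt_right (h : HasComps Φ X c A B) {a : CoordSpace p n}
    (ha : a ∈ Φ.target) : DifferentiableAt ℝ B a :=
  (h.2.1.contDiffAt (Φ.open_target.mem_nhds ha)).differentiableAt (by simp)

theorem HasComps.smoothAt (h : HasComps Φ X c A B) {z : M} (hz : z ∈ Φ.source) :
    SmoothAt X z := by
  have ha := Φ.map_source hz
  refine smoothAt_of_contDiffAt_rep Φ hz ?_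
  have : ContDiffOn ℝ ∞ (rep Φ X) Φ.target :=
    (contDiffOn_const.prodMk (h.1.prodMk h.2.1)).congr h.2.2
  exact this.contDiffAt (Φ.open_target.mem_nhds ha)

theorem fderiv_components (c : Fin p → ℝ) {a : CoordSpace p n} (hA : DifferentiableAt ℝ A a)
    (hB : DifferentiableAt ℝ B a) (v : CoordSpace p n) :
    fderiv ℝ (fun a => (c, A a, B a)) a v = (0, fderiv ℝ A a v, fderiv ℝ B a v) := by
  have h := (hasFDerivAt_const c a).prodMk (hA.hasFDerivAt.prodMk hB.hasFDerivAt)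
  rw [h.fderiv]
  rfl

theorem contDiffOn_fderiv_apply {G : Type*} [NormedAddCommGroup G] [NormedSpace ℝ G]
    {g : CoordSpace p n → G} {Z : CoordSpace p n → CoordSpace p n} (hg : ContDiffOn ℝ ∞ g Φ.target)
    (hZ : ContDiffOn ℝ ∞ Z Φ.target) : ContDiffOn ℝ ∞ (fun a => fderiv ℝ g a (Z a)) Φ.target :=
  (hg.fderiv_of_isOpen Φ.open_target (by simp)).clm_apply hZ

/-- Both `t`-components are constant, so the bracket has none. -/
theorem HasComps.br (h : HasComps Φ X c A B) (h' : HasComps Φ Y d A' B') :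
    HasComps Φ (br X Y) 0
      (fun a => fderiv ℝ A' a (c, A a, B a) - fderiv ℝ A a (d, A' a, B' a))
      (fun a => fderiv ℝ B' a (c, A a, B a) - fderiv ℝ B a (d, A' a, B' a)) := by
  have hZ : ContDiffOn ℝ ∞ (fun a => (c, A a, B a)) Φ.target :=
    contDiffOn_const.prodMk (h.1.prodMk h.2.1)
  have hZ' : ContDiffOn ℝ ∞ (fun a => (d, A' a, B' a)) Φ.target :=
    contDiffOn_const.prodMk (h'.1.prodMk h'.2.1)
  refine ⟨(contDiffOn_fderiv_apply h'.1 hZ).sub (contDiffOn_fderiv_apply h.1 hZ'),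
    (contDiffOn_fderiv_apply h'.2.1 hZ).sub (contDiffOn_fderiv_apply h.2.1 hZ'), fun a ha => ?_⟩
  have hz := symm_mem_source Φ ha
  have e : ∀ {X : VField m M} {c A B}, HasComps Φ X c A B →
      rep Φ X =ᶠ[𝓝 a] fun a => (c, A a, B a) := fun h =>
    Filter.eventually_of_mem (Φ.open_target.mem_nhds ha) h.2.2
  rw [rep_br Φ ha (h.smoothAt hz) (h'.smoothAt hz), (e h).lieBracket_vectorField_eq (e h'),
    VectorField.lieBracket, fderiv_components _ (h.differentiableAt_left ha)
    (h.differentiableAt_right ha), fderiv_components _ (h'.differentiableAt_left ha)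
    (h'.differentiableAt_right ha), Prod.mk_sub_mk, Prod.mk_sub_mk, sub_zero]

theorem rep_add (X Y : VField m M) (a : CoordSpace p n) :
    rep Φ (X + Y) a = rep Φ X a + rep Φ Y a :=
  (mfderiv (𝓡 m) 𝓘(ℝ, CoordSpace p n) Φ (Φ.symm a)).map_add _ _

theorem rep_sub (X Y : VField m M) (a : CoordSpace p n) :
    rep Φ (X - Y) a = rep Φ X a - rep Φ Y a :=
  (mfderiv (𝓡 m) 𝓘(ℝ, CoordSpace p n) Φ (Φ.symm a)).map_sub _ _

theorem rep_smul (r : ℝ) (X : VField m M) (a : CoordSpace p n) :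
    rep Φ (r • X) a = r • rep Φ X a :=
  (mfderiv (𝓡 m) 𝓘(ℝ, CoordSpace p n) Φ (Φ.symm a)).map_smul _ _

theorem HasComps.add (h : HasComps Φ X 0 A B) (h' : HasComps Φ Y 0 A' B') :
    HasComps Φ (X + Y) 0 (fun a => A a + A' a) (fun a => B a + B' a) :=
  ⟨h.1.add h'.1, h.2.1.add h'.2.1, fun a ha => by
    rw [rep_add, h.2.2 a ha, h'.2.2 a ha, Prod.mk_add_mk, Prod.mk_add_mk, add_zero]⟩

theorem HasComps.sub (h : HasComps Φ X 0 A B) (h' : HasComps Φ Y 0 A' B') :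
    HasComps Φ (X - Y) 0 (fun a => A a - A' a) (fun a => B a - B' a) :=
  ⟨h.1.sub h'.1, h.2.1.sub h'.2.1, fun a ha => by
    rw [rep_sub, h.2.2 a ha, h'.2.2 a ha, Prod.mk_sub_mk, Prod.mk_sub_mk, sub_zero]⟩

theorem HasComps.smul (r : ℝ) (h : HasComps Φ X 0 A B) :
    HasComps Φ (r • X) 0 (fun a => r • A a) (fun a => r • B a) :=
  ⟨h.1.const_smul r, h.2.1.const_smul r, fun a ha => by
    rw [rep_smul, h.2.2 a ha, Prod.smul_mk, Prod.smul_mk, smul_zero]⟩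

theorem HasComps.neg (h : HasComps Φ X 0 A B) :
    HasComps Φ (-X) 0 (fun a => -A a) (fun a => -B a) := by
  have := h.smul (-1)
  simpa only [neg_smul, one_smul] using this

theorem rep_section {D : SubspaceField m M} (hA : Adapted D Φ) {V : VField m M}
    (hV : ∀ z, V z ∈ D z) {a : CoordSpace p n} (ha : a ∈ Φ.target) :
    rep Φ V a = (0, 0, (rep Φ V a).2.2) := by
  have h := (hA _ (symm_mem_source Φ ha) _).1 (hV (Φ.symm a))
  exact Prod.ext h.1 (Prod.ext h.2 rfl)

theorem IsSection.hasComps {D : SubspaceField m M} (hA : Adapted D Φ) {V : VField m M}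
    (hV : IsSection D V) : HasComps Φ V 0 (fun _ => 0) (fun a => (rep Φ V a).2.2) := by
  refine ⟨contDiffOn_const, fun a ha => ContDiffAt.contDiffWithinAt ?_,
    fun a ha => rep_section hA hV.2 ha⟩
  exact (contDiffAt_rep Φ ha (hV.1 _)).snd.snd

end Components

/-! ### Coordinate formulas for `S`, the projectors, the connection and the mixed curvature. -/

section Curvature

variable {m p n : ℕ} {M : Type*} [TopologicalSpace M] [ChartedSpace (EuclideanSpace ℝ (Fin m)) M]
  [IsManifold (𝓡 m) ∞ M] {Φ : Coords m M p n} {D : SubspaceField m M} {F : VField m M}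
  {c : Fin p → ℝ} {f : CoordSpace p n → Fin n → ℝ} {X V : VField m M}
  {A B v : CoordSpace p n → Fin n → ℝ}

/-- The `x`-components of `F` are the coordinates `y`, whose derivative along `X` is `B`. The term
`-B` is what makes `[F, ∂/∂y^i]` equal to `-∂/∂x^i` modulo vertical fields. -/
theorem HasComps.br_left (hF : HasComps Φ F c (fun a => a.2.2) f) (hX : HasComps Φ X 0 A B) :
    HasComps Φ (SecondOrder.br F X) 0 (fun a => fderiv ℝ A a (c, a.2.2, f a) - B a)
      (fun a => fderiv ℝ B a (c, a.2.2, f a) - fderiv ℝ f a (0, A a, B a)) := by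
  refine (hF.br hX).congr (fun a ha => ?_) fun a ha => rfl
  have : HasFDerivAt (fun a : CoordSpace p n => a.2.2) ((ContinuousLinearMap.snd ℝ (Fin n → ℝ)
      (Fin n → ℝ)).comp (ContinuousLinearMap.snd ℝ (Fin p → ℝ) ((Fin n → ℝ) × (Fin n → ℝ)))) a :=
    ContinuousLinearMap.hasFDerivAt ((ContinuousLinearMap.snd ℝ (Fin n → ℝ)
      (Fin n → ℝ)).comp (ContinuousLinearMap.snd ℝ (Fin p → ℝ) ((Fin n → ℝ) × (Fin n → ℝ))))
  rw [this.fderiv]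
  rfl

variable [T2Space M]

/-- A vertical vector at a point is the value of a section. -/
theorem exists_section_rep_eq (hD : IsDistribution n D)
    (hΦ : Adapted D Φ) {a : CoordSpace p n} (ha : a ∈ Φ.target) (v : Fin n → ℝ) :
    ∃ V : VField m M, IsSection D V ∧ rep Φ V a = (0, 0, v) := by
  have he := isInvertible_mfderiv Φ (symm_mem_source Φ ha)
  set L := mfderiv (𝓡 m) 𝓘(ℝ, CoordSpace p n) Φ (Φ.symm a) with hL
  have h2 : L (L.inverse (0, 0, v)) = (0, 0, v) := he.self_apply_inverse _
  have h1 : L.inverse (0, 0, v) ∈ D (Φ.symm a) :=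
    (hΦ _ (symm_mem_source Φ ha) _).2 ⟨congrArg (fun w : CoordSpace p n => w.1) h2,
      congrArg (fun w : CoordSpace p n => w.2.1) h2⟩
  obtain ⟨V, hV, hVv⟩ := exists_section_apply_eq hD h1
  exact ⟨V, hV, (congrArg L hVv).trans h2⟩

/-- Whatever `V₂` is chosen in `w = V₁ + [F, V₂]`, the `x`-component of `w` is minus the
`y`-component of `V₂`. The choice in `tensorS` is thus immaterial, and `S` moves the `x`-component
into the `y`-slot. -/
theorem rep_opS (hD : IsDistribution n D) (hΦ : Adapted D Φ)
    (hF : HasComps Φ F c (fun a => a.2.2) f) {a : CoordSpace p n} (ha : a ∈ Φ.target)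
    (hX : (rep Φ X a).1 = 0) : rep Φ (opS F D X) a = (0, 0, (rep Φ X a).2.1) := by
  have key : ∀ V, IsSection D V → rep Φ (br F V) a = (0, -(rep Φ V a).2.2,
      (rep Φ (br F V) a).2.2) := fun V hV => by
    have h := (hF.br_left (hV.hasComps hΦ)).2.2 a ha
    rw [h]
    simp
  have hex : ∃ V₂ : VField m M, IsSection D V₂ ∧ ∃ V₁ : VField m M, IsSection D V₁ ∧
      X (Φ.symm a) = V₁ (Φ.symm a) + br F V₂ (Φ.symm a) := by
    obtain ⟨V₂, hV₂, h₂⟩ := exists_section_rep_eq hD hΦ ha (-(rep Φ X a).2.1)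
    have h1 : X (Φ.symm a) - br F V₂ (Φ.symm a) ∈ D (Φ.symm a) := by
      refine (hΦ _ (symm_mem_source Φ ha) _).2 ?_
      have h2 : comps Φ (Φ.symm a) (X (Φ.symm a) - br F V₂ (Φ.symm a)) =
          rep Φ X a - rep Φ (br F V₂) a := rep_sub (Φ := Φ) X (br F V₂) a
      rw [h2, key V₂ hV₂, h₂]
      simp [hX]
    obtain ⟨V₁, hV₁, h₁⟩ := exists_section_apply_eq hD h1
    exact ⟨V₂, hV₂, V₁, hV₁, by rw [h₁, sub_add_cancel]⟩
  obtain ⟨hV₂, V₁, hV₁, h⟩ := hex.choose_spec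
  have hS : opS F D X (Φ.symm a) = -(hex.choose (Φ.symm a)) := by
    unfold opS tensorS
    rw [dif_pos hex]
  have hrep : rep Φ X a = rep Φ V₁ a + rep Φ (br F hex.choose) a := by
    rw [← rep_add]
    exact congrArg (mfderiv (𝓡 m) 𝓘(ℝ, CoordSpace p n) Φ (Φ.symm a)) h
  have h3 : rep Φ (opS F D X) a = -rep Φ hex.choose a :=
    (congrArg (mfderiv (𝓡 m) 𝓘(ℝ, CoordSpace p n) Φ (Φ.symm a)) hS).trans
      ((mfderiv (𝓡 m) 𝓘(ℝ, CoordSpace p n) Φ (Φ.symm a)).map_neg _)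
  rw [h3, hrep, key _ hV₂, rep_section hΦ hV₁.2 ha, rep_section hΦ hV₂.2 ha]
  simp

theorem HasComps.opS (hX : HasComps Φ X 0 A B) (hD : IsDistribution n D)
    (hΦ : Adapted D Φ) (hF : HasComps Φ F c (fun a => a.2.2) f) :
    HasComps Φ (opS F D X) 0 (fun _ => 0) A :=
  ⟨contDiffOn_const, hX.1, fun a ha => by
    rw [rep_opS hD hΦ hF ha (by rw [hX.2.2 a ha]), hX.2.2 a ha]⟩

/-- The derivatives of `A` along `F` cancel between the two terms, leaving an operator linear over
functions: it fixes vertical fields and reverses the `x`-component. -/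
theorem HasComps.lieS (hX : HasComps Φ X 0 A B) (hD : IsDistribution n D)
    (hΦ : Adapted D Φ) (hF : HasComps Φ F c (fun a => a.2.2) f) :
    HasComps Φ (lieS F D X) 0 (fun a => -A a) (fun a => B a - fderiv ℝ f a (0, 0, A a)) := by
  refine ((hF.br_left (hX.opS hD hΦ hF)).sub ((hF.br_left hX).opS hD hΦ hF)).congr ?_ ?_
  · intro a ha
    simp
  · intro a ha
    abel

theorem HasComps.projH (hX : HasComps Φ X 0 A B) (hD : IsDistribution n D)
    (hΦ : Adapted D Φ) (hF : HasComps Φ F c (fun a => a.2.2) f) :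
    HasComps Φ (projH F D X) 0 A (fun a => (1 / 2 : ℝ) • fderiv ℝ f a (0, 0, A a)) := by
  refine ((hX.sub (hX.lieS hD hΦ hF)).smul (1 / 2)).congr ?_ ?_
  · intro a ha
    module
  · intro a ha
    module

theorem HasComps.projV (hX : HasComps Φ X 0 A B) (hD : IsDistribution n D)
    (hΦ : Adapted D Φ) (hF : HasComps Φ F c (fun a => a.2.2) f) :
    HasComps Φ (projV F D X) 0 (fun _ => 0)
      (fun a => B a - (1 / 2 : ℝ) • fderiv ℝ f a (0, 0, A a)) := by
  refine ((hX.add (hX.lieS hD hΦ hF)).smul (1 / 2)).congr ?_ ?_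
  · intro a ha
    module
  · intro a ha
    module

theorem HasComps.hlift (hV : HasComps Φ V 0 (fun _ => 0) v) (hD : IsDistribution n D)
    (hΦ : Adapted D Φ) (hF : HasComps Φ F c (fun a => a.2.2) f) :
    HasComps Φ (hlift F D V) 0 v (fun a => (1 / 2 : ℝ) • fderiv ℝ f a (0, 0, v a)) := by
  refine ((hF.br_left hV).neg.projH hD hΦ hF).congr ?_ ?_ <;>
  · intro a ha
    simp

/-- The derivative of `a ↦ Dg(a)(Z(a))`. -/
theorem fderiv_fderiv_apply {G : Type*} [NormedAddCommGroup G] [NormedSpace ℝ G]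
    {g : CoordSpace p n → G} {Z : CoordSpace p n → CoordSpace p n} {a : CoordSpace p n}
    (hg : ContDiffAt ℝ ∞ g a) (hZ : DifferentiableAt ℝ Z a) (x : CoordSpace p n) :
    fderiv ℝ (fun a => fderiv ℝ g a (Z a)) a x =
      fderiv ℝ (fderiv ℝ g) a x (Z a) + fderiv ℝ g a (fderiv ℝ Z a x) := by
  have h : DifferentiableAt ℝ (fderiv ℝ g) a :=
    (hg.fderiv_right (m := ∞) (by simp)).differentiableAt (by simp)
  rw [fderiv_clm_apply h hZ]
  simp [add_comm]

/-- The derivative of `a ↦ D²g(a)(Y(a), Z(a))`. -/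
theorem fderiv_fderiv_fderiv_apply {G : Type*} [NormedAddCommGroup G] [NormedSpace ℝ G]
    {g : CoordSpace p n → G} {Y Z : CoordSpace p n → CoordSpace p n} {a : CoordSpace p n}
    (hg : ContDiffAt ℝ ∞ g a) (hY : DifferentiableAt ℝ Y a) (hZ : DifferentiableAt ℝ Z a)
    (x : CoordSpace p n) :
    fderiv ℝ (fun a => fderiv ℝ (fderiv ℝ g) a (Y a) (Z a)) a x =
      fderiv ℝ (fderiv ℝ (fderiv ℝ g)) a x (Y a) (Z a) +
        fderiv ℝ (fderiv ℝ g) a (fderiv ℝ Y a x) (Z a) +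
        fderiv ℝ (fderiv ℝ g) a (Y a) (fderiv ℝ Z a x) := by
  have h1 : ContDiffAt ℝ ∞ (fderiv ℝ g) a := hg.fderiv_right (m := ∞) (by simp)
  have h2 : DifferentiableAt ℝ (fun a => fderiv ℝ (fderiv ℝ g) a (Y a)) a :=
    ((h1.fderiv_right (m := ∞) (by simp)).differentiableAt (by simp)).clm_apply hY
  rw [fderiv_clm_apply h2 hZ]
  simp only [add_apply, ContinuousLinearMap.comp_apply, ContinuousLinearMap.flip_apply,
    fderiv_fderiv_apply h1 hY]
  abel

/-- The first summand differentiates `v` along `P_H X`, the second along `P_V X`; together they give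
the derivative along `X`. In the first one the derivative of `½ ∂f/∂y · A` leaves only the second
derivatives of `f`, since `P_V` removes the term with the derivative of `A`. -/
theorem HasComps.nabla (hX : HasComps Φ X 0 A B)
    (hD : IsDistribution n D) (hΦ : Adapted D Φ) (hF : HasComps Φ F c (fun a => a.2.2) f)
    (hV : HasComps Φ V 0 (fun _ => 0) v) :
    HasComps Φ (nabla F D X V) 0 (fun _ => 0) (fun a => fderiv ℝ v a (0, A a, B a) -
      (1 / 2 : ℝ) • fderiv ℝ (fderiv ℝ f) a (0, 0, v a) (0, 0, A a)) := by
  refine ((((hX.projH hD hΦ hF).br hV).projV hD hΦ hF).add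
    (((hX.projV hD hΦ hF).br (hV.hlift hD hΦ hF)).opS hD hΦ hF)).congr ?_ ?_
  · intro a ha
    simp
  · intro a ha
    have hfa : ContDiffAt ℝ ∞ f a := hF.2.1.contDiffAt (Φ.open_target.mem_nhds ha)
    have hA := hX.differentiableAt_left ha
    have hZ : DifferentiableAt ℝ (fun a => ((0 : Fin p → ℝ), (0 : Fin n → ℝ), A a)) a := by
      fun_prop
    have h1 : DifferentiableAt ℝ (fun a => fderiv ℝ f a (0, 0, A a)) a :=
      ((contDiffOn_fderiv_apply hF.2.1 (contDiffOn_const.prodMk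
        (contDiffOn_const.prodMk hX.1))).contDiffAt (Φ.open_target.mem_nhds ha)).differentiableAt
        (by simp)
    have h2 : ∀ x, fderiv ℝ (fun a => ((0 : Fin p → ℝ), (0 : Fin n → ℝ), A a)) a x =
        (0, 0, fderiv ℝ A a x) := fun x => by
      rw [fderiv_components 0 (differentiableAt_const 0) hA]
      simp
    have h3 : ∀ x, fderiv ℝ (fun a => (1 / 2 : ℝ) • fderiv ℝ f a (0, 0, A a)) a x =
        (1 / 2 : ℝ) • (fderiv ℝ (fderiv ℝ f) a x (0, 0, A a) +
          fderiv ℝ f a (0, 0, fderiv ℝ A a x)) := fun x => by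
      rw [fderiv_fun_const_smul h1, smul_apply, fderiv_fderiv_apply hfa hZ, h2]
    have h4 : ∀ b : Fin n → ℝ, ((0 : Fin p → ℝ), A a, b) = (0, A a, 0) + (0, 0, b) := fun b => by
      simp
    have h5 : ∀ b : Fin n → ℝ, ((0 : Fin p → ℝ), (0 : Fin n → ℝ), -b) = -(0, 0, b) := fun b => by
      simp
    have h6 : ∀ b b' : Fin n → ℝ, ((0 : Fin p → ℝ), (0 : Fin n → ℝ), b - b') =
        (0, 0, b) - (0, 0, b') := fun b b' => by
      simp
    simp only [h3, fderiv_fun_const, Pi.zero_apply, zero_apply, zero_sub, sub_zero,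
      h5, map_neg]
    rw [h4 (B a), h4 ((1 / 2 : ℝ) • _), h6, map_add, map_add, map_sub]
    module

/-- Everything cancels, by symmetry of `D²w` and through the bracket term, except the derivative
along `V₂` of the connection coefficient `-½ ∂²f/∂y∂y`, which enters with a minus sign. -/
theorem HasComps.mixedCurvature {V₁ V₂ V₃ : VField m M} {u w : CoordSpace p n → Fin n → ℝ}
    (hu : HasComps Φ V₁ 0 (fun _ => 0) u) (hv : HasComps Φ V₂ 0 (fun _ => 0) v)
    (hw : HasComps Φ V₃ 0 (fun _ => 0) w) (hD : IsDistribution n D) (hΦ : Adapted D Φ)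
    (hF : HasComps Φ F c (fun a => a.2.2) f) :
    HasComps Φ (mixedCurvature F D V₁ V₂ V₃) 0 (fun _ => 0) (fun a => (1 / 2 : ℝ) •
      fderiv ℝ (fderiv ℝ (fderiv ℝ f)) a (0, 0, v a) (0, 0, w a) (0, 0, u a)) := by
  -- The vertical part of the lift stays an unspecified `b`: all terms containing it cancel.
  obtain ⟨b, hl⟩ : ∃ b, HasComps Φ (SecondOrder.hlift F D V₁) 0 u b := ⟨_, hu.hlift hD hΦ hF⟩
  -- Along vertical fields the connection is the plain derivative.
  have h2 : HasComps Φ (SecondOrder.nabla F D V₂ V₃) 0 (fun _ => 0)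
      (fun a => fderiv ℝ w a (0, 0, v a)) :=
    (hv.nabla hD hΦ hF hw).congr (fun a ha => rfl) fun a ha => by
      rw [show ((0 : Fin p → ℝ), (0 : Fin n → ℝ), (0 : Fin n → ℝ)) = 0 from rfl, map_zero,
        smul_zero, sub_zero]
  have h1 := hl.nabla hD hΦ hF hw
  refine (((hl.nabla hD hΦ hF h2).sub (hv.nabla hD hΦ hF h1)).sub
    ((hl.br hv).nabla hD hΦ hF hw)).congr ?_ ?_
  · intro a ha
    simp
  · intro a ha
    have hfa : ContDiffAt ℝ ∞ f a := hF.2.1.contDiffAt (Φ.open_target.mem_nhds ha)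
    have hwa : ContDiffAt ℝ ∞ w a := hw.2.1.contDiffAt (Φ.open_target.mem_nhds ha)
    have hu' := hu.differentiableAt_right ha
    have hv' := hv.differentiableAt_right ha
    have hw' := hw.differentiableAt_right ha
    have hb' := hl.differentiableAt_right ha
    have hZ : ∀ {g : CoordSpace p n → Fin n → ℝ}, DifferentiableAt ℝ g a →
        DifferentiableAt ℝ (fun a => ((0 : Fin p → ℝ), (0 : Fin n → ℝ), g a)) a :=
      fun hg => by fun_prop
    have hZ' : ∀ {g : CoordSpace p n → Fin n → ℝ}, DifferentiableAt ℝ g a → ∀ x,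
        fderiv ℝ (fun a => ((0 : Fin p → ℝ), (0 : Fin n → ℝ), g a)) a x =
          (0, 0, fderiv ℝ g a x) := fun hg x => by
      rw [fderiv_components 0 (differentiableAt_const 0) hg]
      simp
    have hZub : DifferentiableAt ℝ (fun a => ((0 : Fin p → ℝ), u a, b a)) a := by fun_prop
    have e1 : ∀ x, fderiv ℝ (fun a => fderiv ℝ w a (0, 0, v a)) a x =
        fderiv ℝ (fderiv ℝ w) a x (0, 0, v a) + fderiv ℝ w a (0, 0, fderiv ℝ v a x) := fun x => by
      rw [fderiv_fderiv_apply hwa (hZ hv'), hZ' hv']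
    have d2 : DifferentiableAt ℝ (fun a => fderiv ℝ w a (0, u a, b a)) a :=
      ((hwa.fderiv_right (m := ∞) (by simp)).differentiableAt (by simp)).clm_apply hZub
    have d3 : DifferentiableAt ℝ (fun a => fderiv ℝ (fderiv ℝ f) a (0, 0, w a) (0, 0, u a)) a :=
      ((((hfa.fderiv_right (m := ∞) (by simp)).fderiv_right (m := ∞) (by simp)).differentiableAt
        (by simp)).clm_apply (hZ hw')).clm_apply (hZ hu')
    have e2 : ∀ x, fderiv ℝ (fun a => fderiv ℝ w a (0, u a, b a) -
        (1 / 2 : ℝ) • fderiv ℝ (fderiv ℝ f) a (0, 0, w a) (0, 0, u a)) a x =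
        fderiv ℝ (fderiv ℝ w) a x (0, u a, b a) +
          fderiv ℝ w a (0, fderiv ℝ u a x, fderiv ℝ b a x) -
        (1 / 2 : ℝ) • (fderiv ℝ (fderiv ℝ (fderiv ℝ f)) a x (0, 0, w a) (0, 0, u a) +
          fderiv ℝ (fderiv ℝ f) a (0, 0, fderiv ℝ w a x) (0, 0, u a) +
          fderiv ℝ (fderiv ℝ f) a (0, 0, w a) (0, 0, fderiv ℝ u a x)) := fun x => by
      rw [fderiv_fun_sub d2 (d3.fun_const_smul _), fderiv_fun_const_smul d3, sub_apply,
        smul_apply, fderiv_fderiv_apply hwa hZub, fderiv_components 0 hu' hb',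
        fderiv_fderiv_fderiv_apply hfa (hZ hw') (hZ hu'), hZ' hw', hZ' hu']
    have hsym : fderiv ℝ (fderiv ℝ w) a (0, u a, b a) (0, 0, v a) =
        fderiv ℝ (fderiv ℝ w) a (0, 0, v a) (0, u a, b a) :=
      (hwa.isSymmSndFDerivAt (by
        simp only [minSmoothness_of_isRCLikeNormedField]; exact ENat.LEInfty.out)) _ _
    have h5 : ∀ r s : Fin n → ℝ, ((0 : Fin p → ℝ), r, s) = (0, r, 0) + (0, 0, s) := fun r s => by
      simp
    have h6 : ∀ r : Fin n → ℝ, ((0 : Fin p → ℝ), -r, (0 : Fin n → ℝ)) = -(0, r, 0) := fun r => by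
      simp
    have h7 : ∀ r s : Fin n → ℝ, ((0 : Fin p → ℝ), (0 : Fin n → ℝ), r - s) =
        (0, 0, r) - (0, 0, s) := fun r s => by simp
    have h8 : ∀ r : Fin n → ℝ, ((0 : Fin p → ℝ), (0 : Fin n → ℝ), -r) = -(0, 0, r) := fun r => by
      simp
    have h9 : ((0 : Fin p → ℝ), (0 : Fin n → ℝ), (0 : Fin n → ℝ)) = 0 := rfl
    simp only [e1, e2, hsym, fderiv_fun_const, Pi.zero_apply, zero_apply, zero_sub, h8, h9,
      map_zero, map_neg, smul_zero, sub_zero]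
    rw [h5 (fderiv ℝ u a _) (fderiv ℝ b a _), h5 (-fderiv ℝ u a _), h6, h7]
    simp only [map_add, map_neg, map_sub]
    module

end Curvature

/-! ### Second-order Taylor formula. -/

section Polynomial

theorem hasDerivAt_comp_line {E G : Type*} [NormedAddCommGroup E] [NormedSpace ℝ E]
    [NormedAddCommGroup G] [NormedSpace ℝ G] {g : E → G} {T : Set E} (hT : IsOpen T)
    (hg : ContDiffOn ℝ ∞ g T) {a w : E} {r : ℝ} (hr : a + r • w ∈ T) :
    HasDerivAt (fun r : ℝ => g (a + r • w)) (fderiv ℝ g (a + r • w) w) r := by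
  have h1 : HasDerivAt (fun r : ℝ => a + r • w) w r := by
    simpa using ((hasDerivAt_id r).smul_const w).const_add a
  exact ((hg.contDiffAt (hT.mem_nhds hr)).differentiableAt (by simp)).hasFDerivAt.comp_hasDerivAt
    r h1

/-- A map with vanishing third derivative along a segment is there its second Taylor polynomial. -/
theorem eq_taylor_two_of_third_fderiv_eq_zero {E G : Type*} [NormedAddCommGroup E] [NormedSpace ℝ E]
    [NormedAddCommGroup G] [NormedSpace ℝ G] {f : E → G} {T : Set E} (hT : IsOpen T)
    (hf : ContDiffOn ℝ ∞ f T) {a w : E} (hseg : ∀ r ∈ Set.Icc (0 : ℝ) 1, a + r • w ∈ T)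
    (h : ∀ b ∈ T, fderiv ℝ (fderiv ℝ (fderiv ℝ f)) b w w w = 0) :
    f (a + w) = f a + fderiv ℝ f a w + (1 / 2 : ℝ) • fderiv ℝ (fderiv ℝ f) a w w := by
  have hf1 : ContDiffOn ℝ ∞ (fderiv ℝ f) T := hf.fderiv_of_isOpen hT (by simp)
  have hf2 : ContDiffOn ℝ ∞ (fderiv ℝ (fderiv ℝ f)) T := hf1.fderiv_of_isOpen hT (by simp)
  -- The second-order Taylor polynomial based at `a + r w` and evaluated at `a + w`. Its derivative
  -- in `r` is `(1 - r)² / 2` times the third derivative, so it is constant; `r = 0` and `r = 1`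
  -- give the two sides.
  let ψ : ℝ → G := fun r => f (a + r • w) + (1 - r) • fderiv ℝ f (a + r • w) w +
    ((1 - r) ^ 2 / 2) • fderiv ℝ (fderiv ℝ f) (a + r • w) w w
  have hψ : ∀ r ∈ Set.Icc (0 : ℝ) 1, HasDerivAt ψ 0 r := by
    intro r hr
    have hb := hseg r hr
    have e0 := hasDerivAt_comp_line hT hf hb
    have e1 := (hasDerivAt_comp_line hT hf1 hb).clm_apply (hasDerivAt_const r w)
    have e2 := ((hasDerivAt_comp_line hT hf2 hb).clm_apply (hasDerivAt_const r w)).clm_apply (hasDerivAt_const r w)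
    have s1 : HasDerivAt (fun r : ℝ => 1 - r) (-1) r := by
      simpa using (hasDerivAt_id r).const_sub 1
    have s2 : HasDerivAt (fun r : ℝ => (1 - r) ^ 2 / 2) (-(1 - r)) r := by
      refine ((s1.pow 2).div_const 2).congr_deriv ?_
      norm_num
      ring
    refine ((e0.add (s1.smul e1)).add (s2.smul e2)).congr_deriv ?_
    simp only [map_zero, add_zero, h _ hb]
    module
  have h01 := constant_of_has_deriv_right_zero (f := ψ) (a := 0) (b := 1)
    (fun r hr => (hψ r hr).continuousAt.continuousWithinAt)
    (fun r hr => (hψ r ⟨hr.1, hr.2.le⟩).hasDerivWithinAt) 1 ⟨zero_le_one, le_rfl⟩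
  simpa [ψ] using h01

theorem clm_pi_apply {n : ℕ} {H : Type*} [NormedAddCommGroup H] [NormedSpace ℝ H]
    (L : (Fin n → ℝ) →L[ℝ] H) (y : Fin n → ℝ) : L y = ∑ i, y i • L (Pi.single i 1) := by
  conv_lhs => rw [pi_eq_sum_univ' y]
  simp [map_sum]

end Polynomial

/-! ### Vertical derivatives of quadratic maps. -/

section Quadratic

variable {m p n : ℕ} {M : Type*} [TopologicalSpace M] [ChartedSpace (EuclideanSpace ℝ (Fin m)) M]

/-- The map `y ↦ Γ_{ij} y^i y^j + P_i y^i + Q` with coefficients depending on `(t, x)`. -/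
def quadraticMap (Γ : Fin n → Fin n → Fin n → (Fin p → ℝ) × (Fin n → ℝ) → ℝ)
    (P : Fin n → Fin n → (Fin p → ℝ) × (Fin n → ℝ) → ℝ) (Q : Fin n → (Fin p → ℝ) × (Fin n → ℝ) → ℝ)
    (a : CoordSpace p n) (k : Fin n) : ℝ :=
  (∑ i, ∑ j, Γ k i j (a.1, a.2.1) * a.2.2 i * a.2.2 j) + (∑ i, P k i (a.1, a.2.1) * a.2.2 i)
    + Q k (a.1, a.2.1)

variable {Γ : Fin n → Fin n → Fin n → (Fin p → ℝ) × (Fin n → ℝ) → ℝ}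
  {P : Fin n → Fin n → (Fin p → ℝ) × (Fin n → ℝ) → ℝ} {Q : Fin n → (Fin p → ℝ) × (Fin n → ℝ) → ℝ}

theorem fderiv_eq_of_hasLineDerivAt {E G : Type*} [NormedAddCommGroup E] [NormedSpace ℝ E]
    [NormedAddCommGroup G] [NormedSpace ℝ G] {f g : E → G} {T : Set E} (hT : IsOpen T)
    (hf : ContDiffOn ℝ ∞ f T) (hfg : ∀ a ∈ T, f a = g a) {a w : E} {g' : G} (ha : a ∈ T)
    (hg : HasLineDerivAt ℝ g g' a w) : fderiv ℝ f a w = g' := by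
  have h : HasLineDerivAt ℝ f g' a w := hg.congr_of_eventuallyEq
    (Filter.eventually_of_mem (hT.mem_nhds ha) hfg)
  exact (((hf.contDiffAt (hT.mem_nhds ha)).differentiableAt
    (by simp)).hasFDerivAt.hasLineDerivAt w).unique h

/-- Along vertical lines `t` and `x` are fixed, so the coefficients are constants; each derivative
is computed as a line derivative of a polynomial in `y`. -/
theorem third_fderiv_quadraticMap {f : CoordSpace p n → Fin n → ℝ} {T : Set (CoordSpace p n)}
    (hT : IsOpen T) (hf : ContDiffOn ℝ ∞ f T) (hfq : ∀ a ∈ T, f a = quadraticMap Γ P Q a)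
    {a : CoordSpace p n} (ha : a ∈ T) (u v w : Fin n → ℝ) :
    fderiv ℝ (fderiv ℝ (fderiv ℝ f)) a (0, 0, u) (0, 0, v) (0, 0, w) = 0 := by
  have hl : ∀ (b : CoordSpace p n) (x : Fin n → ℝ) (i : Fin n),
      HasDerivAt (fun r : ℝ => b.2.2 i + r * x i) (x i) 0 := fun b x i => by
    simpa using ((hasDerivAt_id (0 : ℝ)).mul_const (x i)).const_add (b.2.2 i)
  have hf1 : ContDiffOn ℝ ∞ (fderiv ℝ f) T := hf.fderiv_of_isOpen hT (by simp)
  have hf2 : ContDiffOn ℝ ∞ (fderiv ℝ (fderiv ℝ f)) T := hf1.fderiv_of_isOpen hT (by simp)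
  have h1 : ∀ b ∈ T, fderiv ℝ f b (0, 0, w) = fun k =>
      (∑ i, ∑ j, Γ k i j (b.1, b.2.1) * (w i * b.2.2 j + b.2.2 i * w j)) +
        ∑ i, P k i (b.1, b.2.1) * w i := fun b hb => by
    refine fderiv_eq_of_hasLineDerivAt hT hf hfq hb ?_
    refine hasDerivAt_pi.2 fun k => ?_
    simp only [quadraticMap, Prod.smul_mk, smul_zero, Prod.fst_add, Prod.snd_add, add_zero,
      Pi.add_apply, Pi.smul_apply, smul_eq_mul, mul_assoc]
    refine (((HasDerivAt.fun_sum fun i _ => HasDerivAt.fun_sum fun j _ =>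
      (((hl b w i).mul (hl b w j)).const_mul (Γ k i j (b.1, b.2.1)))).add
      (HasDerivAt.fun_sum fun i _ => (hl b w i).const_mul (P k i (b.1, b.2.1)))).add_const
      (Q k (b.1, b.2.1))).congr_deriv ?_
    simp
  have h2 : ∀ b ∈ T, fderiv ℝ (fderiv ℝ f) b (0, 0, v) (0, 0, w) = fun k =>
      ∑ i, ∑ j, Γ k i j (b.1, b.2.1) * (w i * v j + v i * w j) := fun b hb => by
    have e := fderiv_eq_of_hasLineDerivAt (w := (0, 0, v)) (g' := fun k =>
      ∑ i, ∑ j, Γ k i j (b.1, b.2.1) * (w i * v j + v i * w j)) hT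
      (hf1.clm_apply contDiffOn_const) h1 hb (by
        refine hasDerivAt_pi.2 fun k => ?_
        simp only [Prod.smul_mk, smul_zero, Prod.fst_add, Prod.snd_add, add_zero,
          Pi.add_apply, Pi.smul_apply, smul_eq_mul]
        exact (HasDerivAt.fun_sum fun i _ => HasDerivAt.fun_sum fun j _ =>
          (((hl b v j).const_mul (w i)).add ((hl b v i).mul_const (w j))).const_mul
            (Γ k i j (b.1, b.2.1))).add_const _)
    rw [← e, fderiv_clm_apply ((hf1.contDiffAt (hT.mem_nhds hb)).differentiableAt (by simp))
      (differentiableAt_const _)]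
    simp
  have e := fderiv_eq_of_hasLineDerivAt (w := (0, 0, u)) (g' := 0) hT
    ((hf2.clm_apply contDiffOn_const).clm_apply contDiffOn_const) h2 ha (by
      simp only [HasLineDerivAt, Prod.smul_mk, smul_zero, Prod.fst_add, Prod.snd_add, add_zero]
      exact hasDerivAt_const _ _)
  have hd := (hf2.contDiffAt (hT.mem_nhds ha)).differentiableAt (by simp)
  rw [fderiv_clm_apply (hd.clm_apply (differentiableAt_const _)) (differentiableAt_const _),
    fderiv_clm_apply hd (differentiableAt_const _)] at e
  simpa using e

end Quadratic

/-! ### Vanishing mixed curvature versus quadratic components. -/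

section Criterion

variable {m p n : ℕ} {M : Type*} [TopologicalSpace M] [ChartedSpace (EuclideanSpace ℝ (Fin m)) M]
  [IsManifold (𝓡 m) ∞ M] [T2Space M] {Φ : Coords m M p n} {D : SubspaceField m M} {F : VField m M}
  {c : Fin p → ℝ} {f : CoordSpace p n → Fin n → ℝ}

/-- The curvature at a point depends only on the values of the three sections there, and these can
be arbitrary vertical vectors. -/
theorem mixedCurvatureVanishesAt_iff (hD : IsDistribution n D) (hΦ : Adapted D Φ)
    (hF : HasComps Φ F c (fun a => a.2.2) f) {a : CoordSpace p n} (ha : a ∈ Φ.target) :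
    MixedCurvatureVanishesAt F D (Φ.symm a) ↔ ∀ u v w : Fin n → ℝ,
      fderiv ℝ (fderiv ℝ (fderiv ℝ f)) a (0, 0, u) (0, 0, v) (0, 0, w) = 0 := by
  have key : ∀ V₁ V₂ V₃ : VField m M, IsSection D V₁ → IsSection D V₂ → IsSection D V₃ →
      rep Φ (mixedCurvature F D V₁ V₂ V₃) a = (0, 0, (1 / 2 : ℝ) •
        fderiv ℝ (fderiv ℝ (fderiv ℝ f)) a (0, 0, (rep Φ V₂ a).2.2) (0, 0, (rep Φ V₃ a).2.2)
          (0, 0, (rep Φ V₁ a).2.2)) := fun V₁ V₂ V₃ h₁ h₂ h₃ =>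
    (HasComps.mixedCurvature (h₁.hasComps hΦ) (h₂.hasComps hΦ) (h₃.hasComps hΦ) hD hΦ hF).2.2 a ha
  constructor
  · intro h u v w
    obtain ⟨V₂, h₂, e₂⟩ := exists_section_rep_eq hD hΦ ha u
    obtain ⟨V₃, h₃, e₃⟩ := exists_section_rep_eq hD hΦ ha v
    obtain ⟨V₁, h₁, e₁⟩ := exists_section_rep_eq hD hΦ ha w
    have h0 : rep Φ (mixedCurvature F D V₁ V₂ V₃) a = 0 :=
      (congrArg (mfderiv (𝓡 m) 𝓘(ℝ, CoordSpace p n) Φ (Φ.symm a)) (h V₁ V₂ V₃ h₁ h₂ h₃)).trans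
        (map_zero _)
    rw [key V₁ V₂ V₃ h₁ h₂ h₃, e₁, e₂, e₃] at h0
    have h1 := congrArg (fun b : CoordSpace p n => b.2.2) h0
    exact (smul_eq_zero.1 h1).resolve_left (by norm_num)
  · intro h V₁ V₂ V₃ h₁ h₂ h₃
    have h0 := key V₁ V₂ V₃ h₁ h₂ h₃
    rw [h, smul_zero] at h0
    exact (isInvertible_mfderiv Φ (symm_mem_source Φ ha)).injective (h0.trans (map_zero _).symm)

theorem IsQuadraticIn.mixedCurvatureVanishesAt (h : IsQuadraticIn F D c Φ)
    (hD : IsDistribution n D) (hF : IsSmooth F) {z : M} (hz : z ∈ Φ.source) :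
    MixedCurvatureVanishesAt F D z := by
  obtain ⟨hΦ, Γ, P, Q, -, -, -, hq⟩ := h
  have hrep : ∀ a ∈ Φ.target, rep Φ F a = (c, a.2.2, quadraticMap Γ P Q a) := fun a ha =>
    hq _ (symm_mem_source Φ ha) a.1 a.2.1 a.2.2 (Φ.right_inv ha)
  have hf : ContDiffOn ℝ ∞ (fun a => (rep Φ F a).2.2) Φ.target := fun a ha =>
    (contDiffAt_rep Φ ha (hF _)).snd.snd.contDiffWithinAt
  have hFc : HasComps Φ F c (fun a => a.2.2) (fun a => (rep Φ F a).2.2) :=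
    ⟨contDiff_snd.snd.contDiffOn, hf, fun a ha => by simp only [hrep a ha]⟩
  have ha := Φ.map_source hz
  have h1 := (mixedCurvatureVanishesAt_iff hD hΦ hFc ha).2 fun u v w =>
    third_fderiv_quadraticMap Φ.open_target hf (fun a ha => by rw [hrep a ha]) ha u v w
  have h2 : Φ.symm (Φ z) = z := Φ.left_inv hz
  rwa [h2] at h1

/-- Used to shrink coordinates until their target is a box. -/
theorem exists_restrict_target (Φ : Coords m M p n) {S : Set (CoordSpace p n)} (hS : IsOpen S) :
    ∃ Ψ : Coords m M p n, Ψ.source = Φ.source ∩ Φ ⁻¹' S ∧ Ψ.target = Φ.target ∩ S ∧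
      ∀ z, Ψ z = Φ z := by
  let e := (Φ.toOpenPartialHomeomorph.symm.restrOpen S hS).symm
  have h1 : e.source = Φ.source ∩ Φ ⁻¹' S :=
    PartialEquiv.restr_target Φ.toPartialEquiv.symm S
  have h2 : e.target = Φ.target ∩ S := Φ.toOpenPartialHomeomorph.symm.restrOpen_source S hS
  exact ⟨{
    toPartialEquiv := e.toPartialEquiv
    open_source := e.open_source
    open_target := e.open_target
    contMDiffOn_toFun := Φ.contMDiffOn_toFun.mono (h1.subset.trans Set.inter_subset_left)
    contMDiffOn_invFun := Φ.contMDiffOn_invFun.mono (h2.subset.trans Set.inter_subset_left) },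
    h1, h2, fun _ => rfl⟩

/-- Components of a map with vanishing third vertical derivatives on a box are quadratic. -/
theorem exists_quadraticMap_eq {b₀ : CoordSpace p n} {ε : ℝ}
    (hf : ContDiffOn ℝ ∞ f (Metric.ball b₀ ε))
    (h : ∀ b ∈ Metric.ball b₀ ε, ∀ u v w : Fin n → ℝ,
      fderiv ℝ (fderiv ℝ (fderiv ℝ f)) b (0, 0, u) (0, 0, v) (0, 0, w) = 0) :
    ∃ (Γ : Fin n → Fin n → Fin n → (Fin p → ℝ) × (Fin n → ℝ) → ℝ)
      (P : Fin n → Fin n → (Fin p → ℝ) × (Fin n → ℝ) → ℝ)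
      (Q : Fin n → (Fin p → ℝ) × (Fin n → ℝ) → ℝ),
      (∀ k i j, ContDiffOn ℝ ∞ (Γ k i j) ((fun a => (a.1, a.2.1)) '' Metric.ball b₀ ε)) ∧
      (∀ k i, ContDiffOn ℝ ∞ (P k i) ((fun a => (a.1, a.2.1)) '' Metric.ball b₀ ε)) ∧
      (∀ k, ContDiffOn ℝ ∞ (Q k) ((fun a => (a.1, a.2.1)) '' Metric.ball b₀ ε)) ∧
      ∀ a ∈ Metric.ball b₀ ε, f a = quadraticMap Γ P Q a := by
  set T := Metric.ball b₀ ε with hTdef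
  have hT : IsOpen T := Metric.isOpen_ball
  -- The ball of the sup norm is a box, so it contains the point at central height `b₀.2.2` over
  -- each of its points, with the vertical segment joining the two. The Taylor expansion is made
  -- from that height.
  set σ : (Fin p → ℝ) × (Fin n → ℝ) → CoordSpace p n := fun s => (s.1, s.2, b₀.2.2) with hσ
  have hσs : ContDiff ℝ ∞ σ := contDiff_fst.prodMk (contDiff_snd.prodMk contDiff_const)
  have hσT : Set.MapsTo σ ((fun a : CoordSpace p n => (a.1, a.2.1)) '' T) T := by
    rintro _ ⟨a, ha, rfl⟩
    rw [hTdef, Metric.mem_ball, Prod.dist_eq, Prod.dist_eq, max_lt_iff, max_lt_iff] at ha ⊢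
    exact ⟨ha.1, ha.2.1, (dist_self b₀.2.2).trans_lt (dist_nonneg.trans_lt ha.1)⟩
  have hf1 : ContDiffOn ℝ ∞ (fderiv ℝ f) T := hf.fderiv_of_isOpen hT (by simp)
  have hf2 : ContDiffOn ℝ ∞ (fderiv ℝ (fderiv ℝ f)) T := hf1.fderiv_of_isOpen hT (by simp)
  have g0 := hf.comp hσs.contDiffOn hσT
  have g1 := hf1.comp hσs.contDiffOn hσT
  have g2 := hf2.comp hσs.contDiffOn hσT
  let e : (Fin n → ℝ) →L[ℝ] CoordSpace p n := (ContinuousLinearMap.inr ℝ (Fin p → ℝ)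
    ((Fin n → ℝ) × (Fin n → ℝ))).comp (ContinuousLinearMap.inr ℝ (Fin n → ℝ) (Fin n → ℝ))
  let η := b₀.2.2
  -- The coefficients come from expanding the Taylor polynomial in `y - η` into powers of `y`.
  refine ⟨fun k i j s => ((1 / 2 : ℝ) •
      fderiv ℝ (fderiv ℝ f) (σ s) (e (Pi.single i 1)) (e (Pi.single j 1))) k,
    fun k i s => (fderiv ℝ f (σ s) (e (Pi.single i 1)) -
      (1 / 2 : ℝ) • (fderiv ℝ (fderiv ℝ f) (σ s) (e η) (e (Pi.single i 1)) +
        fderiv ℝ (fderiv ℝ f) (σ s) (e (Pi.single i 1)) (e η))) k,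
    fun k s => (f (σ s) - fderiv ℝ f (σ s) (e η) +
      (1 / 2 : ℝ) • fderiv ℝ (fderiv ℝ f) (σ s) (e η) (e η)) k, ?_, ?_, ?_, ?_⟩
  · exact fun k i j => contDiffOn_pi.1 (((g2.clm_apply contDiffOn_const).clm_apply
      contDiffOn_const).const_smul (1 / 2 : ℝ)) k
  · exact fun k i => contDiffOn_pi.1 ((g1.clm_apply contDiffOn_const).sub
      ((((g2.clm_apply contDiffOn_const).clm_apply contDiffOn_const).add
      ((g2.clm_apply contDiffOn_const).clm_apply contDiffOn_const)).const_smul (1 / 2 : ℝ))) k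
  · exact fun k => contDiffOn_pi.1 ((g0.sub (g1.clm_apply contDiffOn_const)).add
      (((g2.clm_apply contDiffOn_const).clm_apply contDiffOn_const).const_smul (1 / 2 : ℝ))) k
  · intro a ha
    obtain ⟨s, hs⟩ : ∃ s, s = (a.1, a.2.1) := ⟨_, rfl⟩
    have hsT : σ s ∈ T := hσT ⟨a, ha, hs.symm⟩
    have haw : σ s + e (a.2.2 - η) = a := by
      rw [hs]
      simp [σ, e, η]
    have ht := eq_taylor_two_of_third_fderiv_eq_zero (w := e (a.2.2 - η)) hT hf (fun r hr =>
      (convex_ball b₀ ε).add_smul_mem hsT (by rwa [haw]) hr) (fun b hb => h b hb _ _ _)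
    rw [haw] at ht
    set B := fderiv ℝ (fderiv ℝ f) (σ s) with hB
    set A := fderiv ℝ f (σ s) with hA
    have hA' : ∀ y, A (e y) = ∑ i, y i • A (e (Pi.single i 1)) := clm_pi_apply (A.comp e)
    have hB1 : ∀ x y, B x (e y) = ∑ i, y i • B x (e (Pi.single i 1)) := fun x =>
      clm_pi_apply ((B x).comp e)
    have hB2 : ∀ x y, B (e y) x = ∑ i, y i • B (e (Pi.single i 1)) x := fun x =>
      clm_pi_apply ((B.flip x).comp e)
    have hBB : ∀ y, B (e y) (e y) =
        ∑ i, ∑ j, (y i * y j) • B (e (Pi.single i 1)) (e (Pi.single j 1)) := fun y => by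
      rw [hB2]
      simp only [hB1 _ y, Finset.smul_sum, smul_smul]
    rw [ht]
    funext k
    simp only [quadraticMap, ← hs, ← hA, ← hB]
    have t1 : ∑ i, ∑ j, ((1 / 2 : ℝ) • B (e (Pi.single i 1)) (e (Pi.single j 1))) k * a.2.2 i * a.2.2 j =
        ((1 / 2 : ℝ) • B (e a.2.2) (e a.2.2)) k := by
      rw [hBB]
      simp only [Pi.smul_apply, Finset.sum_apply, smul_eq_mul, Finset.mul_sum]
      exact Finset.sum_congr rfl fun i _ => Finset.sum_congr rfl fun j _ => by ring
    have t2 : ∑ i, (A (e (Pi.single i 1)) - (1 / 2 : ℝ) • (B (e η) (e (Pi.single i 1)) +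
        B (e (Pi.single i 1)) (e η))) k * a.2.2 i =
        (A (e a.2.2) - (1 / 2 : ℝ) • (B (e η) (e a.2.2) + B (e a.2.2) (e η))) k := by
      rw [hA', hB1 (e η) a.2.2, hB2 (e η) a.2.2]
      simp only [Pi.smul_apply, Finset.sum_apply, smul_eq_mul, Pi.sub_apply, Pi.add_apply,
        ← Finset.sum_add_distrib, Finset.mul_sum, ← Finset.sum_sub_distrib]
      exact Finset.sum_congr rfl fun i _ => by ring
    rw [t1, t2]
    simp only [map_sub, sub_apply, Pi.add_apply, Pi.sub_apply, Pi.smul_apply, smul_eq_mul]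
    ring

/-- If the mixed curvature vanishes, second-order coordinates are quadratic after restriction. -/
theorem exists_isQuadraticIn (hD : IsDistribution n D) (hΦ : Adapted D Φ)
    (hF : HasComps Φ F c (fun a => a.2.2) f) {O : Set M} (hO : IsOpen O)
    (h : ∀ z ∈ O, MixedCurvatureVanishesAt F D z) {z : M} (hz : z ∈ Φ.source) (hzO : z ∈ O) :
    ∃ Ψ : Coords m M p n, z ∈ Ψ.source ∧ IsQuadraticIn F D c Ψ := by
  have hU : IsOpen (Φ.target ∩ Φ.symm ⁻¹' O) :=
    Φ.symm.contMDiffOn_toFun.continuousOn.isOpen_inter_preimage Φ.open_target hO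
  have hzU : Φ z ∈ Φ.target ∩ Φ.symm ⁻¹' O := ⟨Φ.map_source hz, by
    have h2 : Φ.symm (Φ z) = z := Φ.left_inv hz
    rwa [Set.mem_preimage, h2]⟩
  obtain ⟨ε, hε, hb⟩ := Metric.isOpen_iff.1 hU _ hzU
  obtain ⟨Ψ, h1, h2, h3⟩ := exists_restrict_target Φ (Metric.isOpen_ball (x := Φ z) (ε := ε))
  have h2' : Ψ.target = Metric.ball (Φ z) ε :=
    h2.trans (Set.inter_eq_right.2 fun b hb' => (hb hb').1)
  have hcomps : ∀ y v, comps Ψ y v = comps Φ y v := by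
    have : (Ψ : M → CoordSpace p n) = Φ := funext h3
    intro y v
    unfold comps
    rw [this]
  obtain ⟨Γ, P, Q, hΓ, hP, hQ, hfq⟩ := exists_quadraticMap_eq (hF.2.1.mono fun b hb' => (hb hb').1)
    fun b hb' => (mixedCurvatureVanishesAt_iff hD hΦ hF (hb hb').1).1 (h _ (hb hb').2)
  have hs : ∀ y ∈ Ψ.source, y ∈ Φ.source ∧ Φ y ∈ Metric.ball (Φ z) ε := fun y hy => by
    rw [h1] at hy
    exact hy
  refine ⟨Ψ, ?_, fun y hy v => ?_, Γ, P, Q, ?_, ?_, ?_, ?_⟩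
  · rw [h1]
    exact ⟨hz, Metric.mem_ball_self hε⟩
  · rw [hcomps]
    exact hΦ y (hs y hy).1 v
  · rwa [h2']
  · rwa [h2']
  · rwa [h2']
  · intro y hy t x w hyw
    rw [hcomps]
    have e1 : comps Φ y (F y) = rep Φ F (Φ y) := (rep_apply Φ (hs y hy).1).symm
    rw [e1, hF.2.2 _ (Φ.map_source (hs y hy).1), hfq _ (hs y hy).2, ← h3, hyw]
    rfl

end Criterion

/-! ### Local frames of the two distributions in a chart. -/

section LocalFrame

variable {m n : ℕ} {M : Type*} [TopologicalSpace M] [ChartedSpace (EuclideanSpace ℝ (Fin m)) M]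
  [IsManifold (𝓡 m) ∞ M]

theorem mem_span_range_comp_iff {ι V W : Type*} [AddCommGroup V] [Module ℝ V] [AddCommGroup W]
    [Module ℝ W] {L : V →ₗ[ℝ] W} (hL : Function.Injective L) (w : ι → V) (v : V) :
    L v ∈ Submodule.span ℝ (Set.range fun i => L (w i)) ↔ v ∈ Submodule.span ℝ (Set.range w) := by
  have : (Set.range fun i => L (w i)) = L '' Set.range w := Set.range_comp L w
  rw [this, ← Submodule.map_span, Submodule.mem_map]
  exact ⟨fun ⟨y, hy, h⟩ => hL h ▸ hy, fun h => ⟨v, h, rfl⟩⟩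

/-- The preferred chart at a point, as a partial diffeomorphism. -/
def chartDiffeo (z : M) :
    PartialDiffeomorph (𝓡 m) 𝓘(ℝ, EuclideanSpace ℝ (Fin m)) M (EuclideanSpace ℝ (Fin m)) ∞ where
  toPartialEquiv := (chartAt (EuclideanSpace ℝ (Fin m)) z).toPartialEquiv
  open_source := (chartAt (EuclideanSpace ℝ (Fin m)) z).open_source
  open_target := (chartAt (EuclideanSpace ℝ (Fin m)) z).open_target
  contMDiffOn_toFun := contMDiffOn_chart
  contMDiffOn_invFun := contMDiffOn_chart_symm

theorem mem_chartDiffeo_source (z : M) : z ∈ (chartDiffeo z : PartialDiffeomorph (𝓡 m)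
    𝓘(ℝ, EuclideanSpace ℝ (Fin m)) M (EuclideanSpace ℝ (Fin m)) ∞).source :=
  mem_chart_source (EuclideanSpace ℝ (Fin m)) z

/-- A section of the span of an involutive frame that vanishes at a point has its derivatives at
that point in the span. -/
theorem fderiv_mem_span_of_eq_zero {E : Type*} [NormedAddCommGroup E] [NormedSpace ℝ E]
    [FiniteDimensional ℝ E] {ι : Type} [Fintype ι] [DecidableEq ι] {q : ℕ} {X : ι → E → E}
    {U : Set E} (hU : IsOpen U) (hX : ∀ i, ContDiffOn ℝ ∞ (X i) U)
    (hli : ∀ z ∈ U, LinearIndependent ℝ fun i => X i z)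
    (hbr : ∀ i j, ∀ z ∈ U,
      VectorField.lieBracket ℝ (X i) (X j) z ∈ Submodule.span ℝ (Set.range fun i => X i z))
    (hdim : Fintype.card ι + q = Module.finrank ℝ E) {a : E} (ha : a ∈ U) {Y : E → E}
    (hY : DifferentiableAt ℝ Y a)
    (hYX : ∀ z ∈ U, Y z ∈ Submodule.span ℝ (Set.range fun i => X i z)) (hYa : Y a = 0) (v : E) :
    fderiv ℝ Y a v ∈ Submodule.span ℝ (Set.range fun i => X i a) := by
  obtain ⟨V, g, hV, haV, hVU, hg, hker⟩ := exists_first_integrals hU hX hli hbr hdim ha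
  rw [← hker a haV]
  -- The span is the kernel of `dg`. Differentiating `dg(Y) = 0` at a zero of `Y` leaves `dg(DY v) =
  -- 0`, without any need for smooth coefficients of `Y` in the frame.
  have h1 : (fun z => fderiv ℝ g z (Y z)) =ᶠ[𝓝 a] fun _ => 0 := by
    filter_upwards [hV.mem_nhds haV] with z hz
    exact (hker z hz _).2 (hYX z (hVU hz))
  have h2 : fderiv ℝ (fun z => fderiv ℝ g z (Y z)) a = 0 :=
    h1.fderiv_eq.trans (by rw [fderiv_fun_const]; rfl)
  have hg1 : DifferentiableAt ℝ (fderiv ℝ g) a :=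
    ((hg.contDiffAt (hV.mem_nhds haV)).fderiv_right (m := ∞) (by simp)).differentiableAt (by simp)
  rw [fderiv_clm_apply hg1 hY, hYa] at h2
  simpa using DFunLike.congr_fun h2 v

/-- Subtract from `V` the constant-coefficient combination of the frame that agrees with it at `a`.
The difference vanishes at `a`, so its bracket with `F` there is its derivative along `F`, which
lies in the span of the frame. -/
theorem lieBracket_mem_span_of_mem_span {E : Type*} [NormedAddCommGroup E] [NormedSpace ℝ E]
    [FiniteDimensional ℝ E] {ι : Type} [Fintype ι] [DecidableEq ι] {q : ℕ} {X : ι → E → E}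
    {U : Set E} (hU : IsOpen U) (hX : ∀ i, ContDiffOn ℝ ∞ (X i) U)
    (hli : ∀ z ∈ U, LinearIndependent ℝ fun i => X i z)
    (hbr : ∀ i j, ∀ z ∈ U,
      VectorField.lieBracket ℝ (X i) (X j) z ∈ Submodule.span ℝ (Set.range fun i => X i z))
    (hdim : Fintype.card ι + q = Module.finrank ℝ E) {a : E} (ha : a ∈ U) {V : E → E}
    (hV : DifferentiableAt ℝ V a)
    (hVX : ∀ z ∈ U, V z ∈ Submodule.span ℝ (Set.range fun i => X i z)) (F : E → E) :
    VectorField.lieBracket ℝ F V a ∈ Submodule.span ℝ (Set.range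
      (Sum.elim (fun i => X i a) fun i => VectorField.lieBracket ℝ F (X i) a)) := by
  obtain ⟨c, hc⟩ := (Submodule.mem_span_range_iff_exists_fun ℝ).1 (hVX a ha)
  have hXa : ∀ i, DifferentiableAt ℝ (X i) a := fun i =>
    ((hX i).contDiffAt (hU.mem_nhds ha)).differentiableAt (by simp)
  have hsum : DifferentiableAt ℝ (fun z => ∑ i, c i • X i z) a :=
    DifferentiableAt.fun_sum fun i _ => (hXa i).const_smul (c i)
  have h1 := fderiv_mem_span_of_eq_zero hU hX hli hbr hdim ha
    (Y := fun z => V z - ∑ i, c i • X i z) (hV.sub hsum)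
    (fun z hz => Submodule.sub_mem _ (hVX z hz) (Submodule.sum_mem _ fun i _ =>
      Submodule.smul_mem _ _ (Submodule.subset_span ⟨i, rfl⟩))) (by simp [hc]) (F a)
  have h2 : VectorField.lieBracket ℝ F V a = fderiv ℝ (fun z => V z - ∑ i, c i • X i z) a (F a) +
      ∑ i, c i • VectorField.lieBracket ℝ F (X i) a := by
    rw [fderiv_fun_sub hV hsum, fderiv_fun_sum fun i _ => (hXa i).fun_const_smul (c i)]
    simp only [VectorField.lieBracket, ← hc, map_sum, map_smul, sub_apply,
      sum_apply, smul_sub, Finset.sum_sub_distrib,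
      fderiv_fun_const_smul (hXa _), smul_apply]
    abel
  rw [h2]
  refine Submodule.add_mem _ (Submodule.span_mono ?_ h1) (Submodule.sum_mem _ fun i _ =>
    Submodule.smul_mem _ _ (Submodule.subset_span ⟨Sum.inr i, rfl⟩))
  rintro _ ⟨i, rfl⟩
  exact ⟨Sum.inl i, rfl⟩

variable [T2Space M]

/-- Involutivity speaks of global sections; brackets are local, so local sections are extended. -/
theorem br_mem_of_involutive {D : SubspaceField m M} (hD : Involutive D) {X Y : VField m M}
    {U : Set M} (hU : IsOpen U) (hX : ∀ z ∈ U, SmoothAt X z) (hY : ∀ z ∈ U, SmoothAt Y z)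
    (hXD : ∀ z ∈ U, X z ∈ D z) (hYD : ∀ z ∈ U, Y z ∈ D z) {z : M} (hz : z ∈ U) :
    br X Y z ∈ D z := by
  obtain ⟨X', hX', eX⟩ := exists_section_extension hU hX hXD hz
  obtain ⟨Y', hY', eY⟩ := exists_section_extension hU hY hYD hz
  have h : br X' Y' z = br X Y z := eX.mlieBracket_vectorField_eq eY
  exact h ▸ hD X' Y' hX' hY' z

theorem br_mem_of_preserves {D : SubspaceField m M} {F : VField m M} (hD : Preserves F D)
    {X : VField m M} {U : Set M} (hU : IsOpen U) (hX : ∀ z ∈ U, SmoothAt X z)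
    (hXD : ∀ z ∈ U, X z ∈ D z) {z : M} (hz : z ∈ U) : br F X z ∈ D z := by
  obtain ⟨X', hX', eX⟩ := exists_section_extension hU hX hXD hz
  have h : br F X' z = br F X z := Filter.EventuallyEq.rfl.mlieBracket_vectorField_eq eX
  exact h ▸ hD X' hX' z

theorem mem_derived_of_mem {D : SubspaceField m M} (hD : IsDistribution n D) (F : VField m M)
    {z : M} {v : TangentSpace (𝓡 m) z} (hv : v ∈ D z) : v ∈ derived F D z := by
  obtain ⟨V, hV, rfl⟩ := exists_section_apply_eq hD hv
  refine Submodule.subset_span ⟨V, (0 : ℝ) • V, hV, hV.smul 0, ?_⟩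
  have : br F ((0 : ℝ) • V) = 0 := by
    rw [zero_smul]
    exact VectorField.mlieBracket_zero_right
  rw [this, Pi.zero_apply, add_zero]

theorem br_mem_derived {D : SubspaceField m M} {F : VField m M} {V : VField m M}
    (hV : IsSection D V) (z : M) : br F V z ∈ derived F D z := by
  refine Submodule.subset_span ⟨(0 : ℝ) • V, V, hV.smul 0, hV, ?_⟩
  rw [Pi.smul_apply, zero_smul, zero_add]

/-- In a chart, a distribution `D` for which `D + [F, D]` has twice its dimension has a smooth
local frame `X` such that `X` and `[F, X]` together form a frame of `D + [F, D]`. -/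
theorem exists_chart_frame {F : VField m M} (hF : IsSmooth F) {D : SubspaceField m M}
    (hD : IsDistribution n D) (hDinv : Involutive D)
    (hW : ∀ z, Module.finrank ℝ (derived F D z) = 2 * n) (hWinv : Involutive (derived F D))
    (hFW : Preserves F (derived F D)) {p : ℕ} (hdim : 2 * n + p = m) (z : M) :
    ∃ (Φ : PartialDiffeomorph (𝓡 m) 𝓘(ℝ, EuclideanSpace ℝ (Fin m)) M (EuclideanSpace ℝ (Fin m)) ∞)
      (U : Set (EuclideanSpace ℝ (Fin m)))
      (X : Fin n → EuclideanSpace ℝ (Fin m) → EuclideanSpace ℝ (Fin m))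
      (W : Fin n ⊕ Fin n → EuclideanSpace ℝ (Fin m) → EuclideanSpace ℝ (Fin m)),
      z ∈ Φ.source ∧ IsOpen U ∧ U ⊆ Φ.target ∧ Φ z ∈ U ∧
      (W = Sum.elim X fun i => VectorField.lieBracket ℝ (rep Φ F) (X i)) ∧
      (∀ i, ContDiffOn ℝ ∞ (X i) U) ∧ (∀ k, ContDiffOn ℝ ∞ (W k) U) ∧
      ContDiffOn ℝ ∞ (rep Φ F) U ∧
      (∀ a ∈ U, LinearIndependent ℝ fun k => W k a) ∧
      (∀ i j, ∀ a ∈ U, VectorField.lieBracket ℝ (X i) (X j) a ∈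
        Submodule.span ℝ (Set.range fun i => X i a)) ∧
      (∀ k l, ∀ a ∈ U, VectorField.lieBracket ℝ (W k) (W l) a ∈
        Submodule.span ℝ (Set.range fun k => W k a)) ∧
      (∀ k, ∀ a ∈ U, VectorField.lieBracket ℝ (rep Φ F) (W k) a ∈
        Submodule.span ℝ (Set.range fun k => W k a)) ∧
      (∀ y ∈ Φ.source, Φ y ∈ U → ∀ v : TangentSpace (𝓡 m) y, v ∈ D y ↔
        (mfderiv (𝓡 m) 𝓘(ℝ, EuclideanSpace ℝ (Fin m)) Φ y v : EuclideanSpace ℝ (Fin m)) ∈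
          Submodule.span ℝ (Set.range fun i => X i (Φ y))) ∧
      ∀ y ∈ Φ.source, Φ y ∈ U → ∀ v : TangentSpace (𝓡 m) y, v ∈ derived F D y ↔
        (mfderiv (𝓡 m) 𝓘(ℝ, EuclideanSpace ℝ (Fin m)) Φ y v : EuclideanSpace ℝ (Fin m)) ∈
          Submodule.span ℝ (Set.range fun k => W k (Φ y)) := by
  obtain ⟨U₀, hU₀, hzU₀, X₀, hX₀, hXD₀⟩ := hD z
  set Φ : PartialDiffeomorph (𝓡 m) 𝓘(ℝ, EuclideanSpace ℝ (Fin m)) M (EuclideanSpace ℝ (Fin m)) ∞ :=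
    chartDiffeo z with hΦ
  have hz : z ∈ Φ.source := mem_chartDiffeo_source z
  have hXs : ∀ i, ∀ y ∈ U₀, SmoothAt (X₀ i) y := fun i y hy => (hX₀ i).contMDiffAt (hU₀.mem_nhds hy)
  have hXmem : ∀ i, ∀ y ∈ U₀, X₀ i y ∈ D y := fun i y hy => by
    rw [← (hXD₀ y hy).2]
    exact Submodule.subset_span ⟨i, rfl⟩
  let W₀ : Fin n ⊕ Fin n → VField m M := Sum.elim X₀ fun i => br F (X₀ i)
  have hWs : ∀ k, ∀ y ∈ U₀, SmoothAt (W₀ k) y := by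
    rintro (i | i) y hy
    · exact hXs i y hy
    · exact SmoothAt.br (hF y) (hXs i y hy)
  have hWmem : ∀ k, ∀ y ∈ U₀, W₀ k y ∈ derived F D y := by
    rintro (i | i) y hy
    · exact mem_derived_of_mem hD F (hXmem i y hy)
    · obtain ⟨X', hX', eX⟩ := exists_section_extension hU₀ (hXs i) (hXmem i) hy
      have h : br F X' y = br F (X₀ i) y := Filter.EventuallyEq.rfl.mlieBracket_vectorField_eq eX
      change br F (X₀ i) y ∈ _
      exact h ▸ br_mem_derived hX' y
  set U : Set (EuclideanSpace ℝ (Fin m)) := Φ.target ∩ Φ.symm ⁻¹' U₀ with hUdef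
  have hU : IsOpen U :=
    Φ.symm.contMDiffOn_toFun.continuousOn.isOpen_inter_preimage Φ.open_target hU₀
  have hzU : Φ z ∈ U := ⟨Φ.map_source hz, by
    have h2 : Φ.symm (Φ z) = z := Φ.left_inv hz
    rwa [Set.mem_preimage, h2]⟩
  have hUs : ∀ y ∈ Φ.source, Φ y ∈ U → y ∈ U₀ := fun y hy hyU => by
    have h2 : Φ.symm (Φ y) = y := Φ.left_inv hy
    exact h2 ▸ hyU.2
  have hrep : ∀ Y : VField m M, (∀ y ∈ U₀, SmoothAt Y y) → ContDiffOn ℝ ∞ (rep Φ Y) U :=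
    fun Y hY a ha => (contDiffAt_rep Φ ha.1 (hY _ ha.2)).contDiffWithinAt
  have hinj : ∀ y ∈ Φ.source, Function.Injective
      (mfderiv (𝓡 m) 𝓘(ℝ, EuclideanSpace ℝ (Fin m)) Φ y) := fun y hy =>
    (isInvertible_mfderiv Φ hy).injective
  have hmem : ∀ {ι : Type} (Y : ι → VField m M), ∀ y ∈ Φ.source, ∀ v : TangentSpace (𝓡 m) y,
      (mfderiv (𝓡 m) 𝓘(ℝ, EuclideanSpace ℝ (Fin m)) Φ y v : EuclideanSpace ℝ (Fin m)) ∈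
        Submodule.span ℝ (Set.range fun i => rep Φ (Y i) (Φ y)) ↔
      v ∈ Submodule.span ℝ (Set.range fun i => Y i y) := by
    intro ι Y y hy v
    have h1 : (fun i => rep Φ (Y i) (Φ y)) = fun i =>
        mfderiv (𝓡 m) 𝓘(ℝ, EuclideanSpace ℝ (Fin m)) Φ y (Y i y) := funext fun i => rep_apply Φ hy
    rw [h1]
    exact mem_span_range_comp_iff (L := (mfderiv (𝓡 m) 𝓘(ℝ, EuclideanSpace ℝ (Fin m)) Φ
      y).toLinearMap) (hinj y hy) (fun i => Y i y) v
  have hmem' : ∀ {ι : Type} (Y : ι → VField m M), ∀ a ∈ U, ∀ Z : VField m M,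
      rep Φ Z a ∈ Submodule.span ℝ (Set.range fun i => rep Φ (Y i) a) ↔
      Z (Φ.symm a) ∈ Submodule.span ℝ (Set.range fun i => Y i (Φ.symm a)) := by
    intro ι Y a ha Z
    exact mem_span_range_comp_iff (L := (mfderiv (𝓡 m) 𝓘(ℝ, EuclideanSpace ℝ (Fin m)) Φ
      (Φ.symm a)).toLinearMap) (hinj _ (symm_mem_source Φ ha.1)) (fun i => Y i (Φ.symm a)) _
  have hli' : ∀ {ι : Type} (Y : ι → VField m M), ∀ a ∈ U,
      LinearIndependent ℝ (fun i => Y i (Φ.symm a)) → LinearIndependent ℝ fun i => rep Φ (Y i) a :=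
    fun Y a ha h => h.map' (mfderiv (𝓡 m) 𝓘(ℝ, EuclideanSpace ℝ (Fin m)) Φ (Φ.symm a)).toLinearMap
      (LinearMap.ker_eq_bot.2 (hinj _ (symm_mem_source Φ ha.1)))
  set X : Fin n → EuclideanSpace ℝ (Fin m) → EuclideanSpace ℝ (Fin m) := fun i => rep Φ (X₀ i)
    with hX
  set W : Fin n ⊕ Fin n → EuclideanSpace ℝ (Fin m) → EuclideanSpace ℝ (Fin m) :=
    Sum.elim X fun i => VectorField.lieBracket ℝ (rep Φ F) (X i) with hWdef
  have hWW : ∀ k, ∀ a ∈ U, W k a = rep Φ (W₀ k) a := by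
    rintro (i | i) a ha
    · rfl
    · exact (rep_br Φ ha.1 (hF _) (hXs i _ ha.2)).symm
  have hXsm : ∀ i, ContDiffOn ℝ ∞ (X i) U := fun i => hrep _ (hXs i)
  have hXli : ∀ a ∈ U, LinearIndependent ℝ fun i => X i a := fun a ha =>
    hli' X₀ a ha (hXD₀ _ ha.2).1
  have hXbr : ∀ i j, ∀ a ∈ U, VectorField.lieBracket ℝ (X i) (X j) a ∈
      Submodule.span ℝ (Set.range fun i => X i a) := fun i j a ha => by
    rw [← rep_br Φ ha.1 (hXs i _ ha.2) (hXs j _ ha.2)]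
    refine (hmem' X₀ a ha _).2 ?_
    rw [(hXD₀ _ ha.2).2]
    exact br_mem_of_involutive hDinv hU₀ (hXs i) (hXs j) (hXmem i) (hXmem j) ha.2
  -- `derived` is spanned by brackets with arbitrary global sections; the local frame and its
  -- brackets with `F` already suffice.
  have hspan : ∀ a ∈ U, Submodule.span ℝ (Set.range fun k => W₀ k (Φ.symm a)) =
      derived F D (Φ.symm a) := by
    intro a ha
    refine le_antisymm (Submodule.span_le.2 ?_) (Submodule.span_le.2 ?_)
    · rintro _ ⟨k, rfl⟩
      exact hWmem k _ ha.2
    · rintro _ ⟨V₁, V₂, h₁, h₂, rfl⟩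
      refine Submodule.add_mem _ ?_ ?_
      · have h := h₁.2 (Φ.symm a)
        rw [← (hXD₀ _ ha.2).2] at h
        refine Submodule.span_mono ?_ h
        rintro _ ⟨i, rfl⟩
        exact ⟨Sum.inl i, rfl⟩
      · refine (hmem' W₀ a ha (br F V₂)).1 ?_
        have h := lieBracket_mem_span_of_mem_span hU hXsm hXli hXbr (q := n + p)
          (by rw [Fintype.card_fin, finrank_euclideanSpace_fin]; lia) ha
          ((contDiffAt_rep Φ ha.1 (h₂.1 _)).differentiableAt (by simp))
          (fun b hb => (hmem' X₀ b hb V₂).2 (by rw [(hXD₀ _ hb.2).2]; exact h₂.2 _)) (rep Φ F)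
        rw [rep_br Φ ha.1 (hF _) (h₂.1 _)]
        have he : (fun k => rep Φ (W₀ k) a) = Sum.elim (fun i => X i a) fun i =>
            VectorField.lieBracket ℝ (rep Φ F) (X i) a := by
          funext k
          rw [← hWW k a ha]
          rcases k with i | i <;> rfl
        rwa [he]
  have hWspan : ∀ a ∈ U, (fun k => W k a) = fun k => rep Φ (W₀ k) a := fun a ha =>
    funext fun k => hWW k a ha
  have hWev : ∀ k, ∀ a ∈ U, W k =ᶠ[𝓝 a] rep Φ (W₀ k) := fun k a ha =>
    Filter.eventually_of_mem (hU.mem_nhds ha) (hWW k)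
  refine ⟨Φ, U, X, W, hz, hU, Set.inter_subset_left, hzU, rfl, hXsm,
    fun k => (hrep _ (hWs k)).congr (hWW k), hrep F fun y _ => hF y, ?_, hXbr, ?_, ?_, ?_, ?_⟩
  · intro a ha
    rw [hWspan a ha]
    -- Independence is a dimension count: `2 n` vectors span a space of dimension `2 n`.
    refine hli' W₀ a ha ((linearIndependent_iff_card_eq_finrank_span).2 ?_)
    rw [Set.finrank, hspan a ha, hW, Fintype.card_sum, Fintype.card_fin, two_mul]
  · intro k l a ha
    rw [hWspan a ha, (hWev k a ha).lieBracket_vectorField_eq (hWev l a ha),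
      ← rep_br Φ ha.1 (hWs k _ ha.2) (hWs l _ ha.2)]
    refine (hmem' W₀ a ha _).2 ?_
    rw [hspan a ha]
    exact br_mem_of_involutive hWinv hU₀ (hWs k) (hWs l) (hWmem k) (hWmem l) ha.2
  · intro k a ha
    rw [hWspan a ha, Filter.EventuallyEq.rfl.lieBracket_vectorField_eq (hWev k a ha),
      ← rep_br Φ ha.1 (hF _) (hWs k _ ha.2)]
    refine (hmem' W₀ a ha _).2 ?_
    rw [hspan a ha]
    exact br_mem_of_preserves hFW hU₀ (hWs k) (hWmem k) ha.2
  · intro y hy hyU v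
    exact ((hmem X₀ y hy v).trans (by rw [(hXD₀ _ (hUs y hy hyU)).2])).symm
  · intro y hy hyU v
    have h2 : Φ.symm (Φ y) = y := Φ.left_inv hy
    have h3 := hspan (Φ y) hyU
    rw [h2] at h3
    rw [hWspan _ hyU]
    exact ((hmem W₀ y hy v).trans (by rw [h3])).symm

end LocalFrame

/-! ### Adapted coordinates on the manifold and the theorem. -/

section Main

variable {m n p : ℕ} {M : Type*} [TopologicalSpace M] [ChartedSpace (EuclideanSpace ℝ (Fin m)) M]

theorem comps_trans (Φ : PartialDiffeomorph (𝓡 m) 𝓘(ℝ, EuclideanSpace ℝ (Fin m)) M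
      (EuclideanSpace ℝ (Fin m)) ∞)
    (Ψ : PartialDiffeomorph 𝓘(ℝ, EuclideanSpace ℝ (Fin m)) 𝓘(ℝ, CoordSpace p n)
      (EuclideanSpace ℝ (Fin m)) (CoordSpace p n) ∞) {y : M} (hy : y ∈ (Φ.trans Ψ).source)
    (v : TangentSpace (𝓡 m) y) :
    comps (Φ.trans Ψ) y v =
      fderiv ℝ Ψ (Φ y) (mfderiv (𝓡 m) 𝓘(ℝ, EuclideanSpace ℝ (Fin m)) Φ y v) := by
  have h1 := Φ.mdifferentiableAt (by simp) hy.1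
  have h2 := Ψ.mdifferentiableAt (by simp) hy.2
  have h3 := DFunLike.congr_fun (mfderiv_comp y h2 h1) v
  refine h3.trans ?_
  rw [mfderiv_eq_fderiv]
  rfl

variable [IsManifold (𝓡 m) ∞ M] [T2Space M]

/-- Coordinates in which `D` is spanned by the `∂/∂y` and `F` is of second order. -/
theorem exists_adapted_coordinates {F : VField m M} (hF : IsSmooth F) {D : SubspaceField m M}
    (hD : IsDistribution n D) (hDinv : Involutive D)
    (hW : ∀ z, Module.finrank ℝ (derived F D z) = 2 * n) (hWinv : Involutive (derived F D))
    (hFW : Preserves F (derived F D)) (hdim : 2 * n + p = m) {O : Set M} (hO : IsOpen O) {z : M}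
    (hz : z ∈ O) (h : (∀ y ∈ O, F y ∈ derived F D y) ∨ ∀ y ∈ O, F y ∉ derived F D y) :
    ∃ (Φ : Coords m M p n) (c : Fin p → ℝ) (f : CoordSpace p n → Fin n → ℝ), z ∈ Φ.source ∧
      Adapted D Φ ∧ HasComps Φ F c (fun a => a.2.2) f ∧
      (F z ∈ derived F D z → c = 0) ∧ (F z ∉ derived F D z → ∃ k, c = Pi.single k 1) := by
  obtain ⟨Φ, U, X, W, hzΦ, hU, hUΦ, hzU, hWdef, hX, hWs, hFs, hWli, hXbr, hWbr, hFbr, hDX, hDW⟩ :=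
    exists_chart_frame hF hD hDinv hW hWinv hFW hdim z
  have hcard : Fintype.card (Fin n ⊕ Fin n) + p = Module.finrank ℝ (EuclideanSpace ℝ (Fin m)) := by
    rw [Fintype.card_sum, Fintype.card_fin, finrank_euclideanSpace_fin]
    lia
  have hFW' : ∀ a ∈ U, rep Φ F a ∈ Submodule.span ℝ (Set.range fun k => W k a) ↔
      F (Φ.symm a) ∈ derived F D (Φ.symm a) := fun a ha => by
    have h2 : Φ (Φ.symm a) = a := Φ.right_inv (hUΦ ha)
    have h1 := hDW (Φ.symm a) (symm_mem_source Φ (hUΦ ha)) (by rwa [h2]) (F (Φ.symm a))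
    have h3 := rep_apply Φ (X := F) (symm_mem_source Φ (hUΦ ha))
    rw [h1, ← h3, h2]
    exact Iff.rfl
  have hzz : Φ.symm (Φ z) = z := Φ.left_inv hzΦ
  have hUO : IsOpen (U ∩ Φ.symm ⁻¹' O) :=
    (Φ.symm.contMDiffOn_toFun.continuousOn.mono hUΦ).isOpen_inter_preimage hU hO
  have hzUO : Φ z ∈ U ∩ Φ.symm ⁻¹' O := ⟨hzU, by rwa [Set.mem_preimage, hzz]⟩
  obtain ⟨V, t, c, hV, hzV, hVU, ht, htF, htker, hc0, hc1⟩ : ∃ (V : Set (EuclideanSpace ℝ (Fin m)))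
      (t : EuclideanSpace ℝ (Fin m) → Fin p → ℝ)
      (c : Fin p → ℝ), IsOpen V ∧ Φ z ∈ V ∧ V ⊆ U ∧ ContDiffOn ℝ ∞ t V ∧
      (∀ a ∈ V, fderiv ℝ t a (rep Φ F a) = c) ∧
      (∀ a ∈ V, ∀ v, fderiv ℝ t a v = 0 ↔ v ∈ Submodule.span ℝ (Set.range fun k => W k a)) ∧
      (F z ∈ derived F D z → c = 0) ∧ (F z ∉ derived F D z → ∃ k, c = Pi.single k 1) := by
    -- In the tangent case any first integrals of `𝒲` serve as `t`, with `c = 0`; in the transverse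
    -- case one of them has to be the time.
    rcases h with h | h
    · obtain ⟨V, t, hV, hzV, hVU, ht, htker⟩ := exists_first_integrals hUO
        (fun k => (hWs k).mono Set.inter_subset_left) (fun a ha => hWli a ha.1)
        (fun k l a ha => hWbr k l a ha.1) hcard hzUO
      exact ⟨V, t, 0, hV, hzV, hVU.trans Set.inter_subset_left, ht,
        fun a ha => (htker a ha _).2 ((hFW' a (hVU ha).1).2 (h _ (hVU ha).2)), htker,
        fun _ => rfl, fun hn => absurd (h z hz) hn⟩
    · obtain ⟨V, t, k, hV, hzV, hVU, ht, htF, htker⟩ := exists_time_submersion hUO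
        (fun k => (hWs k).mono Set.inter_subset_left) (hFs.mono Set.inter_subset_left)
        (fun a ha => hWli a ha.1) (fun k l a ha => hWbr k l a ha.1) (fun k a ha => hFbr k a ha.1)
        (fun a ha hm => h _ ha.2 ((hFW' a ha.1).1 hm)) hcard hzUO
      exact ⟨V, t, _, hV, hzV, hVU.trans Set.inter_subset_left, ht, htF, htker,
        fun hn => absurd hn (h z hz), fun _ => ⟨k, rfl⟩⟩
  have hWa : ∀ a, (fun k => W k a) =
      Sum.elim (fun i => X i a) fun i => VectorField.lieBracket ℝ (rep Φ F) (X i) a := fun a =>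
    funext fun k => by rw [hWdef]; rcases k with i | i <;> rfl
  obtain ⟨Ψ, hzΨ, hΨV, hΨ⟩ := exists_secondOrder_coordinates hV (fun i => (hX i).mono hVU)
    (hFs.mono hVU) (fun a ha => hWa a ▸ hWli a (hVU ha)) (fun i j a ha => hXbr i j a (hVU ha))
    (by rw [finrank_euclideanSpace_fin]; exact hdim) hzV ht htF
    (fun a ha v => hWa a ▸ htker a ha v)
  refine ⟨Φ.trans Ψ, c, fun a => (rep (Φ.trans Ψ) F a).2.2, ⟨hzΦ, hzΨ⟩, ?_,
    ⟨contDiff_snd.snd.contDiffOn, fun a ha => (contDiffAt_rep _ ha (hF _)).snd.snd.contDiffWithinAt,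
      fun a ha => ?_⟩, hc0, hc1⟩
  · intro y hy v
    rw [comps_trans Φ Ψ hy]
    exact (hDX y hy.1 (hVU (hΨV hy.2)) v).trans ((hΨ _ hy.2).1 _)
  · have hy := symm_mem_source (Φ.trans Ψ) ha
    set y := (Φ.trans Ψ).symm a with hydef
    have hya : Ψ (Φ y) = a := (Φ.trans Ψ).right_inv ha
    have h1 : rep (Φ.trans Ψ) F a = fderiv ℝ Ψ (Φ y) (rep Φ F (Φ y)) := by
      rw [rep_apply Φ hy.1]
      exact comps_trans Φ Ψ hy (F y)
    obtain ⟨-, h2, h3⟩ := hΨ (Φ y) hy.2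
    rw [hya] at h3
    rw [← h1] at h2 h3
    exact Prod.ext h2 (Prod.ext h3 rfl)

end Main

end SecondOrder

end

theorem mainTheorem4 {m n : ℕ} {M : Type*} [TopologicalSpace M] [T2Space M]
    [ChartedSpace (EuclideanSpace ℝ (Fin m)) M] [IsManifold (𝓡 m) ∞ M]
    (F : SecondOrder.VField m M) (hF : SecondOrder.IsSmooth F)
    (D : SecondOrder.SubspaceField m M) (hD : SecondOrder.IsDistribution n D)
    (hDinv : SecondOrder.Involutive D)
    (hW : ∀ z, Module.finrank ℝ (SecondOrder.derived F D z) = 2 * n)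
    (hWinv : SecondOrder.Involutive (SecondOrder.derived F D))
    (hFW : SecondOrder.Preserves F (SecondOrder.derived F D))
    (O : Set M) (hO : IsOpen O) :
    ((∀ z ∈ O, F z ∈ SecondOrder.derived F D z) →
      ((∀ z ∈ O, SecondOrder.QuadraticNear n F D z) ↔
        ∀ z ∈ O, SecondOrder.MixedCurvatureVanishesAt F D z)) ∧
    ((∀ z ∈ O, F z ∉ SecondOrder.derived F D z) →
      ((∀ z ∈ O, SecondOrder.TimeDependentQuadraticNear n F D z) ↔
        ∀ z ∈ O, SecondOrder.MixedCurvatureVanishesAt F D z)) := by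
  -- The subtraction is truncated; a point `z` is needed to know `2 n ≤ m`, since `M` may be empty.
  have hdim : ∀ z : M, 2 * n + (m - 2 * n) = m := fun z => by
    have : Module.Finite ℝ (TangentSpace (𝓡 m) z) :=
      inferInstanceAs (Module.Finite ℝ (EuclideanSpace ℝ (Fin m)))
    have h : Module.finrank ℝ (SecondOrder.derived F D z) ≤
        Module.finrank ℝ (EuclideanSpace ℝ (Fin m)) := Submodule.finrank_le _
    rw [hW, finrank_euclideanSpace_fin] at h
    lia
  refine ⟨fun hFO => ⟨fun h z hz => ?_, fun h z hz => ?_⟩,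
    fun hFO => ⟨fun h z hz => ?_, fun h z hz => ?_⟩⟩
  · obtain ⟨Φ, hzΦ, hq⟩ := h z hz
    exact hq.mixedCurvatureVanishesAt hD hF hzΦ
  · obtain ⟨Φ, c, f, hzΦ, hΦ, hFc, hc, -⟩ := SecondOrder.exists_adapted_coordinates hF hD hDinv hW
      hWinv hFW (hdim z) hO hz (.inl hFO)
    rw [hc (hFO z hz)] at hFc
    exact SecondOrder.exists_isQuadraticIn hD hΦ hFc hO h hzΦ hz
  · obtain ⟨k, Φ, hzΦ, hq⟩ := h z hz
    exact hq.mixedCurvatureVanishesAt hD hF hzΦ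
  · obtain ⟨Φ, c, f, hzΦ, hΦ, hFc, -, hc⟩ := SecondOrder.exists_adapted_coordinates hF hD hDinv hW
      hWinv hFW (hdim z) hO hz (.inr hFO)
    obtain ⟨k, rfl⟩ := hc (hFO z hz)
    exact ⟨k, SecondOrder.exists_isQuadraticIn hD hΦ hFc hO h hzΦ hz⟩
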